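/- Let $\mathbb F_q$ be a finite field with $q$ elements and characteristic $p$, $A=\mathbb F_q[T]$, $F=\mathbb F_q(T)$, let $L$ be an algebraically closed field containing $F$ (for instance $\mathbb C_\infty$), let $\bar F$ be the algebraic closure of $F$ in $L$, and let $r\ge 2$. A Drinfeld module $\phi$ of rank $r$ over $L$ is an $\mathbb F_q$-algebra homomorphism from $A$ to the ring $L\langle x\rangle$ of $q$-polynomials $\sum c_ix^{q^i}$ (under addition and composition) with $\phi_T=Tx+g_1x^q+\dots+g_rx^{q^r}$, $g_r\neq0$. Morphisms $u:\phi\to\psi$ are the $u\in L\langle x\rangle$ with $u\phi_b=\psi_bu$ for all $b\in A$, isomorphisms are the invertible ones, and $\mathrm{End}(\phi)$ is an $A$-algebra through $b\mapsto\phi_b$. Fix a basic $J$-invariant $J(\phi)=g_1^{\delta_1}\cdots g_{r-1}^{\delta_{r-1}}/g_r^{\delta_r}$, where the $\delta_i\ge0$ are integers with $\sum_{i=1}^{r-1}\delta_i(q^i-1)=\delta_r(q^r-1)$, $\delta_i\le (q^r-1)/(q^{\gcd(i,r)}-1)$ for $1\le i\le r-1$, and $\gcd(\delta_1,\dots,\delta_r)=1$.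 Let $\mathfrak a=(a)$ be a prime ideal of $A$ with monic generator $a$. Consider pairs $(\phi,f)$, where $\phi$ is a Drinfeld module of rank $r$ over $L$ and $f:\phi\to\phi$ is a monic isogeny whose kernel is isomorphic to $A/\mathfrak a$ as an $A$-module. Two pairs $(\phi,f)$, $(\phi',f')$ are identified if $f'=c^{-1}fd$ for some isomorphisms $c,d:\phi'\to\phi$. The self-isogenous modular polynomial is $$\Phi_{J,a}(X,X)=\prod_{[(\phi,f)]}(X-J(\phi))\in L[X],$$ the product being over the classes of pairs. An imaginary order of degree $r$ is an $A$-algebra $\mathcal O$ that is an order over $A$ in a field extension $K/F$ of degree $r$ having a unique place above the place $\infty$ of $F$. For such $\mathcal O$ put $$H_{\mathcal O,J}(X)=\prod_{[\phi]:\ \mathrm{End}(\phi)\cong\mathcal O}(X-J(\phi)),$$ the product being over the isomorphism classes of Drinfeld modules $\phi$ of rank $r$ over $L$ with $\mathrm{End}(\phi)\cong\mathcal O$ as $A$-algebras, and $$\gamma(\mathcal O,a)=\bigl|\{u\in\mathcal O:\ u\text{ primitive},\ \mathrm{Nm}_{K/F}(u)=c\,a\text{ for some }c\in\mathbb F_q^*\}/\mathcal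 O^*\bigr|,$$ where $u$ is primitive if $u\ne d\beta$ for all non-units $d\in A$ and all $\beta\in\mathcal O$. Then the products defining $\Phi_{J,a}(X,X)$ and every $H_{\mathcal O,J}(X)$ are finite, every $\gamma(\mathcal O,a)$ is finite, and $\gamma(\mathcal O,a)\neq 0$ for only finitely many imaginary orders $\mathcal O$ of degree $r$ up to isomorphism of $A$-algebras. Moreover $$\Phi_{J,a}(X,X)=\prod_{\mathcal O}H_{\mathcal O,J}(X)^{\gamma(\mathcal O,a)},$$ where $\mathcal O$ runs over the imaginary orders of degree $r$ up to isomorphism of $A$-algebras. The coefficients of $\Phi_{J,a}(X,X)$ lie in $\bar F$, are integral over $A$, and are fixed by $\mathrm{Gal}(\bar F/F)=\mathrm{Aut}_F(\bar F)$. If $p\nmid r$, then $\Phi_{J,a}(X,X)\in A[X]$. -/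

import Mathlib

open Polynomial

noncomputable section

set_option linter.unusedSectionVars false

namespace DrinfeldCM

section Twisted

variable (Fq : Type*) [Field Fq] [Fintype Fq] (L : Type*) [Field L]

/-- The `q`-polynomials `∑ cᵢ x^(q^i)` with coefficients in `L`, where `q` is the cardinality
of `Fq`. -/
def qPolynomials : Submodule L L[X] :=
  Submodule.span L (Set.range fun i : ℕ => (X : L[X]) ^ (Fintype.card Fq ^ i))

/-- The ring `L⟨x⟩` of twisted `q`-polynomials: addition is the usual one, multiplication is
composition of polynomials. -/
def TwistedPoly : Type _ := qPolynomials Fq L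

instance : AddCommGroup (TwistedPoly Fq L) :=
  inferInstanceAs (AddCommGroup (qPolynomials Fq L))

variable {Fq L}

/-- The polynomial underlying a twisted `q`-polynomial. -/
def TwistedPoly.poly (f : TwistedPoly Fq L) : L[X] := Subtype.val f

theorem TwistedPoly.ext {f g : TwistedPoly Fq L} (h : f.poly = g.poly) : f = g := Subtype.ext h

theorem TwistedPoly.poly_mem (f : TwistedPoly Fq L) : f.poly ∈ qPolynomials Fq L := f.2

theorem TwistedPoly.poly_add (f g : TwistedPoly Fq L) : (f + g).poly = f.poly + g.poly := rfl

theorem TwistedPoly.poly_zero : (0 : TwistedPoly Fq L).poly = 0 := rfl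

theorem monomial_mem (c : L) (i : ℕ) :
    C c * X ^ (Fintype.card Fq ^ i) ∈ qPolynomials Fq L := by
  rw [← smul_eq_C_mul]
  exact Submodule.smul_mem _ _ (Submodule.subset_span ⟨i, rfl⟩)

theorem add_pow_q {R : Type*} [CommRing R] [Algebra Fq R] (x y : R) (i : ℕ) :
    (x + y) ^ (Fintype.card Fq ^ i) =
      x ^ (Fintype.card Fq ^ i) + y ^ (Fintype.card Fq ^ i) := by
  induction i with
  | zero => simp
  | succ i ih =>
    have h := map_add (FiniteField.frobeniusAlgHom Fq R)
      (x ^ (Fintype.card Fq ^ i)) (y ^ (Fintype.card Fq ^ i))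
    simp only [FiniteField.frobeniusAlgHom_apply] at h
    rw [pow_succ, pow_mul, ih, h, ← pow_mul, ← pow_mul]

theorem algebraMap_pow_q {R : Type*} [CommRing R] [Algebra Fq R] (c : Fq) (i : ℕ) :
    (algebraMap Fq R c) ^ (Fintype.card Fq ^ i) = algebraMap Fq R c := by
  rw [← map_pow, FiniteField.pow_card_pow]

variable [Algebra Fq L]

theorem comp_add_of_mem {f : L[X]} (hf : f ∈ qPolynomials Fq L) (g h : L[X]) :
    f.comp (g + h) = f.comp g + f.comp h := by
  induction hf using Submodule.span_induction with
  | mem x hx => obtain ⟨i, rfl⟩ := hx; simp [add_pow_q]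
  | zero => simp
  | add x y _ _ hx hy => simp only [add_comp, hx, hy]; ring
  | smul c x _ hx => simp only [smul_comp, hx, smul_add]

theorem comp_C_mul_of_mem {f : L[X]} (hf : f ∈ qPolynomials Fq L) (c : Fq) :
    f.comp (C (algebraMap Fq L c) * X) = C (algebraMap Fq L c) * f := by
  induction hf using Submodule.span_induction with
  | mem x hx =>
    obtain ⟨i, rfl⟩ := hx
    simp only [pow_comp, X_comp, mul_pow]
    rw [← C_pow, algebraMap_pow_q]
  | zero => simp
  | add x y _ _ hx hy => simp only [add_comp, hx, hy]; ring
  | smul c' x _ hx => rw [smul_comp, hx, smul_eq_C_mul, smul_eq_C_mul]; ring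

theorem eval_add_of_mem {f : L[X]} (hf : f ∈ qPolynomials Fq L) (x y : L) :
    f.eval (x + y) = f.eval x + f.eval y := by
  have h := congrArg (eval 0) (comp_add_of_mem hf (C x) (C y))
  rw [← C_add] at h
  simpa only [eval_add, eval_comp, eval_C] using h

theorem eval_smul_of_mem {f : L[X]} (hf : f ∈ qPolynomials Fq L) (c : Fq) (x : L) :
    f.eval (c • x) = c • f.eval x := by
  have h := congrArg (eval x) (comp_C_mul_of_mem hf c)
  simpa [eval_comp, Algebra.smul_def] using h

theorem comp_mem {f g : L[X]} (hf : f ∈ qPolynomials Fq L) (hg : g ∈ qPolynomials Fq L) :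
    f.comp g ∈ qPolynomials Fq L := by
  induction hf using Submodule.span_induction with
  | mem x hx =>
    obtain ⟨i, rfl⟩ := hx
    simp only [pow_comp, X_comp]
    induction hg using Submodule.span_induction with
    | mem y hy =>
      obtain ⟨j, rfl⟩ := hy
      refine Submodule.subset_span ⟨j + i, ?_⟩
      simp only [← pow_mul, ← pow_add]
    | zero =>
      rw [zero_pow (pow_ne_zero _ Fintype.card_ne_zero)]
      exact Submodule.zero_mem _
    | add y z _ _ hy hz => rw [add_pow_q]; exact Submodule.add_mem _ hy hz
    | smul c y _ hy => rw [_root_.smul_pow]; exact Submodule.smul_mem _ _ hy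
  | zero => simp
  | add x y _ _ hx hy => rw [add_comp]; exact Submodule.add_mem _ hx hy
  | smul c x _ hx => rw [smul_comp]; exact Submodule.smul_mem _ _ hx

theorem X_mem : (X : L[X]) ∈ qPolynomials Fq L := Submodule.subset_span ⟨0, by simp⟩

instance : Ring (TwistedPoly Fq L) :=
  { (inferInstance : AddCommGroup (TwistedPoly Fq L)) with
    mul := fun f g => ⟨f.poly.comp g.poly, comp_mem f.poly_mem g.poly_mem⟩
    one := ⟨X, X_mem⟩
    mul_assoc := fun f g h => TwistedPoly.ext (comp_assoc f.poly g.poly h.poly)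
    one_mul := fun f => TwistedPoly.ext (X_comp (p := f.poly))
    mul_one := fun f => TwistedPoly.ext (comp_X (p := f.poly))
    left_distrib := fun f g h => TwistedPoly.ext (comp_add_of_mem f.poly_mem g.poly h.poly)
    right_distrib := fun f g h => TwistedPoly.ext (add_comp (p := f.poly))
    zero_mul := fun f => TwistedPoly.ext (zero_comp (p := f.poly))
    mul_zero := fun f => TwistedPoly.ext (by
      have h := comp_add_of_mem f.poly_mem 0 0
      rw [add_zero, left_eq_add] at h
      exact h) }

theorem TwistedPoly.poly_mul (f g : TwistedPoly Fq L) : (f * g).poly = f.poly.comp g.poly := rfl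

theorem TwistedPoly.poly_one : (1 : TwistedPoly Fq L).poly = X := rfl

/-- A constant `c ∈ Fq` is identified with the twisted polynomial `c x`. -/
instance : Algebra Fq (TwistedPoly Fq L) :=
  RingHom.toAlgebra'
    { toFun := fun c => ⟨C (algebraMap Fq L c) * X, by
        simpa using monomial_mem (Fq := Fq) (algebraMap Fq L c) 0⟩
      map_one' := TwistedPoly.ext (by
        change C (algebraMap Fq L 1) * X = X
        simp)
      map_mul' := fun c d => TwistedPoly.ext (by
        change C (algebraMap Fq L (c * d)) * X =
          (C (algebraMap Fq L c) * X).comp (C (algebraMap Fq L d) * X)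
        simp [mul_assoc])
      map_zero' := TwistedPoly.ext (by
        change C (algebraMap Fq L 0) * X = 0
        simp)
      map_add' := fun c d => TwistedPoly.ext (by
        change C (algebraMap Fq L (c + d)) * X =
          C (algebraMap Fq L c) * X + C (algebraMap Fq L d) * X
        simp [add_mul]) }
    (fun c f => TwistedPoly.ext (by
      change (C (algebraMap Fq L c) * X).comp f.poly = f.poly.comp (C (algebraMap Fq L c) * X)
      rw [comp_C_mul_of_mem f.poly_mem]
      simp))

theorem TwistedPoly.poly_algebraMap (c : Fq) :
    (algebraMap Fq (TwistedPoly Fq L) c).poly = C (algebraMap Fq L c) * X := rfl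

/-- A twisted polynomial `f` acts on `L` by `x ↦ f(x)`. -/
def TwistedPoly.evalHom : TwistedPoly Fq L →+* Module.End Fq L where
  toFun f :=
    { toFun := fun x => f.poly.eval x
      map_add' := eval_add_of_mem f.poly_mem
      map_smul' := eval_smul_of_mem f.poly_mem }
  map_one' := LinearMap.ext fun x => by simp [TwistedPoly.poly_one]
  map_mul' f g := LinearMap.ext fun x => by simp [TwistedPoly.poly_mul, eval_comp]
  map_zero' := LinearMap.ext fun x => by simp [TwistedPoly.poly_zero]
  map_add' f g := LinearMap.ext fun x => by simp [TwistedPoly.poly_add]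

/-- The units of `L⟨x⟩` are the `c x` with `c ∈ L` nonzero. -/
theorem TwistedPoly.exists_of_unit (u : (TwistedPoly Fq L)ˣ) :
    ∃ c : L, c ≠ 0 ∧ (u : TwistedPoly Fq L).poly = C c * X := by
  have h : (u : TwistedPoly Fq L).poly.comp (u⁻¹ : (TwistedPoly Fq L)ˣ).val.poly = X := by
    rw [← TwistedPoly.poly_mul, Units.mul_inv, TwistedPoly.poly_one]
  have hd := congrArg natDegree h
  rw [natDegree_comp, natDegree_X] at hd
  have h1 := Nat.eq_one_of_mul_eq_one_right hd
  have h0 : (u : TwistedPoly Fq L).poly.coeff 0 = 0 := by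
    have h2 : (u : TwistedPoly Fq L).poly.eval 0 = 0 :=
      map_zero (TwistedPoly.evalHom (u : TwistedPoly Fq L))
    rwa [← coeff_zero_eq_eval_zero] at h2
  refine ⟨(u : TwistedPoly Fq L).poly.coeff 1, ?_, ?_⟩
  · rw [← h1]
    exact leadingCoeff_ne_zero.2 (ne_zero_of_natDegree_gt (n := 0) (by omega))
  · conv_lhs => rw [eq_X_add_C_of_natDegree_le_one h1.le]
    rw [h0]; simp

end Twisted

section Drinfeld

variable (Fq : Type*) [Field Fq] [Fintype Fq] (L : Type*) [Field L] [Algebra Fq L]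
  [Algebra Fq[X] L]

/-- A Drinfeld `Fq[T]`-module of rank `r` over `L`:
`φ_T(x) = T x + g₁ x^q + ⋯ + g_r x^(q^r)` with `g_r ≠ 0`. -/
structure DrinfeldModule (r : ℕ) where
  toAlgHom : Fq[X] →ₐ[Fq] TwistedPoly Fq L
  coeff_one : (toAlgHom X).poly.coeff 1 = algebraMap Fq[X] L X
  natDegree_eq : (toAlgHom X).poly.natDegree = Fintype.card Fq ^ r

variable {Fq L} {r : ℕ}

namespace DrinfeldModule

/-- The coefficient `gᵢ` of `x^(q^i)` in `φ_T`. -/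
def g (φ : DrinfeldModule Fq L r) (i : ℕ) : L :=
  (φ.toAlgHom X).poly.coeff (Fintype.card Fq ^ i)

/-- `u` is a morphism `φ → ψ`. -/
def IsMorphism (φ ψ : DrinfeldModule Fq L r) (u : TwistedPoly Fq L) : Prop :=
  ∀ a : Fq[X], u * φ.toAlgHom a = ψ.toAlgHom a * u

/-- The endomorphism ring of `φ`, consisting of all `u` with `u φ_a = φ_a u` for all `a`. -/
def endRing (φ : DrinfeldModule Fq L r) : Subring (TwistedPoly Fq L) where
  carrier := {u | φ.IsMorphism φ u}
  mul_mem' {u v} hu hv a := by rw [mul_assoc, hv a, ← mul_assoc, hu a, mul_assoc]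
  one_mem' a := by rw [one_mul, mul_one]
  add_mem' {u v} hu hv a := by rw [add_mul, mul_add, hu a, hv a]
  zero_mem' a := by rw [zero_mul, mul_zero]
  neg_mem' {u} hu a := by rw [neg_mul, mul_neg, hu a]

/-- `Fq[T]` maps to the endomorphism ring of `φ` by `a ↦ φ_a`. -/
instance (φ : DrinfeldModule Fq L r) : Algebra Fq[X] φ.endRing :=
  RingHom.toAlgebra'
    (RingHom.codRestrict (φ.toAlgHom : Fq[X] →+* TwistedPoly Fq L) φ.endRing
      (fun a b => by
        simp only [RingHom.coe_coe]
        rw [← map_mul, ← map_mul, mul_comm]))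
    (fun a u => Subtype.ext (u.2 a).symm)

/-- `φ` and `ψ` are isomorphic: there is an invertible morphism between them. -/
def Isom (φ ψ : DrinfeldModule Fq L r) : Prop :=
  ∃ c : (TwistedPoly Fq L)ˣ, φ.IsMorphism ψ c

theorem IsMorphism.inv {φ ψ : DrinfeldModule Fq L r} {c : (TwistedPoly Fq L)ˣ}
    (h : φ.IsMorphism ψ c) : ψ.IsMorphism φ ((c⁻¹ : (TwistedPoly Fq L)ˣ) : TwistedPoly Fq L) := by
  intro a
  rw [Units.inv_mul_eq_iff_eq_mul, ← mul_assoc, h a, mul_assoc, Units.mul_inv, mul_one]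

theorem IsMorphism.mul {φ ψ χ : DrinfeldModule Fq L r} {u v : TwistedPoly Fq L}
    (hv : ψ.IsMorphism χ v) (hu : φ.IsMorphism ψ u) : φ.IsMorphism χ (v * u) := by
  intro a
  rw [mul_assoc, hu a, ← mul_assoc, hv a, mul_assoc]

theorem IsMorphism.one (φ : DrinfeldModule Fq L r) :
    φ.IsMorphism φ ((1 : (TwistedPoly Fq L)ˣ) : TwistedPoly Fq L) := by
  intro a
  rw [Units.val_one, one_mul, mul_one]

/-- The additive group of `L` with the `Fq[T]`-module structure `a • x = φ_a(x)`. -/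
def Points (_φ : DrinfeldModule Fq L r) : Type _ := L

instance (φ : DrinfeldModule Fq L r) : AddCommGroup φ.Points := inferInstanceAs (AddCommGroup L)

instance (φ : DrinfeldModule Fq L r) : Module Fq[X] φ.Points :=
  Module.compHom L (TwistedPoly.evalHom.comp (φ.toAlgHom : Fq[X] →+* TwistedPoly Fq L))

/-- The kernel of a morphism `φ → ψ`, as a `Fq[T]`-submodule of `L` for the action of `φ`. -/
def IsMorphism.ker {φ ψ : DrinfeldModule Fq L r} {u : TwistedPoly Fq L}
    (h : φ.IsMorphism ψ u) : Submodule Fq[X] φ.Points where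
  carrier := {x : L | u.poly.eval x = 0}
  add_mem' {x y} hx hy := by
    have key : ∀ s t : L, u.poly.eval s = 0 → u.poly.eval t = 0 → u.poly.eval (s + t) = 0 := by
      intro s t hs ht
      rw [eval_add_of_mem u.poly_mem, hs, ht, add_zero]
    exact key x y hx hy
  zero_mem' := map_zero (TwistedPoly.evalHom u)
  smul_mem' a x hx := by
    have key : ∀ y : L, u.poly.eval y = 0 → u.poly.eval ((φ.toAlgHom a).poly.eval y) = 0 := by
      intro y hy
      have h1 := congrArg (fun f : TwistedPoly Fq L => f.poly.eval y) (h a)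
      simp only [TwistedPoly.poly_mul, eval_comp, hy] at h1
      exact h1.trans (map_zero (TwistedPoly.evalHom (ψ.toAlgHom a)))
    exact key x hx

/-- Exponents `δ₁, …, δ_r` of a basic `J`-invariant for rank `r`. -/
def IsBasicExponent (q r : ℕ) (δ : ℕ → ℕ) : Prop :=
  (∑ i ∈ Finset.Ico 1 r, δ i * (q ^ i - 1) = δ r * (q ^ r - 1)) ∧
  (∀ i ∈ Finset.Ico 1 r, δ i ≤ (q ^ r - 1) / (q ^ Nat.gcd i r - 1)) ∧
  (Finset.Icc 1 r).gcd δ = 1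

/-- The value `g₁^δ₁ ⋯ g_{r-1}^δ_{r-1} / g_r^δ_r`. -/
def J (δ : ℕ → ℕ) (φ : DrinfeldModule Fq L r) : L :=
  (∏ i ∈ Finset.Ico 1 r, φ.g i ^ δ i) / φ.g r ^ δ r

theorem g_of_isom {φ ψ : DrinfeldModule Fq L r} (h : φ.Isom ψ) :
    ∃ c : L, c ≠ 0 ∧ ∀ i, φ.g i = ψ.g i * c ^ (Fintype.card Fq ^ i - 1) := by
  obtain ⟨u, hu⟩ := h
  obtain ⟨c, hc, hcu⟩ := TwistedPoly.exists_of_unit u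
  refine ⟨c, hc, fun i => ?_⟩
  have h1 := congrArg TwistedPoly.poly (hu X)
  rw [TwistedPoly.poly_mul, TwistedPoly.poly_mul, hcu] at h1
  have h2 := congrArg (fun p => p.coeff (Fintype.card Fq ^ i)) h1
  simp only [mul_comp, C_comp, X_comp, coeff_C_mul, comp_C_mul_X_coeff] at h2
  have h3 : 1 ≤ Fintype.card Fq ^ i := Nat.one_le_pow _ _ Fintype.card_pos
  have h4 : c ^ (Fintype.card Fq ^ i) = c ^ (Fintype.card Fq ^ i - 1) * c := by
    rw [← pow_succ, Nat.sub_add_cancel h3]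
  rw [h4, mul_comm, ← mul_assoc] at h2
  exact mul_right_cancel₀ hc h2

theorem J_eq_of_isom {δ : ℕ → ℕ} (hδ : IsBasicExponent (Fintype.card Fq) r δ)
    {φ ψ : DrinfeldModule Fq L r} (h : φ.Isom ψ) : φ.J δ = ψ.J δ := by
  obtain ⟨c, hc, hg⟩ := g_of_isom h
  have h1 : ∏ i ∈ Finset.Ico 1 r, φ.g i ^ δ i =
      (∏ i ∈ Finset.Ico 1 r, ψ.g i ^ δ i) * c ^ (δ r * (Fintype.card Fq ^ r - 1)) := by
    rw [← hδ.1, ← Finset.prod_pow_eq_pow_sum, ← Finset.prod_mul_distrib]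
    refine Finset.prod_congr rfl fun i _ => ?_
    rw [hg i, mul_pow, ← pow_mul, mul_comm (δ i)]
  have h2 : φ.g r ^ δ r = ψ.g r ^ δ r * c ^ (δ r * (Fintype.card Fq ^ r - 1)) := by
    rw [hg r, mul_pow, ← pow_mul, mul_comm (δ r)]
  unfold J
  rw [h1, h2, mul_div_mul_right _ _ (pow_ne_zero _ hc)]

end DrinfeldModule

variable (Fq L r)

/-- Isomorphism of Drinfeld modules over `L`. -/
instance isomSetoid : Setoid (DrinfeldModule Fq L r) where
  r := DrinfeldModule.Isom
  iseqv :=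
    { refl := fun φ => ⟨1, DrinfeldModule.IsMorphism.one φ⟩
      symm := fun ⟨c, hc⟩ => ⟨c⁻¹, hc.inv⟩
      trans := fun ⟨c, hc⟩ ⟨d, hd⟩ => ⟨d * c, by
        rw [Units.val_mul]
        exact hd.mul hc⟩ }

/-- Isomorphism classes of Drinfeld modules of rank `r` over `L`. -/
abbrev IsomClass : Type _ := Quotient (isomSetoid Fq L r)

/-- A monic self-isogeny `f : φ → φ` with kernel isomorphic to `Fq[T]/(a)`. -/
structure CyclicSelfIsogeny (a : Fq[X]) where
  φ : DrinfeldModule Fq L r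
  f : TwistedPoly Fq L
  isMorphism : φ.IsMorphism φ f
  monic : f.poly.Monic
  cyclic : Nonempty (isMorphism.ker ≃ₗ[Fq[X]] Fq[X] ⧸ Ideal.span {a})

/-- Two self-isogenies `f : φ → φ` and `f' : φ' → φ'` are isomorphic copies of each other:
`f' = c⁻¹ f d` for isomorphisms `c, d : φ' → φ`. -/
instance copySetoid (a : Fq[X]) : Setoid (CyclicSelfIsogeny Fq L r a) where
  r s s' := ∃ c d : (TwistedPoly Fq L)ˣ, s'.φ.IsMorphism s.φ c ∧ s'.φ.IsMorphism s.φ d ∧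
    s'.f = ((c⁻¹ : (TwistedPoly Fq L)ˣ) : TwistedPoly Fq L) * s.f * d
  iseqv :=
    { refl := fun s => ⟨1, 1, DrinfeldModule.IsMorphism.one _, DrinfeldModule.IsMorphism.one _,
        by simp⟩
      symm := fun ⟨c, d, hc, hd, h⟩ => ⟨c⁻¹, d⁻¹, hc.inv, hd.inv, by
        rw [h]; simp [mul_assoc]⟩
      trans := fun ⟨c, d, hc, hd, h⟩ ⟨c', d', hc', hd', h'⟩ => ⟨c * c', d * d', by
        rw [Units.val_mul]; exact hc.mul hc', by
        rw [Units.val_mul]; exact hd.mul hd', by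
        rw [h', h]; simp [mul_assoc]⟩ }

/-- Cyclic self-isogenies up to isomorphic copy. -/
abbrev CyclicSelfIsogenyClass (a : Fq[X]) : Type _ := Quotient (copySetoid Fq L r a)

variable {r}

/-- The value of a basic `J`-invariant on an isomorphism class. -/
def jClass {δ : ℕ → ℕ} (hδ : DrinfeldModule.IsBasicExponent (Fintype.card Fq) r δ) :
    IsomClass Fq L r → L :=
  Quotient.lift (DrinfeldModule.J δ) fun _ _ h => DrinfeldModule.J_eq_of_isom hδ h

/-- The isomorphism class of the Drinfeld module underlying a class of self-isogenies. -/
def baseClass {a : Fq[X]} : CyclicSelfIsogenyClass Fq L r a → IsomClass Fq L r :=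
  Quotient.lift (fun s => (Quotient.mk _ s.φ : IsomClass Fq L r))
    fun _ _ ⟨c, _, hc, _, _⟩ => Quotient.sound ⟨c⁻¹, hc.inv⟩

/-- The self-isogenous modular polynomial `Φ_{J,a}(X,X)`. -/
def modularPoly {δ : ℕ → ℕ}
    (hδ : DrinfeldModule.IsBasicExponent (Fintype.card Fq) r δ) (a : Fq[X]) : L[X] :=
  ∏ᶠ s : CyclicSelfIsogenyClass Fq L r a, (X - C (jClass Fq L hδ (baseClass Fq L s)))

variable {Fq L}

/-- The isomorphism classes `[φ]` of Drinfeld modules of rank `r` with `End(φ) ≅ O` as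
`Fq[T]`-algebras. -/
def cmClasses (r : ℕ) (O : Subalgebra Fq[X] L) : Set (IsomClass Fq L r) :=
  {x | ∃ φ : DrinfeldModule Fq L r,
    (Quotient.mk _ φ : IsomClass Fq L r) = x ∧ Nonempty (φ.endRing ≃ₐ[Fq[X]] O)}

/-- The Hilbert class polynomial `H_{O,J}(X)`. -/
def hilbertClassPoly {δ : ℕ → ℕ}
    (hδ : DrinfeldModule.IsBasicExponent (Fintype.card Fq) r δ) (O : Subalgebra Fq[X] L) : L[X] :=
  ∏ᶠ x ∈ cmClasses r O, (X - C (jClass Fq L hδ x))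

end Drinfeld

section Orders

variable {Fq : Type*} [Field Fq] {L : Type*} [Field L] [Algebra Fq[X] L]
  [Algebra (RatFunc Fq) L]

/-- The field of fractions `K = F(O)` of a subring `O` of `L`, where `F = Fq(T)`. -/
abbrev fracField (O : Subalgebra Fq[X] L) : IntermediateField (RatFunc Fq) L :=
  IntermediateField.adjoin (RatFunc Fq) (O : Set L)

open Classical in
/-- There is a unique place of `K` over the place `∞` of `Fq(T)`; places are given by their
valuation rings. -/
def IsImaginary (K : IntermediateField (RatFunc Fq) L) : Prop :=
  ∃! V : ValuationSubring K,
    V.comap (algebraMap (RatFunc Fq) K) = (RatFunc.inftyValuation Fq).valuationSubring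

/-- `O` is an order over `Fq[T]` in an imaginary extension of `Fq(T)` of degree `r`. -/
structure IsImaginaryOrder (r : ℕ) (O : Subalgebra Fq[X] L) : Prop where
  finite : Module.Finite Fq[X] O
  finrank_eq : Module.finrank (RatFunc Fq) (fracField O) = r
  imaginary : IsImaginary (fracField O)

/-- `u ∈ O` is primitive: it is not of the form `d β` with `d ∈ Fq[T]` a non-unit, `β ∈ O`. -/
def IsPrimitive (O : Subalgebra Fq[X] L) (u : O) : Prop :=
  ∀ (d : Fq[X]) (β : O), u = d • β → IsUnit d

/-- The norm `Nm_{K/F}(u)` of `u ∈ O`, where `K` is the field of fractions of `O`. -/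
def fieldNorm (O : Subalgebra Fq[X] L) (u : O) : RatFunc Fq :=
  Algebra.norm (RatFunc Fq)
    (⟨(u : L), IntermediateField.subset_adjoin (RatFunc Fq) (O : Set L) u.2⟩ : fracField O)

/-- The primitive elements of `O` of norm `c a` with `c ∈ Fq` nonzero, modulo `Oˣ`. -/
def normClasses (O : Subalgebra Fq[X] L) (a : Fq[X]) : Set (Associates O) :=
  Associates.mk '' {u : O | IsPrimitive O u ∧
    ∃ c : Fq, c ≠ 0 ∧ fieldNorm O u = algebraMap Fq[X] (RatFunc Fq) (C c * a)}

/-- The exponent `γ(O,a)`. -/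
def gammaExp (O : Subalgebra Fq[X] L) (a : Fq[X]) : ℕ := (normClasses O a).ncard

/-- `R` is a system of representatives for the imaginary orders of degree `r` up to isomorphism
of `Fq[T]`-algebras. -/
def IsOrderReps (r : ℕ) (R : Set (Subalgebra Fq[X] L)) : Prop :=
  (∀ O ∈ R, IsImaginaryOrder r O) ∧
  ∀ O : Subalgebra Fq[X] L, IsImaginaryOrder r O → ∃! O', O' ∈ R ∧ Nonempty (O ≃ₐ[Fq[X]] O')

end Orders

end DrinfeldCM

end

/-!
Let `t = φ_T`. An endomorphism of `φ` is a twisted polynomial commuting with `t`, and in generic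
characteristic it is determined by its derivative, so `End φ` is identified with a subring
`endImage φ` of `L` (`endEquiv`). The left `L`-vector space `L⟨x⟩`, with `X` acting as right
multiplication by `t`, is the motive of `φ`: it is generated over `L[X]` by `1, τ, …, τ^(r-1)`, and
an endomorphism `u` acts on it by a matrix whose entries have controlled degrees. The
Cayley–Hamilton theorem, followed by an `Fq`-linear functional applied to the coefficients, gives a
monic equation of degree `r` for `u` over `Fq[t]`, with the bounds that hold if all conjugates of
`u` have absolute value `q ^ (deg u / r)` at infinity (`exists_monic_evalPair_eq_zero`). The same
bounds show that `deg u` defines a place of the field of fractions of `End φ`, the only one over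
`∞` (`isImaginary_fracField_endImage`).

*The product formula.* Let `a` be prime. Comparing norms with degrees, an endomorphism has kernel
`Fq[T] / (a)` if and only if its derivative has degree `r` over `Fq(T)` and norm `c a` with
`c ∈ Fq*` (`hasPrimeNorm_of_ker_equiv`, `ker_equiv_of_hasPrimeNorm`). In that case `End φ` is an
imaginary order of degree `r`, and the classes of pairs over the class of `φ` correspond to the
elements of `End φ` of norm `c a`, up to units (`finite_and_ncard_fibre`); such elements are
automatically primitive since `r ≥ 2`. Sorting the classes of pairs by the endomorphism ring gives
the formula (`modularPoly_eq_finprod`).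

*Finiteness and integrality.* Elements of norm `c a` generating an imaginary field have size
`|a| ^ (1 / r)` at infinity, so their minimal polynomials are bounded and there are finitely many of
them (`finite_setOf_hasPrimeNorm`), and each lies in finitely many orders with the field it
generates as field of fractions (`finite_setOf_order`). For a fixed derivative `α` of degree `r`
and a bounded degree, the pairs `(t, u)` with `t` of leading coefficient `1` form a closed subset
of affine space. By good reduction of modules with complex multiplication (`good_reduction`) the
coordinates of its points over any extension field lie in every valuation ring containing `T`, so
they are integral; a closed subset all of whose points are algebraic is finite
(`finite_zeroSet_of_forall_isAlgebraic`). This bounds the number of modules and shows that the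
values of `J` are integral over `Fq[T]`.

*Rationality.* Automorphisms of `L` over `Fq(T)` permute the classes of pairs, and automorphisms of
the algebraic closure of `Fq(T)` extend to `L`, whence the Galois invariance. If `p ∤ r`, the
derivative `α` of a self-isogeny is separable over `Fq(T)`. Then `α` is a simple root of the
characteristic polynomial of `u` on the motive, and the pair `(t, u)` has no first order
deformations with the same derivatives (`eq_zero_of_deformation`). Hence the coefficients of `t`
are separable over `Fq(T)`: let `E` be a subfield of `L` containing `T`, `α` and the
`q`-th powers of all coefficients of `t` and `u`. An `E`-linear map that kills `E`, applied to the
coefficients in the relation `u t = t u`, gives a deformation, so it kills all coefficients and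
these lie in `E` (`tc_mem_of_pow_mem`); descending along `p`-th roots, they are separable
(`isSeparable_tc`). So the modular polynomial has separable, Galois invariant
and integral coefficients, and these lie in `Fq[T]`.
-/

noncomputable section

set_option linter.unusedSectionVars false

namespace DrinfeldCM

/-! ### Coefficients and degree of twisted polynomials -/

namespace TwistedPoly

section Coeff

variable {Fq : Type*} [Field Fq] [Fintype Fq] {L : Type*} [Field L]

/-- The coefficient of `x^(q^i)`, that is, of `τ^i`. -/
def tc (f : TwistedPoly Fq L) (i : ℕ) : L := f.poly.coeff (Fintype.card Fq ^ i)

/-- The monomial `c τ^i`. -/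
def mono (c : L) (i : ℕ) : TwistedPoly Fq L := ⟨C c * X ^ (Fintype.card Fq ^ i), monomial_mem c i⟩

theorem one_lt_q : 1 < Fintype.card Fq := Fintype.one_lt_card

theorem q_pow_injective : Function.Injective fun i : ℕ => Fintype.card Fq ^ i :=
  Nat.pow_right_injective (one_lt_q (Fq := Fq))

@[simp] theorem tc_mono (c : L) (i n : ℕ) :
    (mono c i : TwistedPoly Fq L).tc n = if n = i then c else 0 := by
  change (C c * X ^ (Fintype.card Fq ^ i) : L[X]).coeff _ = _
  rw [coeff_C_mul, coeff_X_pow]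
  simp [(q_pow_injective (Fq := Fq)).eq_iff]

@[simp] theorem tc_zero (i : ℕ) : (0 : TwistedPoly Fq L).tc i = 0 := by simp [tc, poly_zero]

@[simp] theorem tc_add (f g : TwistedPoly Fq L) (i : ℕ) : (f + g).tc i = f.tc i + g.tc i := by
  simp [tc, poly_add]

@[simp] theorem tc_neg (f : TwistedPoly Fq L) (i : ℕ) : (-f).tc i = -f.tc i :=
  Polynomial.coeff_neg _ _

@[simp] theorem tc_sub (f g : TwistedPoly Fq L) (i : ℕ) : (f - g).tc i = f.tc i - g.tc i :=
  Polynomial.coeff_sub _ _ _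

instance : Module L (TwistedPoly Fq L) := inferInstanceAs (Module L (qPolynomials Fq L))

@[simp] theorem tc_smul (c : L) (f : TwistedPoly Fq L) (i : ℕ) : (c • f).tc i = c * f.tc i :=
  Polynomial.coeff_smul _ _ _

theorem poly_smul (c : L) (f : TwistedPoly Fq L) : (c • f).poly = C c * f.poly :=
  Polynomial.smul_eq_C_mul _

variable (Fq L) in
/-- The coefficient of `τ^i` as an additive map. -/
def tcHom (i : ℕ) : TwistedPoly Fq L →+ L where
  toFun f := f.tc i
  map_zero' := tc_zero i
  map_add' f g := tc_add f g i

@[simp] theorem tc_sum {ι : Type*} (s : Finset ι) (f : ι → TwistedPoly Fq L) (i : ℕ) :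
    (∑ j ∈ s, f j).tc i = ∑ j ∈ s, (f j).tc i :=
  map_sum (tcHom Fq L i) f s

@[elab_as_elim] theorem induction_mono {P : TwistedPoly Fq L → Prop} (f : TwistedPoly Fq L)
    (h0 : P 0) (hadd : ∀ f g, P f → P g → P (f + g)) (hmono : ∀ c i, P (mono c i)) : P f := by
  -- the scalar `c` is carried along because `P` is not assumed to be stable under scalars
  suffices H : ∀ p ∈ qPolynomials Fq L, ∀ (c : L) (g : TwistedPoly Fq L),
      g.poly = C c * p → P g from H f.poly f.poly_mem 1 f (by simp)
  intro p hp
  induction hp using Submodule.span_induction with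
  | mem x hx =>
    obtain ⟨i, rfl⟩ := hx
    intro c g hg
    rw [show g = mono c i from TwistedPoly.ext hg]
    exact hmono c i
  | zero =>
    intro c g hg
    rw [show g = 0 from TwistedPoly.ext (by rw [hg, mul_zero, poly_zero])]
    exact h0
  | add x y hx' hy' hx hy =>
    intro c g hg
    have hcx : C c * x ∈ qPolynomials Fq L := by
      rw [← Polynomial.smul_eq_C_mul]; exact Submodule.smul_mem _ c hx'
    have hcy : C c * y ∈ qPolynomials Fq L := by
      rw [← Polynomial.smul_eq_C_mul]; exact Submodule.smul_mem _ c hy'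
    rw [show g = (⟨C c * x, hcx⟩ : qPolynomials Fq L) + (⟨C c * y, hcy⟩ : qPolynomials Fq L) from
      TwistedPoly.ext (by rw [hg, mul_add]; rfl)]
    exact hadd _ _ (hx c _ rfl) (hy c _ rfl)
  | smul d x hx' hx =>
    intro c g hg
    exact hx (c * d) g (by rw [hg, Polynomial.smul_eq_C_mul, C_mul, mul_assoc])

theorem coeff_eq_zero_of_forall_ne (f : TwistedPoly Fq L) (n : ℕ)
    (hn : ∀ i, n ≠ Fintype.card Fq ^ i) : f.poly.coeff n = 0 := by
  induction f using induction_mono with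
  | h0 => rfl
  | hadd f g hf hg => rw [poly_add, coeff_add, hf, hg, add_zero]
  | hmono c i =>
    change (C c * X ^ (Fintype.card Fq ^ i) : L[X]).coeff n = 0
    rw [coeff_C_mul, coeff_X_pow, if_neg (hn i), mul_zero]

theorem ext_tc {f g : TwistedPoly Fq L} (h : ∀ i, f.tc i = g.tc i) : f = g := by
  refine TwistedPoly.ext (Polynomial.ext fun n => ?_)
  by_cases hn : ∃ i, n = Fintype.card Fq ^ i
  · obtain ⟨i, rfl⟩ := hn
    exact h i
  · push Not at hn
    rw [coeff_eq_zero_of_forall_ne f n hn, coeff_eq_zero_of_forall_ne g n hn]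

theorem exists_tc_eq_zero (f : TwistedPoly Fq L) : ∃ N, ∀ i ≥ N, f.tc i = 0 := by
  refine ⟨f.poly.natDegree + 1, fun i hi => coeff_eq_zero_of_natDegree_lt ?_⟩
  have := (Nat.lt_pow_self (one_lt_q (Fq := Fq)) : i < _)
  omega

theorem eq_sum_mono (f : TwistedPoly Fq L) {N : ℕ} (hN : ∀ i ≥ N, f.tc i = 0) :
    f = ∑ i ∈ Finset.range N, mono (f.tc i) i := by
  refine ext_tc fun n => ?_
  rw [tc_sum]
  simp only [tc_mono]
  rw [Finset.sum_ite_eq]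
  split_ifs with h
  · rfl
  · exact hN n (by simpa using h)

/-- The degree in `τ`; it is `0` for the zero polynomial. -/
def tdeg (f : TwistedPoly Fq L) : ℕ := Nat.log (Fintype.card Fq) f.poly.natDegree

theorem natDegree_eq_pow {f : TwistedPoly Fq L} (hf : f ≠ 0) :
    f.poly.natDegree = Fintype.card Fq ^ f.tdeg := by
  have h0 : f.poly ≠ 0 := fun h => hf (TwistedPoly.ext h)
  by_cases hn : ∃ i, f.poly.natDegree = Fintype.card Fq ^ i
  · obtain ⟨i, hi⟩ := hn
    rw [tdeg, hi, Nat.log_pow (one_lt_q (Fq := Fq))]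
  · push Not at hn
    exact absurd (coeff_eq_zero_of_forall_ne f _ hn) (leadingCoeff_ne_zero.2 h0)

theorem tc_tdeg_eq_leadingCoeff {f : TwistedPoly Fq L} (hf : f ≠ 0) :
    f.tc f.tdeg = f.poly.leadingCoeff := by
  rw [tc, ← natDegree_eq_pow hf]
  rfl

theorem tc_tdeg_ne_zero {f : TwistedPoly Fq L} (hf : f ≠ 0) : f.tc f.tdeg ≠ 0 := by
  rw [tc_tdeg_eq_leadingCoeff hf]
  exact leadingCoeff_ne_zero.2 fun h => hf (TwistedPoly.ext h)

theorem tc_eq_zero_of_tdeg_lt {f : TwistedPoly Fq L} {i : ℕ} (hi : f.tdeg < i) : f.tc i = 0 := by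
  by_cases hf : f = 0
  · rw [hf, tc_zero]
  · refine coeff_eq_zero_of_natDegree_lt ?_
    rw [natDegree_eq_pow hf]
    exact Nat.pow_lt_pow_right (one_lt_q (Fq := Fq)) hi

theorem le_tdeg_of_ne_zero {f : TwistedPoly Fq L} {i : ℕ} (h : f.tc i ≠ 0) : i ≤ f.tdeg :=
  not_lt.1 fun hi => h (tc_eq_zero_of_tdeg_lt hi)

theorem tdeg_le_of_forall {f : TwistedPoly Fq L} {n : ℕ} (h : ∀ i > n, f.tc i = 0) :
    f.tdeg ≤ n := by
  by_cases hf : f = 0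
  · simp [hf, tdeg, poly_zero]
  · exact not_lt.1 fun hn => tc_tdeg_ne_zero hf (h _ hn)

theorem tdeg_eq_of {f : TwistedPoly Fq L} {n : ℕ} (h0 : f.tc n ≠ 0) (h : ∀ i > n, f.tc i = 0) :
    f.tdeg = n :=
  le_antisymm (tdeg_le_of_forall h) (le_tdeg_of_ne_zero h0)

end Coeff

section Mul

variable {Fq : Type*} [Field Fq] [Fintype Fq] {L : Type*} [Field L] [Algebra Fq L]

theorem zero_pow_q (i : ℕ) : (0 : L) ^ (Fintype.card Fq ^ i) = 0 :=
  zero_pow (pow_ne_zero _ Fintype.card_ne_zero)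

theorem smul_mul (c : L) (f g : TwistedPoly Fq L) : (c • f) * g = c • (f * g) := by
  refine TwistedPoly.ext ?_
  rw [poly_mul, poly_smul, poly_smul, poly_mul, mul_comp, C_comp]

instance : IsScalarTower L (TwistedPoly Fq L) (TwistedPoly Fq L) :=
  ⟨fun c f g => smul_mul c f g⟩

theorem mono_mul_mono (c d : L) (i j : ℕ) :
    (mono c i * mono d j : TwistedPoly Fq L) = mono (c * d ^ (Fintype.card Fq ^ i)) (i + j) := by
  refine TwistedPoly.ext ?_
  change (C c * X ^ (Fintype.card Fq ^ i) : L[X]).comp (C d * X ^ (Fintype.card Fq ^ j)) =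
    C (c * d ^ (Fintype.card Fq ^ i)) * X ^ (Fintype.card Fq ^ (i + j))
  simp only [mul_comp, C_comp, pow_comp, X_comp, mul_pow, C_mul, C_pow]
  rw [← pow_mul, ← pow_add, add_comm j i, mul_assoc]

/-- The product is determined by `τ c = c^q τ`. -/
theorem tc_mul (f g : TwistedPoly Fq L) (n : ℕ) :
    (f * g).tc n = ∑ x ∈ Finset.HasAntidiagonal.antidiagonal n,
      f.tc x.1 * g.tc x.2 ^ (Fintype.card Fq ^ x.1) := by
  induction f using induction_mono with
  | h0 => simp
  | hadd f f' hf hf' =>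
    rw [add_mul, tc_add, hf, hf', ← Finset.sum_add_distrib]
    exact Finset.sum_congr rfl fun x _ => by rw [tc_add, add_mul]
  | hmono c i =>
    induction g using induction_mono with
    | h0 =>
      rw [mul_zero, tc_zero]
      exact (Finset.sum_eq_zero fun x _ => by rw [tc_zero, zero_pow_q, mul_zero]).symm
    | hadd g g' hg hg' =>
      rw [mul_add, tc_add, hg, hg', ← Finset.sum_add_distrib]
      exact Finset.sum_congr rfl fun x _ => by rw [tc_add, add_pow_q, mul_add]
    | hmono d j =>
      rw [mono_mul_mono, tc_mono]
      by_cases hn : n = i + j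
      · rw [if_pos hn, Finset.sum_eq_single_of_mem (i, j) (by simp [hn])]
        · simp
        · rintro ⟨a, b⟩ hab hne
          simp only [Finset.HasAntidiagonal.mem_antidiagonal] at hab
          by_cases ha : a = i
          · exact absurd (by ext <;> simp <;> omega) hne
          · simp [ha]
      · rw [if_neg hn]
        refine (Finset.sum_eq_zero ?_).symm
        rintro ⟨a, b⟩ hab
        simp only [Finset.HasAntidiagonal.mem_antidiagonal] at hab
        by_cases ha : a = i
        · have hb : b ≠ j := by omega
          rw [tc_mono, tc_mono, if_neg hb, zero_pow_q, mul_zero]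
        · simp [ha]

theorem tc_mul_add (f g : TwistedPoly Fq L) {m n : ℕ} (hf : ∀ i > m, f.tc i = 0)
    (hg : ∀ i > n, g.tc i = 0) :
    (f * g).tc (m + n) = f.tc m * g.tc n ^ (Fintype.card Fq ^ m) := by
  rw [tc_mul, Finset.sum_eq_single_of_mem (m, n) (by simp)]
  rintro ⟨a, b⟩ hab hne
  simp only [Finset.HasAntidiagonal.mem_antidiagonal] at hab
  rcases lt_trichotomy a m with h | h | h
  · simp only
    rw [hg b (by omega), zero_pow_q, mul_zero]
  · exact absurd (by ext <;> simp <;> omega) hne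
  · simp only
    rw [hf a h, zero_mul]

theorem tc_mul_eq_zero (f g : TwistedPoly Fq L) {m n : ℕ} (hf : ∀ i > m, f.tc i = 0)
    (hg : ∀ i > n, g.tc i = 0) {k : ℕ} (hk : m + n < k) : (f * g).tc k = 0 := by
  rw [tc_mul]
  refine Finset.sum_eq_zero ?_
  rintro ⟨a, b⟩ hab
  simp only [Finset.HasAntidiagonal.mem_antidiagonal] at hab
  by_cases h : m < a
  · simp only
    rw [hf a h, zero_mul]
  · simp only
    rw [hg b (by omega), zero_pow_q, mul_zero]

theorem tdeg_mul' {f g : TwistedPoly Fq L} (hf : f ≠ 0) (hg : g ≠ 0) :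
    f * g ≠ 0 ∧ (f * g).tdeg = f.tdeg + g.tdeg := by
  have h := tc_mul_add f g (m := f.tdeg) (n := g.tdeg) (fun _ => tc_eq_zero_of_tdeg_lt)
    (fun _ => tc_eq_zero_of_tdeg_lt)
  have h0 : (f * g).tc (f.tdeg + g.tdeg) ≠ 0 := by
    rw [h]
    exact mul_ne_zero (tc_tdeg_ne_zero hf) (pow_ne_zero _ (tc_tdeg_ne_zero hg))
  refine ⟨fun h1 => h0 (by rw [h1, tc_zero]), tdeg_eq_of h0 fun k hk => ?_⟩
  exact tc_mul_eq_zero f g (fun _ => tc_eq_zero_of_tdeg_lt) (fun _ => tc_eq_zero_of_tdeg_lt) hk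

theorem tdeg_mul {f g : TwistedPoly Fq L} (hf : f ≠ 0) (hg : g ≠ 0) :
    (f * g).tdeg = f.tdeg + g.tdeg := (tdeg_mul' hf hg).2

instance : NoZeroDivisors (TwistedPoly Fq L) where
  eq_zero_or_eq_zero_of_mul_eq_zero {f g} h := by
    by_contra! h'
    exact (tdeg_mul' h'.1 h'.2).1 h

@[simp] theorem tc_one (n : ℕ) : (1 : TwistedPoly Fq L).tc n = if n = 0 then 1 else 0 := by
  have h : (1 : TwistedPoly Fq L) = mono 1 0 := TwistedPoly.ext (by
    change (X : L[X]) = C 1 * X ^ (Fintype.card Fq ^ 0)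
    simp)
  rw [h, tc_mono]

theorem tc_algebraMap (c : Fq) (n : ℕ) :
    (algebraMap Fq (TwistedPoly Fq L) c).tc n = if n = 0 then algebraMap Fq L c else 0 := by
  have h : algebraMap Fq (TwistedPoly Fq L) c = mono (algebraMap Fq L c) 0 := TwistedPoly.ext (by
    rw [poly_algebraMap]
    change _ = C (algebraMap Fq L c) * X ^ (Fintype.card Fq ^ 0)
    simp)
  rw [h, tc_mono]

theorem algebraMap_mul_eq_smul (c : Fq) (f : TwistedPoly Fq L) :
    algebraMap Fq (TwistedPoly Fq L) c * f = algebraMap Fq L c • f := by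
  refine TwistedPoly.ext ?_
  rw [poly_mul, poly_algebraMap, poly_smul]
  simp

@[simp] theorem tdeg_one : (1 : TwistedPoly Fq L).tdeg = 0 :=
  tdeg_eq_of (by simp) fun i hi => by rw [tc_one, if_neg (by omega)]

theorem tdeg_pow {f : TwistedPoly Fq L} (hf : f ≠ 0) (n : ℕ) : (f ^ n).tdeg = n * f.tdeg := by
  induction n with
  | zero => simp
  | succ n ih => rw [pow_succ, tdeg_mul (pow_ne_zero _ hf) hf, ih]; ring

/-- The derivative at the origin: the ring homomorphism sending a twisted polynomial to its
coefficient of `τ^0`. -/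
def d0 : TwistedPoly Fq L →+* L where
  toFun f := f.tc 0
  map_zero' := tc_zero 0
  map_add' f g := tc_add f g 0
  map_one' := by simp
  map_mul' f g := by simp [tc_mul]

theorem d0_apply (f : TwistedPoly Fq L) : d0 f = f.tc 0 := rfl

/-- Right division by a nonzero twisted polynomial. -/
theorem exists_right_div {t : TwistedPoly Fq L} (ht : t ≠ 0) (n : ℕ) (m : TwistedPoly Fq L)
    (hm : ∀ i ≥ n, m.tc i = 0) :
    ∃ w ρ : TwistedPoly Fq L, m = w * t + ρ ∧ (∀ i ≥ n - t.tdeg, w.tc i = 0) ∧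
      (∀ i ≥ t.tdeg, ρ.tc i = 0) ∧ ∀ i ≥ n, ρ.tc i = 0 := by
  induction n generalizing m with
  | zero => exact ⟨0, m, by simp, by simp, fun i _ => hm i (by omega), hm⟩
  | succ n ih =>
    by_cases hn : n < t.tdeg
    · exact ⟨0, m, by simp, by simp, fun i hi => hm i (by omega), hm⟩
    · push Not at hn
      obtain ⟨k, rfl⟩ := Nat.exists_eq_add_of_le' hn
      -- cancel the top coefficient of `m` against `c τ^k t`
      set c : L := m.tc (k + t.tdeg) / t.tc t.tdeg ^ (Fintype.card Fq ^ k) with hc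
      have hmono : ∀ i > k, (mono c k : TwistedPoly Fq L).tc i = 0 := fun i hi => by
        rw [tc_mono, if_neg (by omega)]
      obtain ⟨w, ρ, h1, h2, h3, h4⟩ := ih (m - mono c k * t) (fun i hi => by
        rcases hi.eq_or_lt with rfl | hi
        · rw [tc_sub, tc_mul_add _ _ hmono (fun _ => tc_eq_zero_of_tdeg_lt), tc_mono, if_pos rfl,
            hc, div_mul_cancel₀ _ (pow_ne_zero _ (tc_tdeg_ne_zero ht)), sub_self]
        · rw [tc_sub, hm i (by omega),
            tc_mul_eq_zero _ _ hmono (fun _ => tc_eq_zero_of_tdeg_lt) (by omega), sub_zero])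
      refine ⟨w + mono c k, ρ, ?_, fun i hi => ?_, h3, fun i hi => h4 i (by omega)⟩
      · rw [add_mul, add_right_comm, ← h1, sub_add_cancel]
      · rw [tc_add, h2 i (by omega), hmono i (by omega), add_zero]

end Mul

end TwistedPoly

end DrinfeldCM

namespace DrinfeldCM

/-! ### Relations that hold for all Frobenius twists -/

section Frobenius

variable {Fq : Type*} [Field Fq] [Fintype Fq] {k : Type*} [Field k] [Algebra Fq k]

theorem mem_range_algebraMap_of_pow_q {x : k} (hx : x ^ Fintype.card Fq = x) :
    ∃ c : Fq, algebraMap Fq k c = x := by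
  classical
  by_contra! h
  -- the polynomial `X^q - X` would have more than `q` roots
  have hne : (X ^ Fintype.card Fq - X : k[X]) ≠ 0 :=
    FiniteField.X_pow_card_sub_X_ne_zero k (TwistedPoly.one_lt_q (Fq := Fq))
  have hsub : insert x (Finset.univ.image (algebraMap Fq k)) ⊆
      (X ^ Fintype.card Fq - X : k[X]).roots.toFinset := by
    intro y hy
    rw [Multiset.mem_toFinset, mem_roots hne]
    rcases Finset.mem_insert.1 hy with rfl | hy
    · simp [hx]
    · obtain ⟨c, -, rfl⟩ := Finset.mem_image.1 hy
      simp [← map_pow, FiniteField.pow_card]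
  have h1 := Finset.card_le_card hsub
  rw [Finset.card_insert_of_notMem (by simpa using h),
    Finset.card_image_of_injective _ (algebraMap Fq k).injective, Finset.card_univ] at h1
  have h2 := (Multiset.toFinset_card_le _).trans (card_roots' (X ^ Fintype.card Fq - X : k[X]))
  rw [FiniteField.X_pow_card_sub_X_natDegree_eq k (TwistedPoly.one_lt_q (Fq := Fq))] at h2
  omega

/-- If `∑ bⱼ xⱼ^(q^n) = 0` for all `n` and the `bⱼ` are linearly independent over `Fq`, then all
`xⱼ` vanish: normalise one `xⱼ` to be `1` and subtract two consecutive relations. -/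
theorem eq_zero_of_forall_sum_pow_q {ι : Type*} (S : Finset ι) (b : ι → k)
    (hb : LinearIndepOn Fq b (S : Set ι)) (x : ι → k)
    (hx : ∀ n, ∑ j ∈ S, b j * x j ^ (Fintype.card Fq ^ n) = 0) : ∀ j ∈ S, x j = 0 := by
  classical
  induction S using Finset.induction_on generalizing x with
  | empty => simp
  | insert j₀ S hj₀ ih =>
    have hS : LinearIndepOn Fq b (S : Set ι) := hb.mono (by simp)
    have key : x j₀ = 0 := by
      by_contra h0
      have hy : ∀ n, ∑ j ∈ insert j₀ S, b j * (x j / x j₀) ^ (Fintype.card Fq ^ n) = 0 := by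
        intro n
        simp_rw [div_pow, ← mul_div_assoc, ← Finset.sum_div, hx n, zero_div]
      -- the term of `j₀` cancels when consecutive normalised relations are subtracted
      have hz := ih hS (fun j => (x j / x j₀) ^ Fintype.card Fq - x j / x j₀) (fun n => by
        have h1 := hy (n + 1)
        have h2 := hy n
        rw [Finset.sum_insert hj₀, div_self h0, one_pow] at h1 h2
        have h3 : ∀ j, ((x j / x j₀) ^ Fintype.card Fq - x j / x j₀) ^ (Fintype.card Fq ^ n) =
            (x j / x j₀) ^ (Fintype.card Fq ^ (n + 1)) - (x j / x j₀) ^ (Fintype.card Fq ^ n) := by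
          intro j
          rw [eq_sub_iff_add_eq, ← add_pow_q (Fq := Fq), sub_add_cancel, ← pow_mul, pow_succ']
        simp_rw [h3, mul_sub, Finset.sum_sub_distrib]
        linear_combination h1 - h2)
      -- so all ratios lie in `Fq`, and the relation for `n = 0` contradicts linear independence
      choose! c hc using fun j (hj : j ∈ S) =>
        mem_range_algebraMap_of_pow_q (Fq := Fq) (sub_eq_zero.1 (hz j hj))
      have h4 := hy 0
      rw [Finset.sum_insert hj₀, div_self h0] at h4
      refine one_ne_zero (linearIndepOn_finset_iff.1 hb (fun j => if j = j₀ then 1 else c j) ?_ j₀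
        (Finset.mem_insert_self _ _) |>.symm.trans (if_pos rfl)).symm
      rw [Finset.sum_insert hj₀, if_pos rfl, one_smul, ← h4]
      congr 1
      · simp
      · refine Finset.sum_congr rfl fun j hj => ?_
        rw [if_neg (ne_of_mem_of_not_mem hj hj₀), Algebra.smul_def, hc j hj]
        simp [mul_comm]
    intro j hj
    rcases Finset.mem_insert.1 hj with rfl | hj
    · exact key
    · refine ih hS x (fun n => ?_) j hj
      have := hx n
      rwa [Finset.sum_insert hj₀, key, TwistedPoly.zero_pow_q, mul_zero, zero_add] at this

/-- Expanding the `cₛ` in a basis of `k` over `Fq`, all coefficients of the relation vanish, because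
its `q^n`-th power twists do so simultaneously. -/
theorem sum_functional_mul_eq_zero {ι : Type*} (S : Finset ι) (c x : ι → k)
    (hx : ∀ n, ∑ s ∈ S, c s * x s ^ (Fintype.card Fq ^ n) = 0) (l : k →ₗ[Fq] Fq) :
    ∑ s ∈ S, algebraMap Fq k (l (c s)) * x s = 0 := by
  classical
  let B := Module.Basis.ofVectorSpace Fq k
  let J := S.biUnion fun s => (B.repr (c s)).support
  have hrep : ∀ s ∈ S, c s = ∑ j ∈ J, B.repr (c s) j • B j := fun s hs => by
    conv_lhs => rw [← B.linearCombination_repr (c s), Finsupp.linearCombination_apply]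
    exact Finsupp.sum_of_support_subset _ (Finset.subset_biUnion_of_mem
      (fun s => (B.repr (c s)).support) hs) _ (by simp)
  have hpow : ∀ (T : Finset ι) (y : ι → k) (n : ℕ),
      (∑ s ∈ T, y s) ^ (Fintype.card Fq ^ n) = ∑ s ∈ T, y s ^ (Fintype.card Fq ^ n) := by
    intro T y n
    induction T using Finset.induction_on with
    | empty => simp
    | insert a T ha ih => rw [Finset.sum_insert ha, Finset.sum_insert ha, add_pow_q, ih]
  have h0 := eq_zero_of_forall_sum_pow_q (Fq := Fq) J B
    (B.linearIndependent.linearIndepOn _)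
    (fun j => ∑ s ∈ S, algebraMap Fq k (B.repr (c s) j) * x s) (fun n => by
      rw [← hx n]
      simp_rw [hpow, mul_pow, algebraMap_pow_q, Finset.mul_sum]
      rw [Finset.sum_comm]
      refine Finset.sum_congr rfl fun s hs => ?_
      conv_rhs => rw [hrep s hs, Finset.sum_mul]
      exact Finset.sum_congr rfl fun j _ => by rw [Algebra.smul_def]; ring)
  have h1 : ∀ s ∈ S, algebraMap Fq k (l (c s)) * x s =
      ∑ j ∈ J, algebraMap Fq k (l (B j)) * (algebraMap Fq k (B.repr (c s) j) * x s) := by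
    intro s hs
    conv_lhs => rw [hrep s hs]
    rw [map_sum, map_sum, Finset.sum_mul]
    exact Finset.sum_congr rfl fun j _ => by rw [map_smul, smul_eq_mul, map_mul]; ring
  rw [Finset.sum_congr rfl h1, Finset.sum_comm]
  exact Finset.sum_eq_zero fun j hj => by rw [← Finset.mul_sum, h0 j hj, mul_zero]

/-- A relation `∑ cₛ τ^n mₛ = 0` valid for all `n` descends along every `Fq`-linear functional
applied to the scalars `cₛ`. This replaces the faithfulness of the action of `k ⊗ E` for a subring
`E` of `k⟨x⟩`, and holds in every characteristic of the Drinfeld module. -/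
theorem sum_functional_smul_eq_zero {ι : Type*} (S : Finset ι) (c : ι → k)
    (m : ι → TwistedPoly Fq k)
    (h : ∀ n, ∑ s ∈ S, c s • ((TwistedPoly.mono 1 n : TwistedPoly Fq k) * m s) = 0)
    (l : k →ₗ[Fq] Fq) :
    ∑ s ∈ S, algebraMap Fq (TwistedPoly Fq k) (l (c s)) * m s = 0 := by
  refine TwistedPoly.ext_tc fun i => ?_
  rw [TwistedPoly.tc_sum, TwistedPoly.tc_zero]
  simp_rw [TwistedPoly.algebraMap_mul_eq_smul, TwistedPoly.tc_smul]
  refine sum_functional_mul_eq_zero S c (fun s => (m s).tc i) (fun n => ?_) l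
  have h1 := congrArg (fun f => TwistedPoly.tc f (n + i)) (h n)
  simp only [TwistedPoly.tc_sum, TwistedPoly.tc_smul, TwistedPoly.tc_zero] at h1
  rw [← h1]
  refine Finset.sum_congr rfl fun s _ => ?_
  rw [TwistedPoly.tc_mul, Finset.sum_eq_single_of_mem (n, i) (by simp)]
  · simp
  · rintro ⟨a, b⟩ hab hne
    simp only [Finset.HasAntidiagonal.mem_antidiagonal] at hab
    by_cases ha : a = n
    · exact absurd (by ext <;> simp <;> omega) hne
    · simp [ha]

end Frobenius

end DrinfeldCM

namespace DrinfeldCM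

/-! ### The motive of a twisted polynomial -/

section Motive

variable {Fq : Type*} [Field Fq] [Fintype Fq] {k : Type*} [Field k] [Algebra Fq k]

/-- Right multiplication by `t`, as a `k`-linear endomorphism of `k⟨x⟩`. -/
abbrev rightMul (t : TwistedPoly Fq k) : TwistedPoly Fq k →ₗ[k] TwistedPoly Fq k where
  toFun m := m * t
  map_add' m n := add_mul m n t
  map_smul' c m := smul_mul_assoc c m t

/-- The motive of `t`: the left `k`-vector space `k⟨x⟩` made into a `k[X]`-module by letting `X`
act as right multiplication by `t`. -/
abbrev Motive (t : TwistedPoly Fq k) : Type _ := Module.AEval' (rightMul t)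

/-- The identity map from `k⟨x⟩` to the motive of `t`. -/
abbrev toMotive (t : TwistedPoly Fq k) : TwistedPoly Fq k ≃ₗ[k] Motive t :=
  Module.AEval'.of (rightMul t)

theorem X_smul_toMotive (t m : TwistedPoly Fq k) :
    (X : k[X]) • toMotive t m = toMotive t (m * t) :=
  Module.AEval'.X_smul_of _ _

theorem X_pow_smul_toMotive (t m : TwistedPoly Fq k) (n : ℕ) :
    (X ^ n : k[X]) • toMotive t m = toMotive t (m * t ^ n) := by
  induction n generalizing m with
  | zero => simp
  | succ n ih => rw [pow_succ, mul_smul, X_smul_toMotive, ih, mul_assoc, ← pow_succ']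

theorem C_smul_toMotive (t m : TwistedPoly Fq k) (c : k) :
    (C c : k[X]) • toMotive t m = toMotive t (c • m) :=
  Module.AEval.C_smul (rightMul t) c (toMotive t m)

theorem smul_toMotive (t m : TwistedPoly Fq k) (P : k[X]) {N : ℕ} (hN : P.natDegree < N) :
    P • toMotive t m = toMotive t (∑ a ∈ Finset.range N, P.coeff a • (m * t ^ a)) := by
  conv_lhs => rw [as_sum_range_C_mul_X_pow' P hN, Finset.sum_smul]
  rw [map_sum]
  refine Finset.sum_congr rfl fun a _ => ?_
  rw [mul_smul, X_pow_smul_toMotive, C_smul_toMotive]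

/-- Right multiplication by an element commuting with `t`, as an endomorphism of the motive. -/
def motiveEnd {t u : TwistedPoly Fq k} (h : u * t = t * u) : Module.End k[X] (Motive t) where
  toFun n := toMotive t ((toMotive t).symm n * u)
  map_add' n n' := by rw [map_add, add_mul, map_add]
  map_smul' P n := by
    obtain ⟨m, rfl⟩ := (toMotive t).surjective n
    rw [smul_toMotive t m P (Nat.lt_succ_self _), RingHom.id_apply, LinearEquiv.symm_apply_apply,
      LinearEquiv.symm_apply_apply, smul_toMotive t _ P (Nat.lt_succ_self _), Finset.sum_mul]
    congr 1
    refine Finset.sum_congr rfl fun a _ => ?_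
    have hc : u * t ^ a = t ^ a * u := (Commute.pow_right (show Commute u t from h) a)
    rw [smul_mul_assoc, mul_assoc, mul_assoc, hc]

theorem motiveEnd_toMotive {t u : TwistedPoly Fq k} (h : u * t = t * u) (m : TwistedPoly Fq k) :
    motiveEnd h (toMotive t m) = toMotive t (m * u) := by
  change toMotive t ((toMotive t).symm (toMotive t m) * u) = _
  rw [LinearEquiv.symm_apply_apply]

theorem motiveEnd_pow_toMotive {t u : TwistedPoly Fq k} (h : u * t = t * u)
    (m : TwistedPoly Fq k) (n : ℕ) :
    (motiveEnd h ^ n) (toMotive t m) = toMotive t (m * u ^ n) := by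
  induction n generalizing m with
  | zero => simp
  | succ n ih => rw [pow_succ, Module.End.mul_apply, motiveEnd_toMotive, ih, mul_assoc, ← pow_succ']

/-- The generator `τ^j` of the motive. -/
abbrev motiveGen (t : TwistedPoly Fq k) (j : Fin t.tdeg) : Motive t :=
  toMotive t (TwistedPoly.mono 1 (j : ℕ))

/-- Expansion in the generators `τ^j`, with the expected degree bound. -/
theorem exists_motive_expansion {t : TwistedPoly Fq k} (ht : t.tdeg ≠ 0) (n : ℕ)
    (m : TwistedPoly Fq k) (hm : ∀ i ≥ n, m.tc i = 0) :
    ∃ c : Fin t.tdeg → k[X], toMotive t m = ∑ j, c j • motiveGen t j ∧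
      ∀ j a, (c j).coeff a ≠ 0 → t.tdeg * a + j < n := by
  have ht0 : t ≠ 0 := by rintro rfl; simp [TwistedPoly.tdeg, TwistedPoly.poly_zero] at ht
  induction n using Nat.strong_induction_on generalizing m with
  | _ n ih =>
  rcases Nat.eq_zero_or_pos n with rfl | hn
  · refine ⟨0, ?_, by simp⟩
    rw [show m = 0 from TwistedPoly.ext_tc fun i => by rw [hm i (by omega), TwistedPoly.tc_zero]]
    simp
  -- write `m = w t + ρ`, where `w t` is `X` times `w` in the motive
  obtain ⟨w, ρ, h1, h2, h3, h4⟩ := TwistedPoly.exists_right_div ht0 n m hm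
  obtain ⟨c, hc, hcb⟩ := ih (n - t.tdeg) (by omega) w h2
  refine ⟨fun j => X * c j + C (ρ.tc j), ?_, fun j a ha => ?_⟩
  · have hρ : toMotive t ρ = ∑ j : Fin t.tdeg, (C (ρ.tc j) : k[X]) • motiveGen t j := by
      conv_lhs => rw [TwistedPoly.eq_sum_mono ρ h3]
      rw [map_sum, Finset.sum_range]
      refine Finset.sum_congr rfl fun j _ => ?_
      rw [C_smul_toMotive]
      congr 1
      exact TwistedPoly.ext_tc fun i => by simp
    simp_rw [add_smul, mul_smul, Finset.sum_add_distrib, ← Finset.smul_sum]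
    rw [← hc, ← hρ, X_smul_toMotive, ← map_add, ← h1]
  · rw [coeff_add] at ha
    rcases Nat.eq_zero_or_pos a with rfl | hpos
    · rw [mul_coeff_zero, coeff_X_zero, zero_mul, zero_add, coeff_C_zero] at ha
      by_contra hlt
      exact ha (h4 _ (by omega))
    · obtain ⟨a, rfl⟩ := Nat.exists_eq_succ_of_ne_zero hpos.ne'
      rw [coeff_X_mul, coeff_C_succ, add_zero] at ha
      have := hcb j a ha
      rw [Nat.succ_eq_add_one, mul_add, mul_one]
      omega

theorem span_motiveGen {t : TwistedPoly Fq k} (ht : t.tdeg ≠ 0) :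
    Submodule.span k[X] (Set.range (motiveGen t)) = ⊤ := by
  refine eq_top_iff.2 fun n _ => ?_
  obtain ⟨m, rfl⟩ := (toMotive t).surjective n
  obtain ⟨N, hN⟩ := m.exists_tc_eq_zero
  obtain ⟨c, hc, -⟩ := exists_motive_expansion ht N m hN
  rw [hc]
  exact Submodule.sum_mem _ fun j _ => Submodule.smul_mem _ _ (Submodule.subset_span ⟨j, rfl⟩)

/-- The entries of a matrix of `u` are bounded by giving `τ^j` the degree `j` and `X` the degree of
`t`. Only the fact that the `τ^j` generate is used, not that they are a basis. -/
theorem exists_motive_matrix {t u : TwistedPoly Fq k} (ht : t.tdeg ≠ 0) (h : u * t = t * u) :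
    ∃ B : Matrix (Fin t.tdeg) (Fin t.tdeg) k[X],
      B.Represents (motiveGen t) (motiveEnd h) ∧
      ∀ i j a, (B i j).coeff a ≠ 0 → t.tdeg * a + i ≤ j + u.tdeg := by
  have h1 : ∀ j : Fin t.tdeg, ∀ i ≥ (j : ℕ) + u.tdeg + 1,
      ((TwistedPoly.mono 1 (j : ℕ) : TwistedPoly Fq k) * u).tc i = 0 := fun j i hi =>
    TwistedPoly.tc_mul_eq_zero _ _ (m := j) (n := u.tdeg)
      (fun i hi => by rw [TwistedPoly.tc_mono, if_neg (by omega)])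
      (fun _ => TwistedPoly.tc_eq_zero_of_tdeg_lt) (by omega)
  choose c hc hcb using fun j => exists_motive_expansion ht _ _ (h1 j)
  refine ⟨fun i j => c j i, Matrix.represents_iff'.2 fun j => ?_, fun i j a ha => ?_⟩
  · rw [motiveEnd_toMotive, hc]
  · have := hcb j i a ha
    omega

/-- Cayley–Hamilton on the motive. -/
theorem aeval_charpoly_motiveEnd {t u : TwistedPoly Fq k} (ht : t.tdeg ≠ 0) (h : u * t = t * u)
    {B : Matrix (Fin t.tdeg) (Fin t.tdeg) k[X]} (hB : B.Represents (motiveGen t) (motiveEnd h)) :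
    aeval (motiveEnd h) B.charpoly = 0 := by
  let B' : Matrix.isRepresentation k[X] (motiveGen t) := ⟨B, _, hB⟩
  rw [← Matrix.isRepresentation.eq_toEnd_of_represents k[X] (motiveGen t) (span_motiveGen ht) B' hB,
    aeval_algHom_apply]
  have h0 : aeval B' B.charpoly = 0 := by
    refine Subtype.ext ?_
    rw [← Subalgebra.coe_val, ← aeval_algHom_apply]
    exact Matrix.aeval_self_charpoly B
  rw [h0, map_zero]

end Motive

/-! ### Degree bounds for the characteristic polynomial -/

section Weight

variable {k : Type*} [Field k]

/-- `P = ∑ pᵢₐ X^a Y^i` has weight at most `w` when `X` has weight `s` and `Y` has weight `D`. -/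
def WeightLE (s D : ℕ) (w : ℤ) (P : k[X][X]) : Prop :=
  ∀ i a, (P.coeff i).coeff a ≠ 0 → (s * a + i * D : ℤ) ≤ w

variable {s D : ℕ} {w w' : ℤ} {P Q : k[X][X]}

theorem WeightLE.mul (hP : WeightLE s D w P) (hQ : WeightLE s D w' Q) :
    WeightLE s D (w + w') (P * Q) := by
  intro i a h
  rw [coeff_mul, finsetSum_coeff] at h
  obtain ⟨⟨i₁, i₂⟩, hi, h1⟩ := Finset.exists_ne_zero_of_sum_ne_zero h
  rw [coeff_mul] at h1
  obtain ⟨⟨a₁, a₂⟩, ha, h2⟩ := Finset.exists_ne_zero_of_sum_ne_zero h1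
  simp only [Finset.HasAntidiagonal.mem_antidiagonal] at hi ha
  have h3 := hP i₁ a₁ (left_ne_zero_of_mul h2)
  have h4 := hQ i₂ a₂ (right_ne_zero_of_mul h2)
  rw [← hi, ← ha]
  push_cast
  linarith

theorem WeightLE.sum {ι : Type*} (S : Finset ι) (P : ι → k[X][X])
    (h : ∀ i ∈ S, WeightLE s D w (P i)) : WeightLE s D w (∑ i ∈ S, P i) := by
  intro i a h1
  rw [finsetSum_coeff, finsetSum_coeff] at h1
  obtain ⟨j, hj, h2⟩ := Finset.exists_ne_zero_of_sum_ne_zero h1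
  exact h j hj i a h2

theorem WeightLE.one : WeightLE s D 0 (1 : k[X][X]) := by
  intro i a h
  rw [coeff_one] at h
  split_ifs at h with hi
  · rw [coeff_one] at h
    split_ifs at h with ha
    · simp [hi, ha]
    · exact absurd rfl h
  · simp at h

theorem WeightLE.prod {ι : Type*} (S : Finset ι) (P : ι → k[X][X]) (w : ι → ℤ)
    (h : ∀ i ∈ S, WeightLE s D (w i) (P i)) : WeightLE s D (∑ i ∈ S, w i) (∏ i ∈ S, P i) := by
  classical
  induction S using Finset.induction_on with
  | empty => simpa using WeightLE.one
  | insert a S ha ih =>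
    rw [Finset.sum_insert ha, Finset.prod_insert ha]
    exact (h a (by simp)).mul (ih fun i hi => h i (by simp [hi]))

/-- A degree bound for the entries, relative to the grading in which the `j`-th basis vector has
degree `j`, bounds the characteristic polynomial: the shifts `i - σ i` cancel in each term of the
determinant. -/
theorem weightLE_charpoly (B : Matrix (Fin s) (Fin s) k[X])
    (hB : ∀ i j a, (B i j).coeff a ≠ 0 → s * a + i ≤ j + D) :
    WeightLE s D (s * D) B.charpoly := by
  rw [Matrix.charpoly, Matrix.det_apply]
  refine WeightLE.sum _ _ fun σ _ => ?_
  have h1 : WeightLE s D (∑ i : Fin s, ((D : ℤ) + (i : ℕ) - (σ i : ℕ)))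
      (∏ i, B.charmatrix (σ i) i) := by
    refine WeightLE.prod _ _ _ fun i _ n a h => ?_
    rw [Matrix.charmatrix_apply, coeff_sub, coeff_sub] at h
    by_cases hc : ((C (B (σ i) i)).coeff n).coeff a = 0
    · rw [hc, sub_zero, Matrix.diagonal_apply] at h
      split_ifs at h with hσ
      · rw [coeff_X] at h
        split_ifs at h with hn
        · rw [coeff_one] at h
          split_ifs at h with ha
          · subst hn ha
            rw [hσ]
            push_cast
            linarith
          · exact absurd rfl h
        · simp at h
      · simp at h
    · rw [coeff_C] at hc
      split_ifs at hc with hn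
      · have := hB _ _ _ hc
        subst hn
        zify at this
        push_cast
        linarith
      · simp at hc
  have h2 : ∑ i : Fin s, ((D : ℤ) + (i : ℕ) - (σ i : ℕ)) = s * D := by
    rw [Finset.sum_sub_distrib, Finset.sum_add_distrib,
      Equiv.sum_comp σ (fun i : Fin s => ((i : ℕ) : ℤ))]
    simp
  rw [h2] at h1
  intro i a h
  refine h1 i a fun h0 => h ?_
  rw [Units.smul_def, zsmul_eq_mul]
  rcases Int.units_eq_one_or (Equiv.Perm.sign σ) with h' | h' <;> rw [h'] <;> simp [h0]

end Weight

end DrinfeldCM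

namespace DrinfeldCM

/-! ### Commuting twisted polynomials are algebraically dependent -/

section Functional

variable {Fq : Type*} [Field Fq] {k : Type*} [Field k] [Algebra Fq k]

/-- Apply an `Fq`-linear functional to the coefficients of a polynomial. -/
def mapFunctional (l : k →ₗ[Fq] Fq) (P : k[X]) : Fq[X] :=
  ∑ a ∈ P.support, monomial a (l (P.coeff a))

theorem coeff_mapFunctional (l : k →ₗ[Fq] Fq) (P : k[X]) (a : ℕ) :
    (mapFunctional l P).coeff a = l (P.coeff a) := by
  rw [mapFunctional, finsetSum_coeff]
  simp only [coeff_monomial]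
  rw [Finset.sum_ite_eq']
  split_ifs with h
  · rfl
  · rw [notMem_support_iff.1 h, map_zero]

theorem mapFunctional_zero (l : k →ₗ[Fq] Fq) : mapFunctional l 0 = 0 := by simp [mapFunctional]

/-- Apply an `Fq`-linear functional to the coefficients of a polynomial in two variables. -/
def mapFunctional₂ (l : k →ₗ[Fq] Fq) (P : k[X][X]) : Fq[X][X] :=
  ∑ i ∈ P.support, monomial i (mapFunctional l (P.coeff i))

theorem coeff_mapFunctional₂ (l : k →ₗ[Fq] Fq) (P : k[X][X]) (i : ℕ) :
    (mapFunctional₂ l P).coeff i = mapFunctional l (P.coeff i) := by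
  rw [mapFunctional₂, finsetSum_coeff]
  simp only [coeff_monomial]
  rw [Finset.sum_ite_eq']
  split_ifs with h
  · rfl
  · rw [notMem_support_iff.1 h, mapFunctional_zero]

theorem eq_zero_of_forall_mapFunctional₂ {P : k[X][X]}
    (h : ∀ l : k →ₗ[Fq] Fq, mapFunctional₂ l P = 0) : P = 0 := by
  ext i a
  rw [coeff_zero, coeff_zero, ← Module.forall_dual_apply_eq_zero_iff Fq]
  intro l
  have := congrArg (fun Q : Fq[X][X] => (Q.coeff i).coeff a) (h l)
  simpa [coeff_mapFunctional₂, coeff_mapFunctional] using this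

theorem exists_functional_one (Fq k : Type*) [Field Fq] [Field k] [Algebra Fq k] :
    ∃ l : k →ₗ[Fq] Fq, l 1 = 1 := by
  by_contra! h
  refine one_ne_zero ((Module.forall_dual_apply_eq_zero_iff Fq (1 : k)).1 fun l => ?_)
  by_contra h0
  exact h ((l 1)⁻¹ • l) (by simp [h0])

end Functional

section Annihilator

variable {Fq : Type*} [Field Fq] [Fintype Fq] {k : Type*} [Field k] [Algebra Fq k]

/-- The value at `(t, u)` of a polynomial in two variables over `Fq`. -/
abbrev evalPair (t u : TwistedPoly Fq k) (p : Fq[X][X]) : TwistedPoly Fq k :=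
  p.eval₂ (aeval t : Fq[X] →ₐ[Fq] TwistedPoly Fq k).toRingHom u

theorem aeval_eq_sum_range_smul (t : TwistedPoly Fq k) (P : Fq[X]) {N : ℕ}
    (hN : P.natDegree < N) :
    aeval t P = ∑ a ∈ Finset.range N,
      algebraMap Fq (TwistedPoly Fq k) (P.coeff a) * t ^ a := by
  rw [aeval_eq_sum_range' hN]
  simp_rw [Algebra.smul_def]

theorem evalPair_eq_sum (t u : TwistedPoly Fq k) (p : Fq[X][X]) {N : ℕ} (hN : p.natDegree < N)
    (hN' : ∀ i, (p.coeff i).natDegree < N) :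
    evalPair t u p = ∑ x ∈ Finset.range N ×ˢ Finset.range N,
      algebraMap Fq (TwistedPoly Fq k) ((p.coeff x.1).coeff x.2) * (t ^ x.2 * u ^ x.1) := by
  rw [evalPair, eval₂_eq_sum_range' _ hN, Finset.sum_product]
  refine Finset.sum_congr rfl fun i _ => ?_
  change aeval t (p.coeff i) * u ^ i = _
  rw [aeval_eq_sum_range_smul t _ (hN' i), Finset.sum_mul]
  exact Finset.sum_congr rfl fun a _ => mul_assoc _ _ _

theorem exists_natDegree_lt (P : k[X][X]) :
    ∃ N, P.natDegree < N ∧ ∀ i, (P.coeff i).natDegree < N := by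
  refine ⟨max P.natDegree (P.support.sup fun i => (P.coeff i).natDegree) + 1, by omega, fun i => ?_⟩
  by_cases hi : i ∈ P.support
  · have := Finset.le_sup (f := fun i => (P.coeff i).natDegree) hi
    omega
  · rw [notMem_support_iff.1 hi, natDegree_zero]
    omega

theorem aeval_motiveEnd_toMotive {t u : TwistedPoly Fq k} (h : u * t = t * u) (P : k[X][X])
    {N : ℕ} (hN : P.natDegree < N) (hN' : ∀ i, (P.coeff i).natDegree < N)
    (m : TwistedPoly Fq k) :
    aeval (motiveEnd h) P (toMotive t m) = toMotive t (∑ x ∈ Finset.range N ×ˢ Finset.range N,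
      ((P.coeff x.1).coeff x.2) • (m * (t ^ x.2 * u ^ x.1))) := by
  rw [aeval_eq_sum_range' hN, LinearMap.sum_apply, Finset.sum_product, map_sum]
  refine Finset.sum_congr rfl fun i _ => ?_
  rw [LinearMap.smul_apply, motiveEnd_pow_toMotive, smul_toMotive t _ _ (hN' i)]
  congr 1
  refine Finset.sum_congr rfl fun a _ => ?_
  have hc : u ^ i * t ^ a = t ^ a * u ^ i := (Commute.pow_pow (show Commute u t from h) i a)
  rw [mul_assoc, hc]

/-- A relation for `u` over `k[X]` on the motive descends to relations over `Fq[t]` in `k⟨x⟩`. -/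
theorem evalPair_mapFunctional₂ {t u : TwistedPoly Fq k} (h : u * t = t * u) {P : k[X][X]}
    (hP : aeval (motiveEnd h) P = 0) (l : k →ₗ[Fq] Fq) :
    evalPair t u (mapFunctional₂ l P) = 0 := by
  obtain ⟨N, hN, hN'⟩ := exists_natDegree_lt P
  have hM : (mapFunctional₂ l P).natDegree < N := by
    refine lt_of_le_of_lt (natDegree_le_iff_coeff_eq_zero.2 fun i hi => ?_) hN
    rw [coeff_mapFunctional₂, coeff_eq_zero_of_natDegree_lt hi, mapFunctional_zero]
  have hM' : ∀ i, ((mapFunctional₂ l P).coeff i).natDegree < N := fun i => by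
    refine lt_of_le_of_lt (natDegree_le_iff_coeff_eq_zero.2 fun a ha => ?_) (hN' i)
    rw [coeff_mapFunctional₂, coeff_mapFunctional, coeff_eq_zero_of_natDegree_lt ha, map_zero]
  rw [evalPair_eq_sum t u _ hM hM']
  simp_rw [coeff_mapFunctional₂, coeff_mapFunctional]
  refine sum_functional_smul_eq_zero _ _ _ (fun n => ?_) l
  have h1 := aeval_motiveEnd_toMotive h P hN hN' (TwistedPoly.mono 1 n)
  rw [hP, LinearMap.zero_apply] at h1
  exact (LinearEquiv.map_eq_zero_iff _).1 h1.symm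

theorem aeval_motiveEnd_map {t u : TwistedPoly Fq k} (h : u * t = t * u) {p : Fq[X][X]}
    (hp : evalPair t u p = 0) :
    aeval (motiveEnd h) (p.map (mapRingHom (algebraMap Fq k))) = 0 := by
  refine LinearMap.ext fun n => ?_
  obtain ⟨m, rfl⟩ := (toMotive t).surjective n
  obtain ⟨N, hN, hN'⟩ := exists_natDegree_lt p
  rw [aeval_motiveEnd_toMotive h _ (natDegree_map_le.trans_lt hN)
    (fun i => by rw [coeff_map]; exact natDegree_map_le.trans_lt (hN' i)), LinearMap.zero_apply]
  have h1 : ∑ x ∈ Finset.range N ×ˢ Finset.range N,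
      ((p.map (mapRingHom (algebraMap Fq k))).coeff x.1).coeff x.2 • (m * (t ^ x.2 * u ^ x.1)) =
      m * evalPair t u p := by
    rw [evalPair_eq_sum t u p hN hN', Finset.mul_sum]
    refine Finset.sum_congr rfl fun x _ => ?_
    rw [coeff_map, coe_mapRingHom, coeff_map, ← TwistedPoly.algebraMap_mul_eq_smul,
      ← mul_assoc, Algebra.commutes, mul_assoc]
  rw [h1, hp, mul_zero, map_zero]

/-- An endomorphism `u` of `t` satisfies a monic polynomial over `Fq[t]` of degree `deg t`, whose
coefficients are bounded as if all conjugates of `u` had size `deg u / deg t`. -/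
theorem exists_monic_evalPair_eq_zero {t u : TwistedPoly Fq k} (ht : t.tdeg ≠ 0)
    (h : u * t = t * u) :
    ∃ p : Fq[X][X], p.Monic ∧ p.natDegree = t.tdeg ∧ evalPair t u p = 0 ∧
      ∀ i a, (p.coeff i).coeff a ≠ 0 → t.tdeg * a + i * u.tdeg ≤ t.tdeg * u.tdeg := by
  obtain ⟨B, hB, hBb⟩ := exists_motive_matrix ht h
  -- a functional with `l 1 = 1` keeps the characteristic polynomial monic
  obtain ⟨l, hl⟩ := exists_functional_one Fq k
  have hχ := B.charpoly_monic
  have hdeg : B.charpoly.natDegree = t.tdeg := by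
    rw [Matrix.charpoly_natDegree_eq_dim, Fintype.card_fin]
  have hlead : (mapFunctional₂ l B.charpoly).coeff t.tdeg = 1 := by
    have hc : B.charpoly.coeff t.tdeg = 1 := by simpa only [hdeg] using hχ.coeff_natDegree
    rw [coeff_mapFunctional₂, hc]
    ext a
    rw [coeff_mapFunctional, coeff_one, coeff_one]
    split_ifs
    · exact hl
    · exact map_zero l
  have hle : (mapFunctional₂ l B.charpoly).natDegree ≤ t.tdeg :=
    natDegree_le_iff_coeff_eq_zero.2 fun i hi => by
      rw [coeff_mapFunctional₂, coeff_eq_zero_of_natDegree_lt (by omega), mapFunctional_zero]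
  refine ⟨mapFunctional₂ l B.charpoly, monic_of_natDegree_le_of_coeff_eq_one _ hle hlead,
    le_antisymm hle (le_natDegree_of_ne_zero (by rw [hlead]; exact one_ne_zero)),
    evalPair_mapFunctional₂ h (aeval_charpoly_motiveEnd ht h hB) l, fun i a hia => ?_⟩
  have := weightLE_charpoly B hBb i a fun h0 => hia (by
    rw [coeff_mapFunctional₂, coeff_mapFunctional, h0, map_zero])
  exact_mod_cast this

/-- If `u` satisfies no relation over `Fq[t]` of degree less than `deg t`, then the characteristic
polynomial of `u` on the motive has coefficients in `Fq[X]`. -/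
theorem charpoly_motive_eq {t u : TwistedPoly Fq k} (ht : t.tdeg ≠ 0) (h : u * t = t * u)
    {B : Matrix (Fin t.tdeg) (Fin t.tdeg) k[X]} (hB : B.Represents (motiveGen t) (motiveEnd h))
    {p : Fq[X][X]} (hp : p.Monic) (hpdeg : p.natDegree = t.tdeg) (hp0 : evalPair t u p = 0)
    (hmin : ∀ Q : Fq[X][X], Q.degree < t.tdeg → evalPair t u Q = 0 → Q = 0) :
    B.charpoly = p.map (mapRingHom (algebraMap Fq k)) := by
  rw [← sub_eq_zero]
  refine eq_zero_of_forall_mapFunctional₂ (Fq := Fq) fun l => hmin _ ?_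
    (evalPair_mapFunctional₂ h (by
      rw [map_sub, aeval_charpoly_motiveEnd ht h hB, aeval_motiveEnd_map h hp0, sub_zero]) l)
  have hχ := B.charpoly_monic
  have hdeg : B.charpoly.natDegree = t.tdeg := by
    rw [Matrix.charpoly_natDegree_eq_dim, Fintype.card_fin]
  have hq : (p.map (mapRingHom (algebraMap Fq k))).Monic := hp.map _
  have hlt : (B.charpoly - p.map (mapRingHom (algebraMap Fq k))).degree < t.tdeg := by
    have h1 : B.charpoly.degree = (p.map (mapRingHom (algebraMap Fq k))).degree := by
      rw [degree_eq_natDegree hχ.ne_zero, degree_eq_natDegree hq.ne_zero, hdeg, hp.natDegree_map,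
        hpdeg]
    have h2 := degree_sub_lt_left h1 hχ.ne_zero (by rw [hχ.leadingCoeff, hq.leadingCoeff])
    rwa [degree_eq_natDegree hχ.ne_zero, hdeg] at h2
  rw [degree_lt_iff_coeff_zero] at hlt ⊢
  intro i hi
  rw [coeff_mapFunctional₂, hlt i hi, mapFunctional_zero]

end Annihilator

end DrinfeldCM

namespace DrinfeldCM

/-! ### Scaling by constants -/

section Scale

variable {Fq : Type*} [Field Fq] [Fintype Fq] {L : Type*} [Field L] [Algebra Fq L]

open TwistedPoly

/-- Conjugation of a twisted polynomial by the multiplication by `e`. -/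
def scale (e : L) (f : TwistedPoly Fq L) : TwistedPoly Fq L := (e⁻¹ • f) * mono e 0

theorem tc_mul_mono_zero (e : L) (f : TwistedPoly Fq L) (i : ℕ) :
    (f * mono e 0).tc i = f.tc i * e ^ (Fintype.card Fq ^ i) := by
  rw [tc_mul, Finset.sum_eq_single_of_mem (i, 0) (by simp)]
  · simp
  · rintro ⟨a, b⟩ hab hne
    simp only [Finset.HasAntidiagonal.mem_antidiagonal] at hab
    by_cases hb : b = 0
    · exact absurd (by ext <;> simp <;> omega) hne
    · simp [hb]

theorem mono_zero_mul (e : L) (f : TwistedPoly Fq L) : mono e 0 * f = e • f := by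
  have h : (mono e 0 : TwistedPoly Fq L) = e • 1 := ext_tc fun i => by simp
  rw [h, smul_mul_assoc, one_mul]

theorem tc_scale (e : L) (f : TwistedPoly Fq L) (i : ℕ) :
    (scale e f).tc i = e⁻¹ * f.tc i * e ^ (Fintype.card Fq ^ i) := by
  rw [scale, tc_mul_mono_zero, tc_smul]

theorem tc_scale' {e : L} (he : e ≠ 0) (f : TwistedPoly Fq L) (i : ℕ) :
    (scale e f).tc i = f.tc i * e ^ (Fintype.card Fq ^ i - 1) := by
  have h3 : 1 ≤ Fintype.card Fq ^ i := Nat.one_le_pow _ _ Fintype.card_pos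
  rw [tc_scale, ← Nat.sub_add_cancel h3, pow_succ, Nat.add_sub_cancel]
  field_simp

theorem scale_mul {e : L} (he : e ≠ 0) (f g : TwistedPoly Fq L) :
    scale e (f * g) = scale e f * scale e g := by
  have h1 : mono e 0 * (e⁻¹ • g * mono e 0) = g * mono e 0 := by
    rw [mono_zero_mul, smul_mul_assoc, smul_smul, mul_inv_cancel₀ he, one_smul]
  rw [scale, scale, scale, mul_assoc, h1, smul_mul_assoc, smul_mul_assoc, mul_assoc]

theorem scale_zero (e : L) : scale e (0 : TwistedPoly Fq L) = 0 := by
  rw [scale, smul_zero, zero_mul]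

theorem tdeg_scale {e : L} (he : e ≠ 0) (f : TwistedPoly Fq L) : (scale e f).tdeg = f.tdeg := by
  by_cases hf : f = 0
  · rw [hf, scale_zero]
  · refine tdeg_eq_of ?_ fun i hi => ?_
    · rw [tc_scale' he]
      exact mul_ne_zero (tc_tdeg_ne_zero hf) (pow_ne_zero _ he)
    · rw [tc_scale, tc_eq_zero_of_tdeg_lt hi, mul_zero, zero_mul]

theorem inv_smul_mul_eq {e : L} (he : e ≠ 0) {t u : TwistedPoly Fq L} (h : u * t = t * u) :
    (e⁻¹ • u) * t = scale e t * (e⁻¹ • u) := by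
  rw [smul_mul_assoc, h, scale, smul_mul_assoc, smul_mul_assoc, mul_assoc, mono_zero_mul, smul_smul,
    mul_inv_cancel₀ he, one_smul]

end Scale

/-! ### Reduction modulo a valuation -/

section Reduction

variable {Fq : Type*} [Field Fq] [Fintype Fq] {L : Type*} [Field L] [Algebra Fq L]

open TwistedPoly

/-- `x` lies in the valuation ring `V` and has residue `y`. -/
def ResidueRel (V : ValuationSubring L) (x : L) (y : IsLocalRing.ResidueField V) : Prop :=
  ∃ h : x ∈ V, IsLocalRing.residue V ⟨x, h⟩ = y

section

variable {V : ValuationSubring L} {x x' : L} {y y' : IsLocalRing.ResidueField V}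

theorem ResidueRel.of_mem (h : x ∈ V) : ResidueRel V x (IsLocalRing.residue V ⟨x, h⟩) := ⟨h, rfl⟩

theorem ResidueRel.add (h : ResidueRel V x y) (h' : ResidueRel V x' y') :
    ResidueRel V (x + x') (y + y') := by
  obtain ⟨h, rfl⟩ := h
  obtain ⟨h', rfl⟩ := h'
  exact ⟨V.add_mem _ _ h h', map_add (IsLocalRing.residue V) ⟨x, h⟩ ⟨x', h'⟩⟩

theorem ResidueRel.mul (h : ResidueRel V x y) (h' : ResidueRel V x' y') :
    ResidueRel V (x * x') (y * y') := by
  obtain ⟨h, rfl⟩ := h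
  obtain ⟨h', rfl⟩ := h'
  exact ⟨V.mul_mem _ _ h h', map_mul (IsLocalRing.residue V) ⟨x, h⟩ ⟨x', h'⟩⟩

theorem ResidueRel.zero : ResidueRel V (0 : L) 0 := ⟨V.zero_mem, map_zero (IsLocalRing.residue V)⟩

theorem ResidueRel.one : ResidueRel V (1 : L) 1 := ⟨V.one_mem, map_one (IsLocalRing.residue V)⟩

theorem ResidueRel.pow (h : ResidueRel V x y) (n : ℕ) : ResidueRel V (x ^ n) (y ^ n) := by
  induction n with
  | zero => simpa using ResidueRel.one
  | succ n ih => rw [pow_succ, pow_succ]; exact ih.mul h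

theorem ResidueRel.sum {ι : Type*} (S : Finset ι) (f : ι → L) (g : ι → IsLocalRing.ResidueField V)
    (h : ∀ i ∈ S, ResidueRel V (f i) (g i)) : ResidueRel V (∑ i ∈ S, f i) (∑ i ∈ S, g i) := by
  classical
  induction S using Finset.induction_on with
  | empty => simpa using ResidueRel.zero
  | insert a S ha ih =>
    rw [Finset.sum_insert ha, Finset.sum_insert ha]
    exact (h a (by simp)).add (ih fun i hi => h i (by simp [hi]))

theorem ResidueRel.unique (h : ResidueRel V x y) (h' : ResidueRel V x y') : y = y' := by
  obtain ⟨h, rfl⟩ := h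
  obtain ⟨h', rfl⟩ := h'
  rfl

theorem residueRel_zero_iff : ResidueRel V x 0 ↔ V.valuation x < 1 := by
  constructor
  · rintro ⟨h, h0⟩
    rw [IsLocalRing.residue_eq_zero_iff] at h0
    exact (V.valuation_lt_one_iff ⟨x, h⟩).1 h0
  · intro h
    have hx : x ∈ V := (V.valuation_le_one_iff x).1 h.le
    exact ⟨hx, (IsLocalRing.residue_eq_zero_iff _).2 ((V.valuation_lt_one_iff ⟨x, hx⟩).2 h)⟩

theorem residueRel_inv_zero (h : x ∉ V) : ResidueRel V x⁻¹ 0 := by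
  rw [residueRel_zero_iff, map_inv₀]
  rw [← V.valuation_le_one_iff, not_le] at h
  exact inv_lt_one_of_one_lt₀ h

end

/-- Among finitely many elements, not all zero, one divides all others in `V`. -/
theorem exists_div_mem (V : ValuationSubring L) {ι : Type*} (S : Finset ι) (x : ι → L)
    (hx : ∃ i ∈ S, x i ≠ 0) : ∃ j ∈ S, x j ≠ 0 ∧ ∀ i ∈ S, x i / x j ∈ V := by
  obtain ⟨i₀, hi₀, h0⟩ := hx
  obtain ⟨j, hj, hmax⟩ := S.exists_max_image (fun i => V.valuation (x i)) ⟨i₀, hi₀⟩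
  have hxj : x j ≠ 0 := by
    intro h
    have := hmax i₀ hi₀
    rw [h, map_zero, le_zero_iff, map_eq_zero] at this
    exact h0 this
  refine ⟨j, hj, hxj, fun i hi => ?_⟩
  rw [← V.valuation_le_one_iff, map_div₀]
  exact div_le_one_of_le₀ (hmax i hi) zero_le

theorem exists_primitive_scaling (V : ValuationSubring L) {f : TwistedPoly Fq L} (hf : f ≠ 0) :
    ∃ j, f.tc j ≠ 0 ∧ ∀ i, ((f.tc j)⁻¹ • f).tc i ∈ V := by
  obtain ⟨j, -, hj0, hj⟩ := exists_div_mem V (Finset.range (f.tdeg + 1)) f.tc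
    ⟨f.tdeg, by simp, tc_tdeg_ne_zero hf⟩
  refine ⟨j, hj0, fun i => ?_⟩
  rw [tc_smul, mul_comm, ← div_eq_mul_inv]
  by_cases hi : i ≤ f.tdeg
  · exact hj i (by simp; omega)
  · rw [tc_eq_zero_of_tdeg_lt (i := i) (by omega), zero_div]
    exact V.zero_mem

/-- Coefficientwise reduction of twisted polynomials. -/
def Reduces (V : ValuationSubring L) (f : TwistedPoly Fq L)
    (g : TwistedPoly Fq (IsLocalRing.ResidueField V)) : Prop :=
  ∀ i, ResidueRel V (f.tc i) (g.tc i)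

variable {V : ValuationSubring L}

theorem Reduces.exists_of_mem {f : TwistedPoly Fq L} (hf : ∀ i, f.tc i ∈ V) :
    ∃ g, Reduces V f g := by
  refine ⟨∑ i ∈ Finset.range (f.tdeg + 1), mono (IsLocalRing.residue V ⟨f.tc i, hf i⟩) i,
    fun i => ?_⟩
  rw [tc_sum]
  simp only [tc_mono]
  rw [Finset.sum_ite_eq]
  split_ifs with h
  · exact .of_mem _
  · rw [tc_eq_zero_of_tdeg_lt (by simpa using h)]
    exact .zero

theorem Reduces.unique {f : TwistedPoly Fq L}
    {g g' : TwistedPoly Fq (IsLocalRing.ResidueField V)} (h : Reduces V f g)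
    (h' : Reduces V f g') : g = g' :=
  ext_tc fun i => (h i).unique (h' i)

theorem Reduces.smul {f : TwistedPoly Fq L} {g : TwistedPoly Fq (IsLocalRing.ResidueField V)}
    (h : Reduces V f g) {x : L} {y : IsLocalRing.ResidueField V} (hx : ResidueRel V x y) :
    Reduces V (x • f) (y • g) := fun i => by
  rw [tc_smul, tc_smul]
  exact hx.mul (h i)

theorem Reduces.sum {ι : Type*} (S : Finset ι) (f : ι → TwistedPoly Fq L)
    (g : ι → TwistedPoly Fq (IsLocalRing.ResidueField V)) (h : ∀ i ∈ S, Reduces V (f i) (g i)) :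
    Reduces V (∑ i ∈ S, f i) (∑ i ∈ S, g i) := fun n => by
  rw [tc_sum, tc_sum]
  exact ResidueRel.sum _ _ _ fun i hi => h i hi n

variable [Algebra Fq (IsLocalRing.ResidueField V)]

theorem Reduces.mul {f f' : TwistedPoly Fq L}
    {g g' : TwistedPoly Fq (IsLocalRing.ResidueField V)} (h : Reduces V f g)
    (h' : Reduces V f' g') : Reduces V (f * f') (g * g') := fun i => by
  rw [tc_mul, tc_mul]
  exact ResidueRel.sum _ _ _ fun x _ => (h _).mul ((h' _).pow _)

theorem Reduces.pow {f : TwistedPoly Fq L}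
    {g : TwistedPoly Fq (IsLocalRing.ResidueField V)} (h : Reduces V f g) (n : ℕ) :
    Reduces V (f ^ n) (g ^ n) := by
  induction n with
  | zero =>
    intro i
    rw [pow_zero, pow_zero, tc_one, tc_one]
    split_ifs
    · exact .one
    · exact .zero
  | succ n ih => rw [pow_succ, pow_succ]; exact ih.mul h

theorem Reduces.evalPair
    (hV : ∀ c : Fq, ResidueRel V (algebraMap Fq L c)
      (algebraMap Fq (IsLocalRing.ResidueField V) c))
    {t u : TwistedPoly Fq L} {t' u' : TwistedPoly Fq (IsLocalRing.ResidueField V)}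
    (ht : Reduces V t t') (hu : Reduces V u u') (p : Fq[X][X]) :
    Reduces V (evalPair t u p) (evalPair t' u' p) := by
  obtain ⟨N, hN, hN'⟩ := exists_natDegree_lt p
  rw [evalPair_eq_sum t u p hN hN', evalPair_eq_sum t' u' p hN hN']
  refine Reduces.sum _ _ _ fun x _ => ?_
  rw [algebraMap_mul_eq_smul, algebraMap_mul_eq_smul]
  exact Reduces.smul ((ht.pow _).mul (hu.pow _)) (hV _)

end Reduction

section GoodReduction

variable {Fq : Type*} [Field Fq] [Fintype Fq] {L : Type*} [Field L] [Algebra Fq L]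

open TwistedPoly

theorem d0_evalPair (t u : TwistedPoly Fq L) (p : Fq[X][X]) :
    d0 (evalPair t u p) =
      p.eval₂ (aeval (t.tc 0) : Fq[X] →ₐ[Fq] L).toRingHom (u.tc 0) := by
  rw [evalPair, eval₂_eq_sum_range, map_sum, eval₂_eq_sum_range]
  refine Finset.sum_congr rfl fun i _ => ?_
  rw [map_mul, map_pow, d0_apply u]
  congr 1
  change d0 (aeval t (p.coeff i)) = aeval (t.tc 0) (p.coeff i)
  rw [aeval_eq_sum_range, aeval_eq_sum_range, map_sum]
  refine Finset.sum_congr rfl fun a _ => ?_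
  rw [Algebra.smul_def, Algebra.smul_def, map_mul, map_pow, d0_apply t, d0_apply, tc_algebraMap,
    if_pos rfl]

theorem commute_evalPair {t u : TwistedPoly Fq L} (h : u * t = t * u) (p : Fq[X][X]) :
    evalPair t u p * t = t * evalPair t u p := by
  obtain ⟨N, hN, hN'⟩ := exists_natDegree_lt p
  rw [evalPair_eq_sum t u p hN hN']
  refine Commute.sum_left _ _ _ fun x _ => ?_
  refine Commute.mul_left ?_ (Commute.mul_left (Commute.pow_left rfl _) (Commute.pow_left h _))
  exact Algebra.commutes _ _

/-- An endomorphism of an integral twisted polynomial `t`, some coefficient of which other than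
the constant one is a unit, is integral. -/
theorem tc_mem_of_commute (V : ValuationSubring L)
    (hV : ∀ c : Fq, algebraMap Fq L c ∈ V) {t u : TwistedPoly Fq L} (h : u * t = t * u)
    (ht : ∀ i, t.tc i ∈ V) {j : ℕ} (hj : j ≠ 0) (htj : t.tc j = 1) (i : ℕ) : u.tc i ∈ V := by
  let : Algebra Fq (IsLocalRing.ResidueField V) :=
    ((IsLocalRing.residue V).comp ((algebraMap Fq L).codRestrict V.toSubring hV)).toAlgebra
  by_contra hi
  have hu : u ≠ 0 := by
    rintro rfl
    exact hi (by rw [tc_zero]; exact V.zero_mem)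
  -- Let `e ∉ V` be the largest coefficient of `u`, so that `e⁻¹ u` is integral and nonzero modulo
  -- the maximal ideal. Then `(e⁻¹ u) t = (e⁻¹ t e) (e⁻¹ u)`, and `e⁻¹ t e` has a largest coefficient
  -- `m ∉ V`. After division by `m` the left hand side reduces to `0`, but the right hand side to a
  -- product of nonzero twisted polynomials.
  obtain ⟨a, ha0, ha⟩ := exists_primitive_scaling V hu
  set e := u.tc a
  have mem_of : ∀ {f : TwistedPoly Fq L} {e : L}, e ≠ 0 → (∀ i, (e⁻¹ • f).tc i ∈ V) →
      ∀ {i}, f.tc i ∉ V → e ∉ V := by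
    intro f e he hf i hi hmem
    refine hi ?_
    have h1 := V.mul_mem _ _ hmem (hf i)
    rwa [tc_smul, ← mul_assoc, mul_inv_cancel₀ he, one_mul] at h1
  have heV : e ∉ V := mem_of ha0 ha hi
  have hrel := inv_smul_mul_eq ha0 h
  have hsj : (scale e t).tc j ∉ V := by
    rw [tc_scale' ha0, htj, one_mul, ← V.valuation_le_one_iff, map_pow, not_le]
    rw [← V.valuation_le_one_iff, not_le] at heV
    refine one_lt_pow₀ heV ?_
    have := Nat.one_lt_pow hj (one_lt_q (Fq := Fq))
    omega
  have hs0 : scale e t ≠ 0 := fun h0 => hsj (by rw [h0, tc_zero]; exact V.zero_mem)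
  obtain ⟨b, hb0, hb⟩ := exists_primitive_scaling V hs0
  have hmV := mem_of hb0 hb hsj
  set m := (scale e t).tc b
  obtain ⟨v', hv'⟩ := Reduces.exists_of_mem ha
  obtain ⟨w', hw'⟩ := Reduces.exists_of_mem hb
  obtain ⟨t', ht'⟩ := Reduces.exists_of_mem ht
  have h1 : Reduces V (m⁻¹ • ((e⁻¹ • u) * t)) ((0 : IsLocalRing.ResidueField V) • (v' * t')) :=
    (hv'.mul ht').smul (residueRel_inv_zero hmV)
  rw [hrel, ← smul_mul_assoc, zero_smul] at h1
  have h2 := h1.unique (hw'.mul hv')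
  have one_of : ∀ {f : TwistedPoly Fq L} {b : ℕ} (_ : f.tc b ≠ 0)
      {g : TwistedPoly Fq (IsLocalRing.ResidueField V)}, Reduces V ((f.tc b)⁻¹ • f) g → g ≠ 0 := by
    intro f b hb g hg h0
    have h3 := hg b
    rw [tc_smul, inv_mul_cancel₀ hb, h0, tc_zero] at h3
    exact one_ne_zero (ResidueRel.one.unique h3)
  exact (mul_ne_zero (one_of hb0 hw') (one_of ha0 hv')) h2.symm

/-- A nonzero endomorphism of an integral twisted polynomial `t` does not reduce to `0`, provided
that the reduction of `t` has positive degree. -/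
theorem eq_zero_of_reduces_zero {V : ValuationSubring L}
    [Algebra Fq (IsLocalRing.ResidueField V)] {t w : TwistedPoly Fq L}
    {t' : TwistedPoly Fq (IsLocalRing.ResidueField V)} (h : w * t = t * w) (ht : Reduces V t t')
    (ht' : t'.tdeg ≠ 0) (hw : Reduces V w 0) : w = 0 := by
  by_contra hw0
  -- Let `e` be the largest coefficient of `w`. Since `e` reduces to `0`, the conjugate `e⁻¹ t e`
  -- reduces to a constant, and `(e⁻¹ w) t = (e⁻¹ t e) (e⁻¹ w)` reduces to an identity in which the
  -- left hand side has the greater degree.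
  obtain ⟨a, ha0, ha⟩ := exists_primitive_scaling V hw0
  set e := w.tc a with he
  have hrel := inv_smul_mul_eq ha0 h
  obtain ⟨v', hv'⟩ := Reduces.exists_of_mem ha
  have he0 : ResidueRel V e 0 := by simpa using hw a
  have hs : Reduces V (scale e t) (mono (t'.tc 0) 0) := fun i => by
    rw [tc_scale' ha0, tc_mono]
    split_ifs with hi
    · subst hi
      simpa using ht 0
    · have h1 : Fintype.card Fq ^ i - 1 ≠ 0 := by
        have := Nat.one_lt_pow hi (one_lt_q (Fq := Fq))
        omega
      simpa [zero_pow h1] using (ht i).mul (he0.pow (Fintype.card Fq ^ i - 1))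
  have h1 := (hv'.mul ht).unique (hrel ▸ hs.mul hv')
  have hv0 : v' ≠ 0 := by
    intro h0
    have h3 := hv' a
    rw [tc_smul, ← he, inv_mul_cancel₀ ha0, h0, tc_zero] at h3
    exact one_ne_zero (ResidueRel.one.unique h3)
  have ht0 : t' ≠ 0 := by rintro rfl; simp [tdeg, poly_zero] at ht'
  have h2 := tdeg_mul hv0 ht0
  have h3 : (v' * t').tdeg ≤ v'.tdeg := by
    rw [h1, mono_zero_mul]
    refine tdeg_le_of_forall fun i hi => ?_
    rw [tc_smul, tc_eq_zero_of_tdeg_lt hi, mul_zero]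
  omega

/-- Good reduction of Drinfeld modules with complex multiplication: if `t = φ_T` has leading
coefficient `1` and commutes with some `u` whose derivative has degree at least `deg t` over
`Fq(T)`, then `t` and `u` have coefficients in every valuation ring containing `T`. The module is
rescaled so that its reduction has positive rank; endomorphisms stay integral and reduce
faithfully, so by `exists_monic_evalPair_eq_zero` the rank cannot drop. -/
theorem good_reduction [IsAlgClosed L] (V : ValuationSubring L)
    (hV : ∀ c : Fq, algebraMap Fq L c ∈ V) {t u : TwistedPoly Fq L} (h : u * t = t * u)
    (hr : t.tdeg ≠ 0) (hlead : t.tc t.tdeg = 1) (h0 : t.tc 0 ∈ V)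
    (hα : ∀ p : Fq[X][X], p.Monic →
      p.eval₂ (aeval (t.tc 0) : Fq[X] →ₐ[Fq] L).toRingHom (u.tc 0) = 0 → t.tdeg ≤ p.natDegree) :
    ∀ i, t.tc i ∈ V ∧ u.tc i ∈ V := by
  have hq : ∀ i, i ≠ 0 → Fintype.card Fq ^ i - 1 ≠ 0 := fun i hi => by
    have := Nat.one_lt_pow hi (one_lt_q (Fq := Fq))
    omega
  -- Choose `x i` with `x i ^ (q^i - 1) = t.tc i`. Conjugation by `(x j)⁻¹`, for the largest `x j`,
  -- makes all coefficients integral and one of them equal to `1`.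
  have hroot : ∀ i, ∃ x : L, i ≠ 0 → x ^ (Fintype.card Fq ^ i - 1) = t.tc i := fun i => by
    by_cases hi : i = 0
    · exact ⟨0, fun h => absurd hi h⟩
    · obtain ⟨x, hx⟩ := IsAlgClosed.exists_pow_nat_eq (t.tc i) (Nat.pos_of_ne_zero (hq i hi))
      exact ⟨x, fun _ => hx⟩
  choose x hx using hroot
  obtain ⟨j, hjmem, hxj, hxV⟩ := exists_div_mem V (Finset.Icc 1 t.tdeg) x
    ⟨t.tdeg, by simp; omega, fun h1 => by
      have h2 := hx t.tdeg hr
      rw [h1, zero_pow (hq _ hr), hlead] at h2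
      exact zero_ne_one h2⟩
  have hj : j ≠ 0 := by
    have := (Finset.mem_Icc.1 hjmem).1
    omega
  set c := (x j)⁻¹ with hc
  have hc0 : c ≠ 0 := inv_ne_zero hxj
  have htc : ∀ i, i ≠ 0 → (scale c t).tc i = (x i / x j) ^ (Fintype.card Fq ^ i - 1) := by
    intro i hi
    rw [tc_scale' hc0, ← hx i hi, ← mul_pow, hc, div_eq_mul_inv]
  have htV : ∀ i, (scale c t).tc i ∈ V := fun i => by
    by_cases hi : i = 0
    · subst hi
      rw [tc_scale' hc0]
      simpa using h0
    · by_cases hi' : i ≤ t.tdeg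
      · rw [htc i hi]
        exact pow_mem (hxV i (by simp; omega)) _
      · rw [tc_scale, tc_eq_zero_of_tdeg_lt (by omega), mul_zero, zero_mul]
        exact V.zero_mem
  have htj : (scale c t).tc j = 1 := by rw [htc j hj, div_self hxj, one_pow]
  have hcomm : scale c u * scale c t = scale c t * scale c u := by
    rw [← scale_mul hc0, ← scale_mul hc0, h]
  have huV := tc_mem_of_commute V hV hcomm htV hj htj
  let : Algebra Fq (IsLocalRing.ResidueField V) :=
    ((IsLocalRing.residue V).comp ((algebraMap Fq L).codRestrict V.toSubring hV)).toAlgebra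
  have hVr : ∀ c : Fq, ResidueRel V (algebraMap Fq L c)
      (algebraMap Fq (IsLocalRing.ResidueField V) c) := fun c => ⟨hV c, rfl⟩
  obtain ⟨t', ht'⟩ := Reduces.exists_of_mem htV
  obtain ⟨u', hu'⟩ := Reduces.exists_of_mem huV
  have hcomm' : u' * t' = t' * u' := (hu'.mul ht').unique (hcomm ▸ ht'.mul hu')
  have ht'j : t'.tc j ≠ 0 := by
    have h1 := ht' j
    rw [htj] at h1
    rw [← ResidueRel.one.unique h1]
    exact one_ne_zero
  have ht'deg : t'.tdeg ≠ 0 := by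
    have := le_tdeg_of_ne_zero ht'j
    omega
  -- a monic relation of degree `deg t'` between the reductions already holds between `t` and `u`
  obtain ⟨p, hp, hpdeg, hp0, -⟩ := exists_monic_evalPair_eq_zero ht'deg hcomm'
  have hW : evalPair (scale c t) (scale c u) p = 0 := by
    refine eq_zero_of_reduces_zero (commute_evalPair hcomm p) ht' ht'deg ?_
    rw [← hp0]
    exact Reduces.evalPair hVr ht' hu' p
  have hle : t.tdeg ≤ t'.tdeg := by
    rw [← hpdeg]
    refine hα p hp ?_
    have h1 := congrArg d0 hW
    rw [d0_evalPair, map_zero, tc_scale' hc0, tc_scale' hc0] at h1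
    simpa using h1
  have ht'0 : t' ≠ 0 := by rintro rfl; simp at ht'j
  have hle' : t'.tdeg ≤ t.tdeg := by
    by_contra hlt
    have h1 := ht' t'.tdeg
    rw [tc_scale, tc_eq_zero_of_tdeg_lt (f := t) (by omega), mul_zero, zero_mul] at h1
    exact tc_tdeg_ne_zero ht'0 (h1.unique ResidueRel.zero)
  have heq : t'.tdeg = t.tdeg := le_antisymm hle' hle
  -- the rescaled leading coefficient is a unit, hence so is the scaling factor
  have hcV : V.valuation c = 1 := by
    have h1 := ht' t.tdeg
    have h2 : ¬ ResidueRel V ((scale c t).tc t.tdeg) 0 := fun h2 => by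
      have h3 := h1.unique h2
      rw [← heq] at h3
      exact tc_tdeg_ne_zero ht'0 h3
    rw [residueRel_zero_iff, not_lt] at h2
    have h3 := (V.valuation_le_one_iff _).2 h1.1
    have h4 := le_antisymm h3 h2
    rw [tc_scale' hc0, hlead, one_mul, map_pow] at h4
    exact (pow_eq_one_iff_of_nonneg zero_le (hq _ hr)).1 h4
  have hback : ∀ f : TwistedPoly Fq L, (∀ i, (scale c f).tc i ∈ V) → ∀ i, f.tc i ∈ V := by
    intro f hf i
    have h1 := (V.valuation_le_one_iff _).2 (hf i)
    rw [tc_scale' hc0, map_mul, map_pow, hcV, one_pow, mul_one] at h1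
    exact (V.valuation_le_one_iff _).1 h1
  exact fun i => ⟨hback t htV i, hback u huV i⟩

end GoodReduction

end DrinfeldCM

namespace DrinfeldCM

/-! ### Finite extensions of the rational function field -/

section FunctionField

variable {Fq : Type*} [Field Fq] [Fintype Fq]

theorem finite_of_ringHom_injective {A B C : Type*} [CommRing A] [IsNoetherianRing A] [CommRing B]
    [CommRing C] [Algebra A B] {ρ : A →+* C} (hρ : ρ.Finite) (ψ : B →+* C)
    (hψ : Function.Injective ψ) (h : ψ.comp (algebraMap A B) = ρ) : Module.Finite A B := by
  let := ρ.toAlgebra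
  have : Module.Finite A C := hρ
  let ψ' : B →ₐ[A] C := { ψ with commutes' := fun a => RingHom.congr_fun h a }
  exact Module.Finite.of_injective ψ'.toLinearMap hψ

theorem finite_iterateFrobenius_polynomial (p n : ℕ) [ExpChar Fq p] :
    (iterateFrobenius Fq[X] p n).Finite := by
  refine RingHom.IsIntegral.to_finite ?_ ?_
  · intro x
    refine ⟨X ^ p ^ n - C x, monic_X_pow_sub_C x (pow_pos (expChar_pos Fq p) n).ne', ?_⟩
    rw [eval₂_sub, eval₂_X_pow, eval₂_C, iterateFrobenius_def, sub_self]
  · refine RingHom.FiniteType.of_comp_finiteType (f := (C : Fq →+* Fq[X])) ?_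
    have h : (iterateFrobenius Fq[X] p n).comp C = C.comp (iterateFrobenius Fq p n) := by
      ext c
      simp [iterateFrobenius_def]
    rw [h]
    refine RingHom.FiniteType.comp ?_ (RingHom.FiniteType.of_surjective _
      (bijective_iterateFrobenius Fq p n).2)
    exact RingHom.finiteType_algebraMap.2 (inferInstance : Algebra.FiniteType Fq Fq[X])

variable (K : Type*) [Field K] [Algebra (RatFunc Fq) K] [FiniteDimensional (RatFunc Fq) K]

/-- Finiteness of the integral closure of `Fq[T]` in an arbitrary finite extension `K` of `Fq(T)`:
a power of Frobenius embeds it, semilinearly, into the integral closure in the separable part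
of `K`. -/
theorem finite_integralClosure [Algebra Fq[X] K] [IsScalarTower Fq[X] (RatFunc Fq) K] :
    Module.Finite Fq[X] (integralClosure Fq[X] K) := by
  obtain ⟨p, hp⟩ := ExpChar.exists Fq
  have : ExpChar (RatFunc Fq) p :=
    expChar_of_injective_algebraMap (algebraMap Fq (RatFunc Fq)).injective p
  have : ExpChar K p := expChar_of_injective_algebraMap (algebraMap (RatFunc Fq) K).injective p
  let Ks := separableClosure (RatFunc Fq) K
  have : ExpChar Ks p := expChar_of_injective_algebraMap (algebraMap (RatFunc Fq) Ks).injective p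
  let e := IsPurelyInseparable.exponent Ks K
  let φ : K →+* Ks := IsPurelyInseparable.iterateFrobenius Ks K p (le_refl e)
  have hφ : ∀ x, algebraMap Ks K (φ x) = x ^ p ^ e := fun x =>
    IsPurelyInseparable.algebraMap_iterateFrobenius Ks p (le_refl e) x
  have hfin : Module.Finite Fq[X] (integralClosure Fq[X] Ks) :=
    IsIntegralClosure.finite Fq[X] (RatFunc Fq) Ks (integralClosure Fq[X] Ks)
  have : IsScalarTower Fq[X] Ks K := IsScalarTower.of_algebraMap_eq fun _ => rfl
  have hint : ∀ x : integralClosure Fq[X] K, φ x ∈ integralClosure Fq[X] Ks := fun x => by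
    rw [mem_integralClosure_iff, ← isIntegral_algebraMap_iff (algebraMap Ks K).injective, hφ]
    exact x.2.pow _
  let ψ : integralClosure Fq[X] K →+* integralClosure Fq[X] Ks :=
    (φ.comp (integralClosure Fq[X] K).val.toRingHom).codRestrict _ hint
  let ρ : Fq[X] →+* integralClosure Fq[X] Ks :=
    (algebraMap Fq[X] (integralClosure Fq[X] Ks)).comp (iterateFrobenius Fq[X] p e)
  have hρ : ρ.Finite := RingHom.Finite.comp (RingHom.finite_algebraMap.2 hfin)
    (finite_iterateFrobenius_polynomial p e)
  refine finite_of_ringHom_injective hρ ψ (fun x y hxy => ?_) (RingHom.ext fun b => ?_)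
  · exact Subtype.ext (φ.injective (congrArg Subtype.val hxy))
  · refine Subtype.ext ((algebraMap Ks K).injective ?_)
    change algebraMap Ks K (φ (algebraMap Fq[X] K b)) =
      algebraMap Ks K (algebraMap Fq[X] Ks (iterateFrobenius Fq[X] p e b))
    rw [hφ, iterateFrobenius_def, ← IsScalarTower.algebraMap_apply, map_pow]

/-- Every finite extension of `Fq(T)` is simple: it lies in a field `F(t, y) = F(t + y)` with
`t^(p^e) = T` and `y` separable, and Steinitz' theorem applies. -/
theorem exists_primitive_element_ratFunc :
    ∃ x : K, IntermediateField.adjoin (RatFunc Fq) {x} = ⊤ := by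
  let F := RatFunc Fq
  let Ω := AlgebraicClosure K
  obtain ⟨p, hp⟩ := ExpChar.exists Fq
  have : ExpChar F p := expChar_of_injective_algebraMap (algebraMap Fq F).injective p
  have : ExpChar K p := expChar_of_injective_algebraMap (algebraMap F K).injective p
  have : ExpChar Ω p := expChar_of_injective_algebraMap (algebraMap F Ω).injective p
  let Ks := separableClosure F K
  have : ExpChar Ks p := expChar_of_injective_algebraMap (algebraMap F Ks).injective p
  let e := IsPurelyInseparable.exponent Ks K
  obtain ⟨y₀, hy₀⟩ := Field.exists_primitive_element F Ks
  obtain ⟨t, ht⟩ := IsAlgClosed.exists_pow_nat_eq (algebraMap F Ω RatFunc.X)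
    (pow_pos (expChar_pos Fq p) e)
  let ι : Ks →ₐ[F] Ω := (IsScalarTower.toAlgHom F K Ω).comp Ks.val
  set y : Ω := ι y₀ with hy
  have hysep : IsSeparable F y := (Algebra.IsSeparable.isSeparable F y₀).map ι ι.injective
  let N : IntermediateField F Ω := IntermediateField.adjoin F {t + y}
  have hsum : t + y ∈ N := IntermediateField.mem_adjoin_simple_self F _
  have hypow : y ^ p ^ e ∈ N := by
    have h1 : y ^ p ^ e = (t + y) ^ p ^ e - algebraMap F Ω RatFunc.X := by
      rw [add_pow_expChar_pow, ht, add_sub_cancel_left]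
    rw [h1]
    exact sub_mem (pow_mem hsum _) (N.algebraMap_mem _)
  have hadj :=
    IntermediateField.adjoin_simple_eq_adjoin_pow_expChar_pow_of_isSeparable F Ω hysep p e
  have hyN : y ∈ N := by
    have h1 : y ∈ IntermediateField.adjoin F {y ^ p ^ e} := by
      rw [← hadj]
      exact IntermediateField.mem_adjoin_simple_self F _
    exact (IntermediateField.adjoin_le_iff.2 (by simpa using hypow)) h1
  have htN : t ∈ N := by
    have := sub_mem hsum hyN
    rwa [add_sub_cancel_right] at this
  -- the `p^e`-th powers of elements of `N` form a field containing `F` and `y^(p^e)`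
  let M : Subfield Ω := N.toSubfield.map (iterateFrobenius Ω p e)
  have hMpow : ∀ z ∈ N, z ^ p ^ e ∈ M := fun z hz => ⟨z, hz, rfl⟩
  have hMpoly : ∀ b : Fq[X], algebraMap F Ω (algebraMap Fq[X] F b) ∈ M := by
    intro b
    induction b using Polynomial.induction_on' with
    | add b c hb hc => rw [map_add, map_add]; exact add_mem hb hc
    | monomial n c =>
      obtain ⟨d, rfl⟩ := (bijective_iterateFrobenius Fq p e).2 c
      rw [← C_mul_X_pow_eq_monomial, map_mul, map_mul, map_pow, map_pow, RatFunc.algebraMap_X,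
        iterateFrobenius_def, C_pow, map_pow, map_pow, ← ht]
      exact mul_mem (hMpow _ (N.algebraMap_mem _)) (pow_mem (hMpow _ htN) _)
  have hMF : ∀ c : F, algebraMap F Ω c ∈ M := fun c => by
    rw [← RatFunc.num_div_denom c, map_div₀]
    exact div_mem (hMpoly _) (hMpoly _)
  let M' : IntermediateField F Ω := M.toIntermediateField hMF
  have hKs : ∀ z : Ks, ι z ∈ M' := by
    intro z
    have h1 : z ∈ IntermediateField.adjoin F {y₀} := by rw [hy₀]; trivial
    have h2 : ι z ∈ (IntermediateField.adjoin F {y₀}).map ι := ⟨z, h1, rfl⟩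
    rw [IntermediateField.adjoin_map, Set.image_singleton, ← hy, hadj] at h2
    exact (IntermediateField.adjoin_le_iff.2 (Set.singleton_subset_iff.2 (hMpow y hyN))) h2
  -- `z^(p^e)` is separable, hence a `p^e`-th power of an element of `N`, which is then `z`
  have hK : ∀ z : K, algebraMap K Ω z ∈ N := by
    intro z
    obtain ⟨w, hw⟩ := IsPurelyInseparable.exponent_def' Ks p z
    obtain ⟨v, hv, hv'⟩ := hKs w
    have h1 : iterateFrobenius Ω p e v = iterateFrobenius Ω p e (algebraMap K Ω z) := by
      rw [iterateFrobenius_def _ _ (algebraMap K Ω z), ← map_pow, ← hw]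
      exact hv'
    rw [← iterateFrobenius_inj Ω p e h1]
    exact hv
  let κ : K →ₐ[F] N := (IsScalarTower.toAlgHom F K Ω).codRestrict N.toSubalgebra hK
  have hint : IsIntegral F (t + y) := (Algebra.IsAlgebraic.isAlgebraic (R := F) (t + y)).isIntegral
  have hfd : FiniteDimensional F N := IntermediateField.adjoin.finiteDimensional hint
  have hgen : IntermediateField.adjoin F {IntermediateField.AdjoinSimple.gen F (t + y)} = ⊤ := by
    refine IntermediateField.map_injective N.val ?_
    rw [IntermediateField.adjoin_map, Set.image_singleton, ← AlgHom.fieldRange_eq_map,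
      IntermediateField.fieldRange_val]
    rfl
  -- `K` embeds in the simple extension `N`, so it has finitely many subfields as well
  have hfin : Finite (IntermediateField F N) :=
    Field.exists_primitive_element_iff_finite_intermediateField F N |>.1
      ⟨inferInstance, _, hgen⟩
  have : Finite (IntermediateField F K) :=
    Finite.of_injective _ (IntermediateField.map_injective κ)
  exact ((Field.exists_primitive_element_iff_finite_intermediateField F K).2 this).2

end FunctionField

end DrinfeldCM

namespace DrinfeldCM

/-! ### Zero sets all of whose points are algebraic -/

section ZeroSet

universe u

/-- A closed subset of affine space is finite as soon as all its points, with values in any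
algebraically closed extension, are algebraic: each irreducible component is then a point. -/
theorem finite_zeroSet_of_forall_isAlgebraic {L : Type u} [Field L] [IsAlgClosed L] {ι : Type}
    [Finite ι] (Q : Set (MvPolynomial ι L))
    (h : ∀ (L' : Type u) [Field L'] [IsAlgClosed L'] [Algebra L L'] (x : ι → L'),
      (∀ P ∈ Q, MvPolynomial.aeval x P = 0) → ∀ i, IsAlgebraic L (x i)) :
    {x : ι → L | ∀ P ∈ Q, MvPolynomial.aeval x P = 0}.Finite := by
  have hle : ∀ x : ι → L, (∀ P ∈ Q, MvPolynomial.aeval x P = 0) →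
      ∃ 𝔭 ∈ (Ideal.span Q).minimalPrimes,
        𝔭 ≤ RingHom.ker (MvPolynomial.aeval x : MvPolynomial ι L →ₐ[L] L) := by
    intro x hx
    have : (RingHom.ker (MvPolynomial.aeval x : MvPolynomial ι L →ₐ[L] L)).IsPrime :=
      RingHom.ker_isPrime _
    exact Ideal.exists_minimalPrimes_le (Ideal.span_le.2 fun P hP => hx P hP)
  choose! 𝔭 h𝔭 h𝔭le using hle
  refine Set.Finite.of_finite_image (f := 𝔭)
    ((Ideal.finite_minimalPrimes_of_isNoetherianRing _ (Ideal.span Q)).subset ?_) ?_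
  · rintro _ ⟨x, hx, rfl⟩
    exact h𝔭 x hx
  · intro x hx y hy hxy
    have hprime : (𝔭 x).IsPrime := (h𝔭 x hx).1.1
    -- the generic point of the component of `x` is algebraic, so its coordinates are constants
    let R' := MvPolynomial ι L ⧸ 𝔭 x
    let L' := AlgebraicClosure (FractionRing R')
    have hinj : Function.Injective (algebraMap R' L') := by
      rw [IsScalarTower.algebraMap_eq R' (FractionRing R') L']
      exact (algebraMap (FractionRing R') L').injective.comp
        (IsFractionRing.injective R' (FractionRing R'))
    let f : MvPolynomial ι L →ₐ[L] L' :=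
      (IsScalarTower.toAlgHom L R' L').comp (Ideal.Quotient.mkₐ L (𝔭 x))
    have hker : ∀ P, f P = 0 → P ∈ 𝔭 x := fun P hP =>
      Ideal.Quotient.eq_zero_iff_mem.1 (hinj (by rw [map_zero]; exact hP))
    have hf : f = MvPolynomial.aeval fun i => f (MvPolynomial.X i) :=
      MvPolynomial.algHom_ext fun i => by simp
    have halg := h L' (fun i => f (MvPolynomial.X i)) (fun P hP => by
      rw [← hf]
      have h0 : P ∈ 𝔭 x := (h𝔭 x hx).1.2 (Ideal.subset_span hP)
      change algebraMap R' L' (Ideal.Quotient.mk _ P) = 0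
      rw [Ideal.Quotient.eq_zero_iff_mem.2 h0, map_zero])
    funext i
    obtain ⟨c, hc⟩ : f (MvPolynomial.X i) ∈ (algebraMap L L').range :=
      minpoly.mem_range_of_degree_eq_one L _ (IsAlgClosed.degree_eq_one_of_irreducible L
        (minpoly.irreducible (halg i).isIntegral))
    have hmem : MvPolynomial.X i - MvPolynomial.C c ∈ 𝔭 x := hker _ (by
      rw [map_sub, ← hc, sub_eq_zero]
      exact (f.commutes c).symm)
    have h1 := h𝔭le x hx hmem
    have h2 := h𝔭le y hy (hxy ▸ hmem)
    rw [RingHom.mem_ker, map_sub, sub_eq_zero, MvPolynomial.aeval_X, MvPolynomial.aeval_C] at h1 h2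
    rw [h1, h2]

/-- The integral closure of a subring of a field is the intersection of the valuation rings
containing it. -/
theorem isIntegralElem_of_forall_valuationSubring {R K : Type*} [CommRing R] [Field K]
    (f : R →+* K) (x : K) (h : ∀ V : ValuationSubring K, (∀ r, f r ∈ V) → x ∈ V) :
    f.IsIntegralElem x := by
  have h1 : x ∈ ⨅ V : {V : ValuationSubring K // (f.range : Set K) ⊆ V.toSubring},
      V.1.toSubring := by
    rw [Subring.mem_iInf]
    exact fun V => h V.1 fun r => V.2 ⟨r, rfl⟩
  rw [iInf_valuationSubring_superset] at h1
  obtain ⟨p, hp, hp0⟩ := h1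
  have hcl : Subring.closure (f.range : Set K) = f.range := Subring.closure_eq _
  have hlift : p.map (algebraMap (Subring.closure (f.range : Set K)) K) ∈ lifts f := by
    rw [lifts_iff_coeff_lifts]
    intro n
    rw [coeff_map]
    exact hcl.le (p.coeff n).2
  obtain ⟨g, hg, -, hgm⟩ := lifts_and_natDegree_eq_and_monic hlift (hp.map _)
  refine ⟨g, hgm, ?_⟩
  rw [← eval_map, hg, eval_map, hp0]

end ZeroSet

/-! ### Finiteness and integrality of Drinfeld modules with complex multiplication -/

section Rigid

universe u

open TwistedPoly

variable {Fq : Type*} [Field Fq] [Fintype Fq] {L : Type u} [Field L] [Algebra Fq L]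

/-- Over an algebraically closed field, a normalised Drinfeld module with an endomorphism of
maximal degree has integral coefficients, and so has the endomorphism. -/
theorem isIntegralElem_tc [IsAlgClosed L] {R : Type*} [CommRing R] (f : R →+* L)
    (hf : ∀ c : Fq, algebraMap Fq L c ∈ f.range) {t u : TwistedPoly Fq L} (h : u * t = t * u)
    (hr : t.tdeg ≠ 0) (hlead : t.tc t.tdeg = 1) (h0 : t.tc 0 ∈ f.range)
    (hα : ∀ p : Fq[X][X], p.Monic →
      p.eval₂ (aeval (t.tc 0) : Fq[X] →ₐ[Fq] L).toRingHom (u.tc 0) = 0 → t.tdeg ≤ p.natDegree)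
    (i : ℕ) : f.IsIntegralElem (t.tc i) ∧ f.IsIntegralElem (u.tc i) := by
  have key : ∀ V : ValuationSubring L, (∀ r, f r ∈ V) → ∀ i, t.tc i ∈ V ∧ u.tc i ∈ V := by
    intro V hV
    refine good_reduction V (fun c => ?_) h hr hlead ?_ hα
    · obtain ⟨r, hr⟩ := hf c
      exact hr ▸ hV r
    · obtain ⟨r, hr⟩ := h0
      exact hr ▸ hV r
  exact ⟨isIntegralElem_of_forall_valuationSubring f _ fun V hV => (key V hV i).1,
    isIntegralElem_of_forall_valuationSubring f _ fun V hV => (key V hV i).2⟩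

/-- The twisted polynomial with prescribed coefficients up to degree `n`. -/
def ofCoeffs (c : ℕ → L) (n : ℕ) : TwistedPoly Fq L := ∑ i ∈ Finset.range (n + 1), mono (c i) i

theorem tc_ofCoeffs (c : ℕ → L) {n : ℕ} (hc : ∀ i > n, c i = 0) (i : ℕ) :
    (ofCoeffs c n : TwistedPoly Fq L).tc i = c i := by
  rw [ofCoeffs, tc_sum]
  simp only [tc_mono]
  rw [Finset.sum_ite_eq]
  split_ifs with h
  · rfl
  · rw [hc i (by simpa using h)]

/-- For fixed `T`, fixed derivative `α` of maximal degree and bounded degree of the endomorphism,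
only finitely many normalised Drinfeld modules have such an endomorphism. The pairs form a closed
subset of affine space, whose points over every algebraically closed extension are integral. -/
theorem finite_setOf_endomorphism [IsAlgClosed L] (θ α : L) {r : ℕ} (hr : r ≠ 0) (d : ℕ)
    (hα : ∀ p : Fq[X][X], p.Monic →
      p.eval₂ (aeval θ : Fq[X] →ₐ[Fq] L).toRingHom α = 0 → r ≤ p.natDegree) :
    {t : TwistedPoly Fq L | t.tdeg = r ∧ t.tc r = 1 ∧ t.tc 0 = θ ∧
      ∃ u : TwistedPoly Fq L, u * t = t * u ∧ u.tc 0 = α ∧ u.tdeg ≤ d}.Finite := by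
  let q := Fintype.card Fq
  let ι := Fin r ⊕ Fin (d + 1)
  -- `G` and `H` are the coefficients of the generic `t` and `u`, and `E n` is the coefficient of
  -- `τ^n` in `u t - t u`
  let G : ℕ → MvPolynomial ι L := fun i =>
    if h : i < r then MvPolynomial.X (Sum.inl ⟨i, h⟩) else if i = r then 1 else 0
  let H : ℕ → MvPolynomial ι L := fun j =>
    if h : j < d + 1 then MvPolynomial.X (Sum.inr ⟨j, h⟩) else 0
  let E : ℕ → MvPolynomial ι L := fun n =>
    ∑ x ∈ Finset.HasAntidiagonal.antidiagonal n, H x.1 * G x.2 ^ (q ^ x.1) -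
      ∑ x ∈ Finset.HasAntidiagonal.antidiagonal n, G x.1 * H x.2 ^ (q ^ x.1)
  let Q : Set (MvPolynomial ι L) :=
    insert (G 0 - MvPolynomial.C θ) (insert (H 0 - MvPolynomial.C α) (Set.range E))
  have hfin := finite_zeroSet_of_forall_isAlgebraic Q (by
    intro L' _ _ _ x hx
    let : Algebra Fq L' := ((algebraMap L L').comp (algebraMap Fq L)).toAlgebra
    have : IsScalarTower Fq L L' := IsScalarTower.of_algebraMap_eq fun _ => rfl
    set g : ℕ → L' := fun i => MvPolynomial.aeval x (G i) with hg
    set w : ℕ → L' := fun i => MvPolynomial.aeval x (H i) with hw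
    have hgr : g r = 1 := by simp [hg, G]
    have hgz : ∀ i > r, g i = 0 := fun i hi => by
      have h1 : ¬ i < r := by omega
      have h2 : ¬ i = r := by omega
      simp [hg, G, h1, h2]
    have hwz : ∀ i > d, w i = 0 := fun i hi => by
      have h1 : ¬ i < d + 1 := by omega
      simp only [hw, H, dif_neg h1, map_zero]
    let t : TwistedPoly Fq L' := ofCoeffs g r
    let u : TwistedPoly Fq L' := ofCoeffs w d
    have ht : ∀ i, t.tc i = g i := tc_ofCoeffs g hgz
    have hu : ∀ i, u.tc i = w i := tc_ofCoeffs w hwz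
    have htdeg : t.tdeg = r := tdeg_eq_of (by rw [ht, hgr]; exact one_ne_zero)
      fun i hi => by rw [ht, hgz i hi]
    have h0 : g 0 = algebraMap L L' θ := by
      have := hx _ (Set.mem_insert _ _)
      rwa [map_sub, MvPolynomial.aeval_C, sub_eq_zero] at this
    have h0' : w 0 = algebraMap L L' α := by
      have := hx _ (Set.mem_insert_of_mem _ (Set.mem_insert _ _))
      rwa [map_sub, MvPolynomial.aeval_C, sub_eq_zero] at this
    have hcomm : u * t = t * u := ext_tc fun n => by
      have h1 := hx (E n) (Set.mem_insert_of_mem _ (Set.mem_insert_of_mem _ ⟨n, rfl⟩))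
      simp only [E, map_sub, map_sum, map_mul, map_pow, sub_eq_zero] at h1
      rw [tc_mul, tc_mul]
      simp only [ht, hu]
      exact h1
    have hint := isIntegralElem_tc (algebraMap L L') (fun c => ⟨algebraMap Fq L c, rfl⟩) hcomm
      (by rw [htdeg]; exact hr) (by rw [htdeg, ht, hgr]) ⟨θ, by rw [ht, h0]⟩ (by
        intro p hp hp0
        rw [htdeg]
        refine hα p hp ((algebraMap L L').injective ?_)
        rw [map_zero, ← hp0, hom_eval₂, ht, hu, h0, h0']
        congr 1
        refine RingHom.ext fun b => ?_
        exact (aeval_algebraMap_apply L' θ b).symm)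
    rintro (i | j)
    · have h1 : IsIntegral L (t.tc i) := (hint i).1
      rw [ht] at h1
      simp only [hg, G, dif_pos i.2, MvPolynomial.aeval_X] at h1
      exact h1.isAlgebraic
    · have h1 : IsIntegral L (u.tc j) := (hint j).2
      rw [hu] at h1
      simp only [hw, H, dif_pos j.2, MvPolynomial.aeval_X] at h1
      exact h1.isAlgebraic)
  refine (hfin.image fun x => (ofCoeffs (fun i => MvPolynomial.aeval x (G i)) r :
    TwistedPoly Fq L)).subset ?_
  rintro t ⟨htdeg, htr, ht0, u, hu, hu0, hud⟩
  have hG : ∀ i, MvPolynomial.aeval (Sum.elim (fun i : Fin r => t.tc i)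
      fun j : Fin (d + 1) => u.tc j) (G i) = t.tc i := by
    intro i
    simp only [G]
    split_ifs with h h
    · rw [MvPolynomial.aeval_X, Sum.elim_inl]
    · rw [map_one, h, htr]
    · rw [map_zero, tc_eq_zero_of_tdeg_lt (by omega)]
  have hH : ∀ i, MvPolynomial.aeval (Sum.elim (fun i : Fin r => t.tc i)
      fun j : Fin (d + 1) => u.tc j) (H i) = u.tc i := by
    intro i
    simp only [H]
    split_ifs with h
    · rw [MvPolynomial.aeval_X, Sum.elim_inr]
    · rw [map_zero, tc_eq_zero_of_tdeg_lt (by omega)]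
  refine ⟨Sum.elim (fun i : Fin r => t.tc i) fun j : Fin (d + 1) => u.tc j, ?_, ?_⟩
  · intro P hP
    rcases hP with rfl | rfl | ⟨n, rfl⟩
    · rw [map_sub, hG, MvPolynomial.aeval_C, ht0]
      exact sub_self _
    · rw [map_sub, hH, MvPolynomial.aeval_C, hu0]
      exact sub_self _
    · simp only [E, map_sub, map_sum, map_mul, map_pow, hG, hH]
      rw [← tc_mul, ← tc_mul, hu, sub_self]
  · refine ext_tc fun i => ?_
    rw [tc_ofCoeffs _ (fun i hi => by rw [hG, tc_eq_zero_of_tdeg_lt (by omega)]), hG]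

end Rigid

end DrinfeldCM

namespace DrinfeldCM

/-! ### Endomorphisms and their derivatives -/

open TwistedPoly

section Injectivity

variable {Fq : Type*} [Field Fq] [Fintype Fq] {L : Type*} [Field L] [Algebra Fq L]

/-- In generic characteristic an endomorphism is determined by its derivative. -/
theorem eq_zero_of_commute_of_tc_zero {t u : TwistedPoly Fq L} (h : u * t = t * u)
    (hθ : ∀ i ≠ 0, t.tc 0 ^ (Fintype.card Fq ^ i) ≠ t.tc 0) (h0 : u.tc 0 = 0) : u = 0 := by
  refine ext_tc fun n => ?_
  rw [tc_zero]
  induction n using Nat.strong_induction_on with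
  | _ n ih =>
  rcases Nat.eq_zero_or_pos n with rfl | hn
  · exact h0
  -- if all coefficients below `τ^n` vanish, compare the coefficients of `τ^n` in `u t = t u`
  have h1 := congrArg (fun f => f.tc n) h
  simp only [tc_mul] at h1
  rw [Finset.sum_eq_single_of_mem (n, 0) (by simp), Finset.sum_eq_single_of_mem (0, n) (by simp)]
    at h1
  · have h2 : u.tc n * (t.tc 0 ^ (Fintype.card Fq ^ n) - t.tc 0) = 0 := by
      rw [mul_sub, h1]
      simp [mul_comm]
    exact (mul_eq_zero.1 h2).resolve_right (sub_ne_zero.2 (hθ n hn.ne'))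
  · rintro ⟨a, b⟩ hab hne
    simp only [Finset.HasAntidiagonal.mem_antidiagonal] at hab
    have hb : b ≠ n := fun hb => hne (by ext <;> simp <;> omega)
    simp [ih b (by omega)]
  · rintro ⟨a, b⟩ hab hne
    simp only [Finset.HasAntidiagonal.mem_antidiagonal] at hab
    have ha : a ≠ n := fun ha => hne (by ext <;> simp <;> omega)
    simp [ih a (by omega)]

end Injectivity

variable {Fq : Type*} [Field Fq] [Fintype Fq] {L : Type*} [Field L] [Algebra Fq L]
  [Algebra Fq[X] L] [IsScalarTower Fq Fq[X] L] {r : ℕ}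

theorem aeval_algebraMap_X_eq (b : Fq[X]) :
    aeval (algebraMap Fq[X] L X) b = algebraMap Fq[X] L b := by
  rw [aeval_algebraMap_apply, aeval_X_left_apply]

variable (Fq L) in
theorem aeval_algebraMap_X_toRingHom :
    (aeval (algebraMap Fq[X] L X) : Fq[X] →ₐ[Fq] L).toRingHom = algebraMap Fq[X] L :=
  RingHom.ext aeval_algebraMap_X_eq

namespace DrinfeldModule

/-- The twisted polynomial `φ_T`. -/
abbrev t (φ : DrinfeldModule Fq L r) : TwistedPoly Fq L := φ.toAlgHom X

theorem t_ne_zero (φ : DrinfeldModule Fq L r) : φ.t ≠ 0 := by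
  intro h
  have h1 := φ.natDegree_eq
  rw [show φ.toAlgHom X = 0 from h, poly_zero, natDegree_zero] at h1
  exact (pow_ne_zero _ Fintype.card_ne_zero) h1.symm

theorem tdeg_t (φ : DrinfeldModule Fq L r) : φ.t.tdeg = r := by
  rw [tdeg, φ.natDegree_eq, Nat.log_pow (one_lt_q (Fq := Fq))]

theorem tc_t_zero (φ : DrinfeldModule Fq L r) : φ.t.tc 0 = algebraMap Fq[X] L X := by
  rw [tc, pow_zero, φ.coeff_one]

theorem g_eq_tc (φ : DrinfeldModule Fq L r) (i : ℕ) : φ.g i = φ.t.tc i := rfl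

theorem toAlgHom_eq_aeval (φ : DrinfeldModule Fq L r) : φ.toAlgHom = aeval φ.t :=
  Polynomial.algHom_ext (by rw [aeval_X])

theorem ext_t {φ ψ : DrinfeldModule Fq L r} (h : φ.t = ψ.t) : φ = ψ := by
  have h1 : φ.toAlgHom = ψ.toAlgHom := Polynomial.algHom_ext h
  cases φ; cases ψ; cases h1; rfl

/-- The Drinfeld module with prescribed `φ_T`. -/
def ofTwisted (t : TwistedPoly Fq L) (h0 : t.tc 0 = algebraMap Fq[X] L X) (ht : t ≠ 0)
    (hr : t.tdeg = r) : DrinfeldModule Fq L r where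
  toAlgHom := aeval t
  coeff_one := by rw [aeval_X, ← h0, tc, pow_zero]
  natDegree_eq := by rw [aeval_X, natDegree_eq_pow ht, hr]

theorem t_ofTwisted (t : TwistedPoly Fq L) (h0 : t.tc 0 = algebraMap Fq[X] L X) (ht : t ≠ 0)
    (hr : t.tdeg = r) : (ofTwisted t h0 ht hr).t = t := aeval_X t

theorem isMorphism_iff {φ ψ : DrinfeldModule Fq L r} {u : TwistedPoly Fq L} :
    φ.IsMorphism ψ u ↔ u * φ.t = ψ.t * u := by
  refine ⟨fun h => h X, fun h b => ?_⟩
  induction b using Polynomial.induction_on' with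
  | add b c hb hc => rw [map_add, map_add, mul_add, add_mul, hb, hc]
  | monomial n c =>
    have hpow : u * φ.t ^ n = ψ.t ^ n * u := SemiconjBy.pow_right (show SemiconjBy u _ _ from h) n
    rw [← C_mul_X_pow_eq_monomial, map_mul, map_mul, map_pow, map_pow, ← algebraMap_eq,
      AlgHom.commutes, AlgHom.commutes, ← mul_assoc, ← Algebra.commutes, mul_assoc, hpow, mul_assoc]

theorem mem_endRing {φ : DrinfeldModule Fq L r} {u : TwistedPoly Fq L} :
    u ∈ φ.endRing ↔ u * φ.t = φ.t * u := isMorphism_iff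

theorem toAlgHom_mem_endRing (φ : DrinfeldModule Fq L r) (b : Fq[X]) :
    φ.toAlgHom b ∈ φ.endRing := fun c => by rw [← map_mul, ← map_mul, mul_comm]

theorem tc_zero_toAlgHom (φ : DrinfeldModule Fq L r) (b : Fq[X]) :
    (φ.toAlgHom b).tc 0 = algebraMap Fq[X] L b := by
  have h : d0.comp (φ.toAlgHom : Fq[X] →+* TwistedPoly Fq L) = algebraMap Fq[X] L := by
    refine Polynomial.ringHom_ext (fun c => ?_) φ.tc_t_zero
    change (φ.toAlgHom (C c)).tc 0 = algebraMap Fq[X] L (C c)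
    rw [← algebraMap_eq, AlgHom.commutes, tc_algebraMap, if_pos rfl,
      ← IsScalarTower.algebraMap_apply]
  exact RingHom.congr_fun h b

theorem tdeg_toAlgHom (φ : DrinfeldModule Fq L r) (hr : r ≠ 0) {b : Fq[X]} (hb : b ≠ 0) :
    φ.toAlgHom b ≠ 0 ∧ (φ.toAlgHom b).tdeg = r * b.natDegree := by
  have hpow : ∀ n, (φ.t ^ n).tdeg = n * r := fun n => by rw [tdeg_pow φ.t_ne_zero, φ.tdeg_t]
  have hsum : ∀ i, (φ.toAlgHom b).tc i =
      ∑ a ∈ Finset.range (b.natDegree + 1), algebraMap Fq L (b.coeff a) * (φ.t ^ a).tc i := by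
    intro i
    rw [toAlgHom_eq_aeval, aeval_eq_sum_range_smul _ _ (Nat.lt_succ_self _), tc_sum]
    simp_rw [algebraMap_mul_eq_smul, tc_smul]
  have htop : (φ.toAlgHom b).tc (r * b.natDegree) ≠ 0 := by
    rw [hsum, Finset.sum_range_succ, Finset.sum_eq_zero, zero_add]
    · refine mul_ne_zero ?_ ?_
      · rw [Ne, map_eq_zero]
        exact leadingCoeff_ne_zero.2 hb
      · rw [mul_comm, ← hpow]
        exact tc_tdeg_ne_zero (pow_ne_zero _ φ.t_ne_zero)
    · intro a ha
      rw [tc_eq_zero_of_tdeg_lt, mul_zero]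
      rw [hpow, mul_comm]
      exact Nat.mul_lt_mul_of_pos_left (Finset.mem_range.1 ha) (Nat.pos_of_ne_zero hr)
  refine ⟨fun h => htop (by rw [h, tc_zero]), tdeg_eq_of htop fun i hi => ?_⟩
  rw [hsum]
  refine Finset.sum_eq_zero fun a ha => ?_
  rw [tc_eq_zero_of_tdeg_lt, mul_zero]
  rw [hpow, mul_comm]
  exact lt_of_le_of_lt (Nat.mul_le_mul_left _ (Nat.lt_succ_iff.1 (Finset.mem_range.1 ha))) hi

/-- The derivative, as an `Fq[T]`-algebra homomorphism on the endomorphism ring. -/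
def endD0 (φ : DrinfeldModule Fq L r) : φ.endRing →ₐ[Fq[X]] L where
  toRingHom := d0.comp φ.endRing.subtype
  commutes' b := φ.tc_zero_toAlgHom b

/-- The image in `L` of the endomorphism ring under the derivative. -/
def endImage (φ : DrinfeldModule Fq L r) : Subalgebra Fq[X] L := φ.endD0.range

theorem mem_endImage {φ : DrinfeldModule Fq L r} {x : L} :
    x ∈ φ.endImage ↔ ∃ u : TwistedPoly Fq L, u * φ.t = φ.t * u ∧ u.tc 0 = x := by
  constructor
  · rintro ⟨u, rfl⟩
    exact ⟨u, mem_endRing.1 u.2, rfl⟩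
  · rintro ⟨u, hu, rfl⟩
    exact ⟨⟨u, mem_endRing.2 hu⟩, rfl⟩

theorem tc_zero_evalPair (φ : DrinfeldModule Fq L r) (u : TwistedPoly Fq L) (p : Fq[X][X]) :
    (evalPair φ.t u p).tc 0 = aeval (u.tc 0) p := by
  have h := d0_evalPair φ.t u p
  rw [φ.tc_t_zero, aeval_algebraMap_X_toRingHom] at h
  exact h

variable [FaithfulSMul Fq[X] L]

variable (Fq L) in
theorem algebraMap_X_pow_ne (i : ℕ) (hi : i ≠ 0) :
    algebraMap Fq[X] L X ^ (Fintype.card Fq ^ i) ≠ algebraMap Fq[X] L X := by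
  rw [← map_pow]
  intro h
  have h1 := congrArg natDegree (FaithfulSMul.algebraMap_injective Fq[X] L h)
  rw [natDegree_X_pow, natDegree_X] at h1
  have := Nat.one_lt_pow hi (one_lt_q (Fq := Fq))
  omega

theorem eq_zero_of_tc_zero (φ : DrinfeldModule Fq L r) {u : TwistedPoly Fq L}
    (h : u * φ.t = φ.t * u) (h0 : u.tc 0 = 0) : u = 0 :=
  eq_zero_of_commute_of_tc_zero h
    (fun i hi => by rw [φ.tc_t_zero]; exact algebraMap_X_pow_ne Fq L i hi) h0

theorem eq_of_tc_zero_eq (φ : DrinfeldModule Fq L r) {u v : TwistedPoly Fq L}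
    (hu : u * φ.t = φ.t * u) (hv : v * φ.t = φ.t * v) (h0 : u.tc 0 = v.tc 0) : u = v := by
  rw [← sub_eq_zero]
  refine φ.eq_zero_of_tc_zero ?_ (by rw [tc_sub, h0, sub_self])
  rw [sub_mul, mul_sub, hu, hv]

/-- The endomorphism ring is isomorphic to its image under the derivative. -/
def endEquiv (φ : DrinfeldModule Fq L r) : φ.endRing ≃ₐ[Fq[X]] φ.endImage :=
  AlgEquiv.ofInjective φ.endD0 fun u v h =>
    Subtype.ext (φ.eq_of_tc_zero_eq (mem_endRing.1 u.2) (mem_endRing.1 v.2) h)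

theorem commute_of_mem_endRing (φ : DrinfeldModule Fq L r) {u v : TwistedPoly Fq L}
    (hu : u * φ.t = φ.t * u) (hv : v * φ.t = φ.t * v) : u * v = v * u := by
  refine φ.eq_of_tc_zero_eq ?_ ?_ ?_
  · rw [mul_assoc, hv, ← mul_assoc, hu, mul_assoc]
  · rw [mul_assoc, hu, ← mul_assoc, hv, mul_assoc]
  · rw [← d0_apply, ← d0_apply, map_mul, map_mul, mul_comm]

theorem evalPair_eq_zero_iff (φ : DrinfeldModule Fq L r) {u : TwistedPoly Fq L}
    (h : u * φ.t = φ.t * u) (p : Fq[X][X]) :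
    evalPair φ.t u p = 0 ↔ aeval (u.tc 0) p = 0 := by
  rw [← φ.tc_zero_evalPair]
  exact ⟨fun h => by rw [h, tc_zero], φ.eq_zero_of_tc_zero (commute_evalPair h p)⟩

/-- The derivative of an endomorphism is integral over `Fq[T]`, with bounds for the degrees of the
coefficients of an equation of degree `r`. -/
theorem exists_monic_aeval_eq_zero (φ : DrinfeldModule Fq L r) (hr : r ≠ 0)
    {u : TwistedPoly Fq L} (h : u * φ.t = φ.t * u) :
    ∃ p : Fq[X][X], p.Monic ∧ p.natDegree = r ∧ aeval (u.tc 0) p = 0 ∧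
      ∀ i a, (p.coeff i).coeff a ≠ 0 → r * a + i * u.tdeg ≤ r * u.tdeg := by
  obtain ⟨p, hp, hpr, hp0, hb⟩ := exists_monic_evalPair_eq_zero (by rwa [φ.tdeg_t]) h
  rw [φ.tdeg_t] at hpr
  refine ⟨p, hp, hpr, (φ.evalPair_eq_zero_iff h p).1 hp0, ?_⟩
  rwa [φ.tdeg_t] at hb

theorem isIntegral_tc_zero (φ : DrinfeldModule Fq L r) (hr : r ≠ 0)
    {u : TwistedPoly Fq L} (h : u * φ.t = φ.t * u) : IsIntegral Fq[X] (u.tc 0) := by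
  obtain ⟨p, hp, -, hp0, -⟩ := φ.exists_monic_aeval_eq_zero hr h
  exact ⟨p, hp, hp0⟩

/-- Every nonzero endomorphism `u` divides `φ_c`, where `c` is the constant coefficient of the
minimal polynomial of its derivative. -/
theorem exists_mul_eq_toAlgHom (φ : DrinfeldModule Fq L r) {u : TwistedPoly Fq L}
    (h : u * φ.t = φ.t * u) {p : Fq[X][X]} (hp : aeval (u.tc 0) p = 0) :
    ∃ w : TwistedPoly Fq L, w * φ.t = φ.t * w ∧ w * u = φ.toAlgHom (p.coeff 0) := by
  refine ⟨-evalPair φ.t u p.divX, ?_, ?_⟩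
  · rw [neg_mul, mul_neg, commute_evalPair h]
  · have h1 := (φ.evalPair_eq_zero_iff h p).2 hp
    rw [← p.divX_mul_X_add, evalPair, eval₂_add, eval₂_mul_X, eval₂_C] at h1
    rw [neg_mul, neg_eq_iff_add_eq_zero, toAlgHom_eq_aeval]
    exact h1

end DrinfeldModule

end DrinfeldCM

namespace DrinfeldCM

/-! ### The place at infinity -/

section Infinity

variable (Fq : Type*) [Field Fq]

open Classical in
/-- The valuation ring of the place `∞` of `Fq(T)`. -/
def inftyRing : ValuationSubring (RatFunc Fq) := (RatFunc.inftyValuation Fq).valuationSubring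

variable {Fq}

theorem div_mem_inftyRing {p b : Fq[X]} (hp : p ≠ 0) (hb : b ≠ 0) :
    algebraMap Fq[X] (RatFunc Fq) p / algebraMap Fq[X] (RatFunc Fq) b ∈ inftyRing Fq ↔
      p.natDegree ≤ b.natDegree := by
  classical
  rw [inftyRing, Valuation.mem_valuationSubring_iff, map_div₀, RatFunc.inftyValuation_apply,
    RatFunc.inftyValuation_apply, RatFunc.inftyValuation.polynomial _ hp,
    RatFunc.inftyValuation.polynomial _ hb, ← WithZero.exp_sub, ← WithZero.exp_zero,
    WithZero.exp_le_exp]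
  omega

theorem div_mem_inftyRing_of_le {p b : Fq[X]} (hb : b ≠ 0) (h : p.natDegree ≤ b.natDegree) :
    algebraMap Fq[X] (RatFunc Fq) p / algebraMap Fq[X] (RatFunc Fq) b ∈ inftyRing Fq := by
  rcases eq_or_ne p 0 with rfl | hp
  · rw [map_zero, zero_div]
    exact zero_mem _
  · exact (div_mem_inftyRing hp hb).2 h

theorem algebraMap_X_notMem_inftyRing :
    algebraMap Fq[X] (RatFunc Fq) X ∉ inftyRing Fq := by
  have h := div_mem_inftyRing (Fq := Fq) X_ne_zero one_ne_zero
  rw [map_one, div_one, natDegree_X, natDegree_one] at h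
  rw [h]
  omega

theorem exists_eq_div (x : RatFunc Fq) : ∃ p b : Fq[X], b ≠ 0 ∧
    x = algebraMap Fq[X] (RatFunc Fq) p / algebraMap Fq[X] (RatFunc Fq) b :=
  ⟨x.num, x.denom, x.denom_ne_zero, x.num_div_denom.symm⟩

theorem aeval_div_scaleRoots {L : Type*} [Field L] [Algebra Fq[X] L] [Algebra (RatFunc Fq) L]
    [IsScalarTower Fq[X] (RatFunc Fq) L] {x : L} {p : Fq[X][X]} (hx : aeval x p = 0) (b : Fq[X]) :
    aeval (x / algebraMap Fq[X] L b) ((p.map (algebraMap Fq[X] (RatFunc Fq))).scaleRoots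
      (algebraMap Fq[X] (RatFunc Fq) b)⁻¹) = 0 := by
  have h1 : eval₂ (algebraMap (RatFunc Fq) L) x (p.map (algebraMap Fq[X] (RatFunc Fq))) = 0 := by
    rw [eval₂_map, ← IsScalarTower.algebraMap_eq]; exact hx
  have h2 := scaleRoots_eval₂_eq_zero (s := (algebraMap Fq[X] (RatFunc Fq) b)⁻¹) _ h1
  rw [map_inv₀, ← IsScalarTower.algebraMap_apply, mul_comm, ← div_eq_mul_inv] at h2
  exact h2

/-- A root of a monic polynomial over `Fq[T]` whose coefficients have degree at most
`(r - i) d` becomes integral over the valuation ring of `∞` after division by a polynomial of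
degree `d`. -/
theorem isIntegral_inftyRing_div {L : Type*} [Field L] [Algebra Fq[X] L] [Algebra (RatFunc Fq) L]
    [IsScalarTower Fq[X] (RatFunc Fq) L] {x : L} {p : Fq[X][X]} (hp : p.Monic)
    (hx : aeval x p = 0) {b : Fq[X]} (hb : b ≠ 0)
    (hdeg : ∀ i < p.natDegree, (p.coeff i).natDegree ≤ (p.natDegree - i) * b.natDegree) :
    IsIntegral (inftyRing Fq) (x / algebraMap Fq[X] L b) := by
  let V := inftyRing Fq
  -- `P` is `b ^ (-deg p) p(b Y)`, with root `x / b`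
  let P : (RatFunc Fq)[X] := (p.map (algebraMap Fq[X] (RatFunc Fq))).scaleRoots
    (algebraMap Fq[X] (RatFunc Fq) b)⁻¹
  have hPm : P.Monic := (monic_scaleRoots_iff _).2 (hp.map _)
  have hP0 : aeval (x / algebraMap Fq[X] L b) P = 0 := aeval_div_scaleRoots hx b
  have hPc : ∀ i, P.coeff i ∈ V := by
    intro i
    rw [coeff_scaleRoots, coeff_map, hp.natDegree_map, inv_pow, ← div_eq_mul_inv, ← map_pow]
    rcases lt_or_ge i p.natDegree with hi | hi
    · refine div_mem_inftyRing_of_le (pow_ne_zero _ hb) ?_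
      rw [natDegree_pow]
      exact hdeg i hi
    · refine div_mem_inftyRing_of_le (pow_ne_zero _ hb) ?_
      rcases hi.eq_or_lt with rfl | hi
      · rw [hp.coeff_natDegree]; simp
      · rw [coeff_eq_zero_of_natDegree_lt hi]; simp
  clear_value P
  obtain ⟨Q, hQ, -, hQm⟩ := Polynomial.lifts_and_natDegree_eq_and_monic
    (f := algebraMap V (RatFunc Fq)) ((Polynomial.lifts_iff_coeff_lifts _).2
      fun i => ⟨⟨P.coeff i, hPc i⟩, rfl⟩) hPm
  refine ⟨Q, hQm, ?_⟩
  rw [← hP0, ← hQ, aeval_map_algebraMap]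
  rfl

end Infinity

section Fields

variable {Fq : Type*} [Field Fq] {L : Type*} [Field L]
  [Algebra Fq[X] L] [Algebra (RatFunc Fq) L] [IsScalarTower Fq[X] (RatFunc Fq) L]

variable (Fq L) in
theorem faithfulSMul_polynomial : FaithfulSMul Fq[X] L := by
  rw [faithfulSMul_iff_algebraMap_injective, IsScalarTower.algebraMap_eq Fq[X] (RatFunc Fq) L]
  exact (algebraMap (RatFunc Fq) L).injective.comp (FaithfulSMul.algebraMap_injective _ _)

instance isScalarTower_intermediateField (K : IntermediateField (RatFunc Fq) L) :
    IsScalarTower Fq[X] K L := .of_algebraMap_eq fun _ => rfl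

/-- The norm of an integral element is, up to sign, a power of the constant coefficient of its
minimal polynomial. -/
theorem exists_norm_eq_coeff_zero_pow (K : IntermediateField (RatFunc Fq) L)
    [FiniteDimensional (RatFunc Fq) K] {x : K} (hx : IsIntegral Fq[X] (x : L)) :
    ∃ e, e * (minpoly Fq[X] (x : L)).natDegree = Module.finrank (RatFunc Fq) K ∧
      Algebra.norm (RatFunc Fq) x = algebraMap Fq[X] (RatFunc Fq)
        (((-1) ^ (minpoly Fq[X] (x : L)).natDegree * (minpoly Fq[X] (x : L)).coeff 0) ^ e) := by
  have hxK : IsIntegral (RatFunc Fq) x := Algebra.IsIntegral.isIntegral x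
  have h1 : minpoly (RatFunc Fq) x =
      (minpoly Fq[X] (x : L)).map (algebraMap Fq[X] (RatFunc Fq)) := by
    rw [← minpoly.isIntegrallyClosed_eq_field_fractions (RatFunc Fq) L hx]
    exact (minpoly.algebraMap_eq (algebraMap K L).injective x).symm
  have hdeg : (minpoly (RatFunc Fq) x).natDegree = (minpoly Fq[X] (x : L)).natDegree := by
    rw [h1, (minpoly.monic hx).natDegree_map]
  refine ⟨Module.finrank (IntermediateField.adjoin (RatFunc Fq) {x}) K, ?_, ?_⟩
  · rw [← hdeg, ← IntermediateField.adjoin.finrank hxK, mul_comm, Module.finrank_mul_finrank]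
  · rw [Algebra.norm_eq_norm_adjoin, ← IntermediateField.adjoin.powerBasis_gen hxK,
      Algebra.PowerBasis.norm_gen_eq_coeff_zero_minpoly, IntermediateField.adjoin.powerBasis_dim,
      IntermediateField.adjoin.powerBasis_gen, IntermediateField.minpoly_gen, hdeg, h1, coeff_map,
      map_pow, map_mul, map_pow, map_neg, map_one]

end Fields

end DrinfeldCM

namespace DrinfeldCM

/-! ### Orders and their fields of fractions -/

section Orders

variable {Fq : Type*} [Field Fq] {L : Type*} [Field L]
  [Algebra Fq[X] L] [Algebra (RatFunc Fq) L] [IsScalarTower Fq[X] (RatFunc Fq) L]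

theorem isImaginary_iff {K : IntermediateField (RatFunc Fq) L} :
    IsImaginary K ↔ ∃! V : ValuationSubring K,
      V.comap (algebraMap (RatFunc Fq) K) = inftyRing Fq := Iff.rfl

instance isScalarTower_inftyRing (K : IntermediateField (RatFunc Fq) L) :
    IsScalarTower (inftyRing Fq) K L := .of_algebraMap_eq fun _ => rfl

theorem mem_of_isIntegral_inftyRing {K : IntermediateField (RatFunc Fq) L} {V : ValuationSubring K}
    (hV : V.comap (algebraMap (RatFunc Fq) K) = inftyRing Fq) {x : K}
    (hx : IsIntegral (inftyRing Fq) (x : L)) : x ∈ V := by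
  have h1 : IsIntegral (inftyRing Fq) x :=
    (isIntegral_algHom_iff (IsScalarTower.toAlgHom (inftyRing Fq) K L)
      (algebraMap K L).injective).1 hx
  let ι : inftyRing Fq →+* V := RingHom.codRestrict ((algebraMap (RatFunc Fq) K).comp
    (inftyRing Fq).subtype) V fun y => by
      have hy : (y : RatFunc Fq) ∈ V.comap (algebraMap (RatFunc Fq) K) := by rw [hV]; exact y.2
      exact ValuationSubring.mem_comap.1 hy
  have h2 : IsIntegral V x := h1.map_of_comp_eq ι (RingHom.id K) rfl
  obtain ⟨y, hy⟩ := IsIntegrallyClosed.isIntegral_iff.1 h2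
  rw [← hy]
  exact y.2

theorem algebraMap_polynomial_ne_zero {b : Fq[X]} (hb : b ≠ 0) : algebraMap Fq[X] L b ≠ 0 := by
  have := faithfulSMul_polynomial Fq L
  rwa [Ne, FaithfulSMul.algebraMap_eq_zero_iff]

/-- The cofactor comes from the minimal polynomial of `β`, whose constant coefficient is nonzero. -/
theorem exists_mul_eq_algebraMap {O : Subalgebra Fq[X] L} {β : L} (hβ : β ∈ O) (hβ0 : β ≠ 0)
    (hint : IsIntegral Fq[X] β) : ∃ γ ∈ O, ∃ c : Fq[X], c ≠ 0 ∧ β * γ = algebraMap Fq[X] L c := by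
  have h0 : (minpoly Fq[X] β).coeff 0 ≠ 0 := by
    have hK : IsIntegral (RatFunc Fq) β := hint.tower_top
    have h := minpoly.coeff_zero_ne_zero hK hβ0
    rw [show β = algebraMap L L β from rfl,
      minpoly.isIntegrallyClosed_eq_field_fractions (RatFunc Fq) L hint, coeff_map] at h
    exact fun h0 => h (by rw [h0, map_zero])
  refine ⟨-aeval β (minpoly Fq[X] β).divX, ?_, (minpoly Fq[X] β).coeff 0,
    h0, ?_⟩
  · exact neg_mem (aeval_mem_adjoin_singleton Fq[X] β |> fun h =>
      Algebra.adjoin_le (Set.singleton_subset_iff.2 hβ) h)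
  · have h := minpoly.aeval Fq[X] β
    rw [← (minpoly Fq[X] β).divX_mul_X_add, map_add, map_mul, aeval_X, aeval_C] at h
    rw [mul_neg, neg_eq_iff_add_eq_zero, mul_comm, h]

/-- The field of fractions of a ring of integral elements consists of the `β / b` with `b` in
`Fq[T]`. -/
theorem mem_fracField_iff {O : Subalgebra Fq[X] L} (hint : ∀ β ∈ O, IsIntegral Fq[X] β) {x : L} :
    x ∈ fracField O ↔ ∃ β ∈ O, ∃ b : Fq[X], b ≠ 0 ∧ x = β / algebraMap Fq[X] L b := by
  have hne : ∀ {b : Fq[X]}, b ≠ 0 → algebraMap Fq[X] L b ≠ 0 := algebraMap_polynomial_ne_zero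
  constructor
  · intro hx
    induction hx using IntermediateField.adjoin_induction with
    | mem x hx => exact ⟨x, hx, 1, one_ne_zero, by rw [map_one, div_one]⟩
    | algebraMap x =>
      obtain ⟨p, b, hb, rfl⟩ := exists_eq_div x
      refine ⟨_, O.algebraMap_mem p, b, hb, ?_⟩
      rw [map_div₀, ← IsScalarTower.algebraMap_apply, ← IsScalarTower.algebraMap_apply]
    | add x y _ _ hx hy =>
      obtain ⟨β, hβ, b, hb, rfl⟩ := hx
      obtain ⟨γ, hγ, c, hc, rfl⟩ := hy
      refine ⟨β * algebraMap _ _ c + algebraMap _ _ b * γ, add_mem (mul_mem hβ (O.algebraMap_mem c))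
        (mul_mem (O.algebraMap_mem b) hγ), b * c, mul_ne_zero hb hc, ?_⟩
      rw [map_mul, div_add_div _ _ (hne hb) (hne hc)]
    | inv x _ hx =>
      obtain ⟨β, hβ, b, hb, rfl⟩ := hx
      rcases eq_or_ne β 0 with rfl | hβ0
      · exact ⟨0, zero_mem _, b, hb, by simp⟩
      · obtain ⟨γ, hγ, c, hc, h⟩ := exists_mul_eq_algebraMap hβ hβ0 (hint β hβ)
        refine ⟨algebraMap _ _ b * γ, mul_mem (O.algebraMap_mem b) hγ, c, hc, ?_⟩
        rw [inv_div, div_eq_div_iff hβ0 (hne hc), mul_assoc, mul_comm γ, h]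
    | mul x y _ _ hx hy =>
      obtain ⟨β, hβ, b, hb, rfl⟩ := hx
      obtain ⟨γ, hγ, c, hc, rfl⟩ := hy
      exact ⟨β * γ, mul_mem hβ hγ, b * c, mul_ne_zero hb hc, by rw [map_mul, div_mul_div_comm]⟩
  · rintro ⟨β, hβ, b, -, rfl⟩
    refine div_mem (IntermediateField.subset_adjoin _ _ hβ) ?_
    rw [IsScalarTower.algebraMap_apply Fq[X] (RatFunc Fq) L]
    exact (fracField O).algebraMap_mem _

/-- `Fq[T]` is noetherian, so the ring inherits finiteness from the integral closure in `K`. -/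
theorem finite_of_forall_isIntegral [Fintype Fq] {O : Subalgebra Fq[X] L}
    (hint : ∀ β ∈ O, IsIntegral Fq[X] β) {K : IntermediateField (RatFunc Fq) L}
    [FiniteDimensional (RatFunc Fq) K] (hK : ∀ β ∈ O, β ∈ K) : Module.Finite Fq[X] O := by
  have := finite_integralClosure (Fq := Fq) K
  have hmem : ∀ β : O, (⟨β, hK β β.2⟩ : K) ∈ integralClosure Fq[X] K := fun β =>
    (isIntegral_algHom_iff (IsScalarTower.toAlgHom Fq[X] K L)
      (algebraMap K L).injective).1 (hint β β.2)
  let ι : O →ₗ[Fq[X]] integralClosure Fq[X] K :=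
    { toFun := fun β => ⟨⟨β, hK β β.2⟩, hmem β⟩
      map_add' := fun _ _ => rfl
      map_smul' := fun c β => Subtype.ext (Subtype.ext (by
        simp only [Algebra.smul_def]; rfl)) }
  refine Module.Finite.of_injective ι fun β γ h => ?_
  have h1 := congrArg (fun z : integralClosure Fq[X] K => ((z : K) : L)) h
  exact Subtype.ext h1

/-- A subfield all of whose elements have degree at most `r` is generated by any element of
degree `r`. -/
theorem fracField_eq_adjoin [Fintype Fq] {O : Subalgebra Fq[X] L} {r : ℕ}
    (hO : ∀ x ∈ fracField O, IsIntegral (RatFunc Fq) x ∧ (minpoly (RatFunc Fq) x).natDegree ≤ r)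
    {α : L} (hα : α ∈ O) (hr : (minpoly (RatFunc Fq) α).natDegree = r) :
    fracField O = IntermediateField.adjoin (RatFunc Fq) {α} := by
  have hα' : α ∈ fracField O := IntermediateField.subset_adjoin _ _ hα
  refine le_antisymm (fun x hx => ?_) (IntermediateField.adjoin_simple_le_iff.2 hα')
  -- the field `F(α, x)` is simple, so its degree is bounded by `r` and it equals `F(α)`
  let M := IntermediateField.adjoin (RatFunc Fq) {α, x}
  have hM : M ≤ fracField O := IntermediateField.adjoin_le_iff.2 (by
    rintro y (rfl | rfl) <;> assumption)
  have : FiniteDimensional (RatFunc Fq) M := IntermediateField.finiteDimensional_adjoin (by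
    rintro y (rfl | rfl)
    · exact (hO _ hα').1
    · exact (hO _ hx).1)
  obtain ⟨y, hy⟩ := exists_primitive_element_ratFunc (Fq := Fq) M
  have hyr : Module.finrank (RatFunc Fq) M ≤ r := by
    rw [← IntermediateField.finrank_top', ← hy,
      IntermediateField.adjoin.finrank (Algebra.IsIntegral.isIntegral y),
      ← minpoly.algebraMap_eq (algebraMap M L).injective]
    exact (hO _ (hM y.2)).2
  have hle : IntermediateField.adjoin (RatFunc Fq) {α} ≤ M :=
    IntermediateField.adjoin.mono _ _ _ (by simp)
  have heq := IntermediateField.eq_of_le_of_finrank_le hle (by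
    rw [IntermediateField.adjoin.finrank (hO _ hα').1, hr]
    exact hyr)
  rw [heq]
  exact IntermediateField.subset_adjoin _ _ (by simp)

end Orders

end DrinfeldCM

namespace DrinfeldCM

/-! ### Degrees of endomorphisms and the place at infinity -/

open TwistedPoly

namespace DrinfeldModule

variable {Fq : Type*} [Field Fq] [Fintype Fq] {L : Type*} [Field L] [Algebra Fq L]
  [Algebra Fq[X] L] [Algebra (RatFunc Fq) L] [IsScalarTower Fq Fq[X] L]
  [IsScalarTower Fq[X] (RatFunc Fq) L] {r : ℕ}

theorem isIntegral_of_mem_endImage (φ : DrinfeldModule Fq L r) (hr : r ≠ 0) {β : L}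
    (hβ : β ∈ φ.endImage) : IsIntegral Fq[X] β := by
  have := faithfulSMul_polynomial Fq L
  obtain ⟨u, hu, rfl⟩ := mem_endImage.1 hβ
  exact φ.isIntegral_tc_zero hr hu

theorem mem_fracField_endImage (φ : DrinfeldModule Fq L r) (hr : r ≠ 0) {x : L} :
    x ∈ fracField φ.endImage ↔ ∃ u : TwistedPoly Fq L, u * φ.t = φ.t * u ∧ ∃ b : Fq[X], b ≠ 0 ∧
      x = u.tc 0 / algebraMap Fq[X] L b := by
  rw [mem_fracField_iff fun β hβ => φ.isIntegral_of_mem_endImage hr hβ]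
  constructor
  · rintro ⟨β, hβ, b, hb, rfl⟩
    obtain ⟨u, hu, rfl⟩ := mem_endImage.1 hβ
    exact ⟨u, hu, b, hb, rfl⟩
  · rintro ⟨u, hu, b, hb, rfl⟩
    exact ⟨_, mem_endImage.2 ⟨u, hu, rfl⟩, b, hb, rfl⟩

theorem natDegree_minpoly_le (φ : DrinfeldModule Fq L r) (hr : r ≠ 0) {x : L}
    (hx : x ∈ fracField φ.endImage) :
    IsIntegral (RatFunc Fq) x ∧ (minpoly (RatFunc Fq) x).natDegree ≤ r := by
  have := faithfulSMul_polynomial Fq L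
  obtain ⟨u, hu, b, hb, rfl⟩ := (φ.mem_fracField_endImage hr).1 hx
  obtain ⟨p, hp, hpr, hp0, -⟩ := φ.exists_monic_aeval_eq_zero hr hu
  have hP0 := aeval_div_scaleRoots hp0 b
  have hPm := (monic_scaleRoots_iff (algebraMap Fq[X] (RatFunc Fq) b)⁻¹).2
    (hp.map (algebraMap Fq[X] (RatFunc Fq)))
  refine ⟨⟨_, hPm, hP0⟩, (natDegree_le_of_dvd (minpoly.dvd _ _ hP0) hPm.ne_zero).trans ?_⟩
  rw [natDegree_scaleRoots, hp.natDegree_map, hpr]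

theorem isIntegral_inftyRing_tc_zero_div (φ : DrinfeldModule Fq L r) (hr : r ≠ 0)
    {u : TwistedPoly Fq L} (hu : u * φ.t = φ.t * u) {b : Fq[X]} (hb : b ≠ 0)
    (hub : u.tdeg ≤ r * b.natDegree) :
    IsIntegral (inftyRing Fq) (u.tc 0 / algebraMap Fq[X] L b) := by
  have := faithfulSMul_polynomial Fq L
  obtain ⟨p, hp, hpr, hp0, hbd⟩ := φ.exists_monic_aeval_eq_zero hr hu
  refine isIntegral_inftyRing_div hp hp0 hb fun i hi => ?_
  rw [hpr] at hi ⊢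
  rcases eq_or_ne (p.coeff i) 0 with h0 | h0
  · simp [h0]
  have h1 := hbd i _ (leadingCoeff_ne_zero.2 h0)
  have h2 : r * (p.coeff i).natDegree ≤ r * ((r - i) * b.natDegree) := by
    obtain ⟨k, rfl⟩ := Nat.exists_eq_add_of_lt hi
    rw [show i + k + 1 - i = k + 1 by omega]
    nlinarith
  exact Nat.le_of_mul_le_mul_left h2 (Nat.pos_of_ne_zero hr)

/-- The degree of the norm of an endomorphism `u` is at most `[K : F] / r` times the degree of `u`:
at every place over `∞` the derivative of `u` has absolute value at most `q ^ (deg u / r)`. -/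
theorem natDegree_norm_le (φ : DrinfeldModule Fq L r) (hr : r ≠ 0)
    {K : IntermediateField (RatFunc Fq) L}
    {u : TwistedPoly Fq L} (hu : u * φ.t = φ.t * u) {x : K} (hx : (x : L) = u.tc 0) {n : Fq[X]}
    (hn : Algebra.norm (RatFunc Fq) x = algebraMap Fq[X] (RatFunc Fq) n) :
    r * n.natDegree ≤ Module.finrank (RatFunc Fq) K * u.tdeg := by
  rcases eq_or_ne n 0 with rfl | hn0
  · simp
  have hpow : ∀ k, u ^ k * φ.t = φ.t * u ^ k := fun k =>
    (Commute.pow_left (show Commute u φ.t from hu) k)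
  -- since `deg u` need not be divisible by `r`, compare `u ^ r` with `T ^ deg u`
  have htd : (u ^ r).tdeg ≤ r * ((X : Fq[X]) ^ u.tdeg).natDegree := by
    rw [natDegree_X_pow]
    rcases eq_or_ne u 0 with rfl | hu0
    · rw [zero_pow hr]; exact tdeg_le_of_forall fun _ _ => tc_zero _ |>.trans rfl
    · rw [tdeg_pow hu0]
  have h1 := φ.isIntegral_inftyRing_tc_zero_div hr (hpow r) (pow_ne_zero u.tdeg X_ne_zero) htd
  let y : K := x ^ r * algebraMap (RatFunc Fq) K
    (algebraMap Fq[X] (RatFunc Fq) (X ^ u.tdeg))⁻¹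
  have hy : (y : L) = (u ^ r).tc 0 / algebraMap Fq[X] L (X ^ u.tdeg) := by
    rw [← d0_apply, map_pow, d0_apply, ← hx, div_eq_mul_inv,
      IsScalarTower.algebraMap_apply Fq[X] (RatFunc Fq) L, ← map_inv₀]
    rfl
  have h2 : IsIntegral (inftyRing Fq) y := by
    rw [← hy] at h1
    exact (isIntegral_algHom_iff (IsScalarTower.toAlgHom (inftyRing Fq) K L)
      (algebraMap K L).injective).1 h1
  -- its norm `n ^ r / T ^ ([K : F] deg u)` is integral at infinity, too
  have h3 := Algebra.isIntegral_norm (RatFunc Fq) h2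
  obtain ⟨z, hz⟩ := IsIntegrallyClosed.isIntegral_iff.1 h3
  have h4 : algebraMap Fq[X] (RatFunc Fq) (n ^ r) / algebraMap Fq[X] (RatFunc Fq)
      (X ^ (u.tdeg * Module.finrank (RatFunc Fq) K)) ∈ inftyRing Fq := by
    have h5 : Algebra.norm (RatFunc Fq) y = algebraMap Fq[X] (RatFunc Fq) (n ^ r) /
        algebraMap Fq[X] (RatFunc Fq) (X ^ (u.tdeg * Module.finrank (RatFunc Fq) K)) := by
      rw [map_mul, map_pow, hn, Algebra.norm_algebraMap, div_eq_mul_inv, pow_mul, map_pow, map_pow,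
        map_pow, map_pow, inv_pow]
    rw [← h5, ← hz]
    exact z.2
  rw [div_mem_inftyRing (pow_ne_zero _ hn0) (pow_ne_zero _ X_ne_zero), natDegree_pow,
    natDegree_X_pow] at h4
  rwa [mul_comm _ u.tdeg]

theorem tdeg_toAlgHom_le (φ : DrinfeldModule Fq L r) (hr : r ≠ 0) (b : Fq[X]) :
    (φ.toAlgHom b).tdeg ≤ r * b.natDegree := by
  rcases eq_or_ne b 0 with rfl | hb
  · rw [map_zero]; exact tdeg_le_of_forall fun _ _ => tc_zero _ |>.trans rfl
  · exact (φ.tdeg_toAlgHom hr hb).2.le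

theorem tdeg_mul_le (f g : TwistedPoly Fq L) : (f * g).tdeg ≤ f.tdeg + g.tdeg := by
  rcases eq_or_ne f 0 with rfl | hf
  · rw [zero_mul]; exact tdeg_le_of_forall fun _ _ => tc_zero _ |>.trans rfl
  rcases eq_or_ne g 0 with rfl | hg
  · rw [mul_zero]; exact tdeg_le_of_forall fun _ _ => tc_zero _ |>.trans rfl
  exact (tdeg_mul hf hg).le

theorem tdeg_add_le {f g : TwistedPoly Fq L} {n : ℕ} (hf : f.tdeg ≤ n) (hg : g.tdeg ≤ n) :
    (f + g).tdeg ≤ n := tdeg_le_of_forall fun i hi => by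
  rw [tc_add, tc_eq_zero_of_tdeg_lt (by omega), tc_eq_zero_of_tdeg_lt (by omega), add_zero]

/-- The inverse of `∂u / b` is `∂w / c` for an endomorphism `w` such that
`deg u + deg w = r (deg b + deg c)`. -/
theorem exists_inv_eq (φ : DrinfeldModule Fq L r) (hr : r ≠ 0) {u : TwistedPoly Fq L}
    (hu : u * φ.t = φ.t * u) (hu0 : u ≠ 0) {b : Fq[X]} (hb : b ≠ 0) :
    ∃ w : TwistedPoly Fq L, w * φ.t = φ.t * w ∧ ∃ c : Fq[X], c ≠ 0 ∧
      u.tdeg + w.tdeg = r * b.natDegree + r * c.natDegree ∧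
      (u.tc 0 / algebraMap Fq[X] L b)⁻¹ = w.tc 0 / algebraMap Fq[X] L c := by
  have := faithfulSMul_polynomial Fq L
  have hu00 : u.tc 0 ≠ 0 := fun h0 => hu0 (φ.eq_zero_of_tc_zero hu h0)
  obtain ⟨γ, hγ, c, hc, hcγ⟩ := exists_mul_eq_algebraMap (mem_endImage.2 ⟨u, hu, rfl⟩) hu00
    (φ.isIntegral_tc_zero hr hu)
  obtain ⟨w, hw, rfl⟩ := mem_endImage.1 hγ
  have huw : u * w = φ.toAlgHom c := φ.eq_of_tc_zero_eq
    (Commute.mul_left (show Commute u φ.t from hu) hw)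
    (mem_endRing.1 (φ.toAlgHom_mem_endRing c)) (by
      rw [← d0_apply, map_mul, φ.tc_zero_toAlgHom, ← hcγ]; rfl)
  have hw0 : w ≠ 0 := by
    rintro rfl
    exact (φ.tdeg_toAlgHom hr hc).1 (by rw [← huw, mul_zero])
  have hw00 : w.tc 0 ≠ 0 := fun h0 => hw0 (φ.eq_zero_of_tc_zero hw h0)
  have hdeg : u.tdeg + w.tdeg = r * c.natDegree := by
    rw [← tdeg_mul hu0 hw0, huw, (φ.tdeg_toAlgHom hr hc).2]
  refine ⟨φ.toAlgHom b * w, Commute.mul_left (show Commute (φ.toAlgHom b) φ.t from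
    mem_endRing.1 (φ.toAlgHom_mem_endRing b)) hw, c, hc, ?_, ?_⟩
  · rw [tdeg_mul (φ.tdeg_toAlgHom hr hb).1 hw0, (φ.tdeg_toAlgHom hr hb).2]; omega
  · rw [← d0_apply (φ.toAlgHom b * w), map_mul, d0_apply, d0_apply, φ.tc_zero_toAlgHom, ← hcγ,
      inv_div, mul_div_mul_right _ _ hw00]

/-- The valuation ring of the place of the field of fractions of the endomorphism ring at which
the absolute value of the derivative of `u` is `q ^ (deg u / r)`. -/
def inftyPlace (φ : DrinfeldModule Fq L r) (hr : r ≠ 0) :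
    ValuationSubring (fracField φ.endImage) where
  carrier := {x | ∃ u : TwistedPoly Fq L, u * φ.t = φ.t * u ∧ ∃ b : Fq[X], b ≠ 0 ∧
    u.tdeg ≤ r * b.natDegree ∧ (x : L) = u.tc 0 / algebraMap Fq[X] L b}
  mul_mem' := by
    rintro x y ⟨u, hu, b, hb, hub, hx⟩ ⟨v, hv, c, hc, hvc, hy⟩
    refine ⟨u * v, Commute.mul_left (show Commute u φ.t from hu) hv, b * c, mul_ne_zero hb hc,
      (tdeg_mul_le _ _).trans ?_, ?_⟩
    · rw [natDegree_mul hb hc, mul_add]; omega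
    · rw [MulMemClass.coe_mul, hx, hy, map_mul, ← d0_apply, ← d0_apply, ← d0_apply, map_mul,
        div_mul_div_comm]
  one_mem' := ⟨1, by rw [one_mul, mul_one], 1, one_ne_zero, by simp, by simp⟩
  add_mem' := by
    rintro x y ⟨u, hu, b, hb, hub, hx⟩ ⟨v, hv, c, hc, hvc, hy⟩
    have hcom : ∀ d, Commute (φ.toAlgHom d) φ.t := fun d =>
      mem_endRing.1 (φ.toAlgHom_mem_endRing d)
    refine ⟨φ.toAlgHom c * u + φ.toAlgHom b * v, Commute.add_left
      (Commute.mul_left (hcom c) (show Commute u φ.t from hu))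
      (Commute.mul_left (hcom b) (show Commute v φ.t from hv)), b * c, mul_ne_zero hb hc,
      tdeg_add_le ((tdeg_mul_le _ _).trans ?_) ((tdeg_mul_le _ _).trans ?_), ?_⟩
    · rw [natDegree_mul hb hc, mul_add]
      have := φ.tdeg_toAlgHom_le hr c
      omega
    · rw [natDegree_mul hb hc, mul_add]
      have := φ.tdeg_toAlgHom_le hr b
      omega
    · rw [AddMemClass.coe_add, hx, hy, div_add_div _ _ (algebraMap_polynomial_ne_zero hb)
        (algebraMap_polynomial_ne_zero hc), map_mul, ← d0_apply, ← d0_apply, ← d0_apply, map_add,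
        map_mul, map_mul, d0_apply (φ.toAlgHom c), d0_apply (φ.toAlgHom b), φ.tc_zero_toAlgHom,
        φ.tc_zero_toAlgHom, mul_comm (d0 u)]
  zero_mem' := ⟨0, by rw [zero_mul, mul_zero], 1, one_ne_zero,
    tdeg_le_of_forall fun _ _ => tc_zero _ |>.trans rfl, by simp⟩
  neg_mem' := by
    rintro x ⟨u, hu, b, hb, hub, hx⟩
    refine ⟨-u, by rw [neg_mul, mul_neg, hu], b, hb, tdeg_le_of_forall fun i hi => ?_, ?_⟩
    · rw [tc_neg, tc_eq_zero_of_tdeg_lt (by omega), neg_zero]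
    · rw [NegMemClass.coe_neg, hx, tc_neg, neg_div]
  mem_or_inv_mem' := by
    intro x
    have := faithfulSMul_polynomial Fq L
    obtain ⟨u, hu, b, hb, hx⟩ := (φ.mem_fracField_endImage hr).1 x.2
    rcases le_or_gt u.tdeg (r * b.natDegree) with h | h
    · exact Or.inl ⟨u, hu, b, hb, h, hx⟩
    right
    have hu0 : u ≠ 0 := by
      rintro rfl
      have : (0 : TwistedPoly Fq L).tdeg ≤ 0 := tdeg_le_of_forall fun _ _ => tc_zero _ |>.trans rfl
      omega
    obtain ⟨w, hw, c, hc, hdeg, hinv⟩ := φ.exists_inv_eq hr hu hu0 hb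
    refine ⟨w, hw, c, hc, by omega, ?_⟩
    change ((x⁻¹ : fracField φ.endImage) : L) = _
    rw [IntermediateField.coe_inv, hx, hinv]

theorem mem_inftyPlace (φ : DrinfeldModule Fq L r) (hr : r ≠ 0) {x : fracField φ.endImage} :
    x ∈ φ.inftyPlace hr ↔ ∃ u : TwistedPoly Fq L, u * φ.t = φ.t * u ∧ ∃ b : Fq[X], b ≠ 0 ∧
      u.tdeg ≤ r * b.natDegree ∧ (x : L) = u.tc 0 / algebraMap Fq[X] L b := Iff.rfl

/-- The place lies over `∞`, since `φ_p` has degree `r deg p`. -/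
theorem comap_inftyPlace (φ : DrinfeldModule Fq L r) (hr : r ≠ 0) :
    (φ.inftyPlace hr).comap (algebraMap (RatFunc Fq) (fracField φ.endImage)) = inftyRing Fq := by
  have := faithfulSMul_polynomial Fq L
  ext z
  rw [ValuationSubring.mem_comap, mem_inftyPlace]
  obtain ⟨p, b, hb, rfl⟩ := exists_eq_div z
  have hz : ((algebraMap (RatFunc Fq) (fracField φ.endImage)
      (algebraMap Fq[X] (RatFunc Fq) p / algebraMap Fq[X] (RatFunc Fq) b) :
        fracField φ.endImage) : L) = algebraMap Fq[X] L p / algebraMap Fq[X] L b := by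
    rw [IsScalarTower.algebraMap_apply Fq[X] (RatFunc Fq) L p,
      IsScalarTower.algebraMap_apply Fq[X] (RatFunc Fq) L b,
      ← map_div₀ (algebraMap (RatFunc Fq) L)]
    rfl
  rw [hz]
  rcases eq_or_ne p 0 with rfl | hp
  · refine iff_of_true ⟨0, by rw [zero_mul, mul_zero], 1, one_ne_zero,
      tdeg_le_of_forall fun _ _ => tc_zero _ |>.trans rfl, by simp⟩ ?_
    rw [map_zero, zero_div]
    exact zero_mem _
  rw [div_mem_inftyRing hp hb]
  constructor
  · rintro ⟨u, hu, c, hc, huc, h⟩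
    rw [div_eq_div_iff (algebraMap_polynomial_ne_zero hb) (algebraMap_polynomial_ne_zero hc)] at h
    have h1 : φ.toAlgHom (p * c) = u * φ.toAlgHom b := φ.eq_of_tc_zero_eq
      (mem_endRing.1 (φ.toAlgHom_mem_endRing _))
      (Commute.mul_left (show Commute u φ.t from hu) (mem_endRing.1 (φ.toAlgHom_mem_endRing b)))
      (by
        rw [φ.tc_zero_toAlgHom, map_mul, h, ← φ.tc_zero_toAlgHom, ← d0_apply (u * _), map_mul]
        rfl)
    have h2 := congrArg tdeg h1
    have h3 := tdeg_mul_le u (φ.toAlgHom b)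
    rw [(φ.tdeg_toAlgHom hr (mul_ne_zero hp hc)).2, natDegree_mul hp hc] at h2
    rw [(φ.tdeg_toAlgHom hr hb).2] at h3
    have h4 : r * p.natDegree ≤ r * b.natDegree := by
      rw [mul_add] at h2; omega
    exact Nat.le_of_mul_le_mul_left h4 (Nat.pos_of_ne_zero hr)
  · intro h
    refine ⟨φ.toAlgHom p, mem_endRing.1 (φ.toAlgHom_mem_endRing p), b, hb, ?_, ?_⟩
    · rw [(φ.tdeg_toAlgHom hr hp).2]
      exact Nat.mul_le_mul_left _ h
    · rw [φ.tc_zero_toAlgHom]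

/-- The field of fractions of the endomorphism ring has a unique place over `∞`. The elements of
`inftyPlace` are integral at infinity, so this ring lies in every valuation ring over `∞`; if such a
valuation ring contained some `x` outside of it, it would contain
`T = (T x ^ (-r)) x ^ r`, which has a pole at `∞`. -/
theorem isImaginary_fracField_endImage (φ : DrinfeldModule Fq L r) (hr : r ≠ 0) :
    IsImaginary (fracField φ.endImage) := by
  rw [isImaginary_iff]
  refine ⟨φ.inftyPlace hr, φ.comap_inftyPlace hr, fun V hV => ?_⟩
  have hle : ∀ x ∈ φ.inftyPlace hr, x ∈ V := by
    rintro x ⟨u, hu, b, hb, hub, hx⟩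
    exact mem_of_isIntegral_inftyRing hV (by
      rw [hx]; exact φ.isIntegral_inftyRing_tc_zero_div hr hu hb hub)
  refine le_antisymm (fun x hxV => ?_) hle
  by_contra hx
  have hx0 : x ≠ 0 := by rintro rfl; exact hx (zero_mem _)
  obtain ⟨u, hu, b, hb, hub, hxi⟩ := ((φ.inftyPlace hr).mem_or_inv_mem x).resolve_left hx
  -- the degree of `u` is strictly smaller, since otherwise `x` is in the valuation ring as well
  have hlt : u.tdeg + 1 ≤ r * b.natDegree := by
    rcases hub.lt_or_eq with h | h
    · exact h
    · exfalso
      have hu0 : u ≠ 0 := by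
        rintro rfl
        rw [tc_zero, zero_div] at hxi
        exact inv_ne_zero hx0 (Subtype.ext hxi)
      obtain ⟨w, hw, c, hc, hdeg, hinv⟩ := φ.exists_inv_eq hr hu hu0 hb
      refine hx ⟨w, hw, c, hc, by omega, ?_⟩
      rw [← hinv, ← hxi, IntermediateField.coe_inv, inv_inv]
  have hT : algebraMap (RatFunc Fq) (fracField φ.endImage) (algebraMap Fq[X] (RatFunc Fq) X) *
      (x⁻¹) ^ r ∈ φ.inftyPlace hr := by
    refine ⟨φ.t * u ^ r, Commute.mul_left (Commute.refl _)
      (Commute.pow_left (show Commute u φ.t from hu) r), b ^ r, pow_ne_zero _ hb,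
      (tdeg_mul_le _ _).trans ?_, ?_⟩
    · rw [φ.tdeg_t, natDegree_pow]
      have : (u ^ r).tdeg ≤ r * u.tdeg := by
        rcases eq_or_ne u 0 with rfl | hu0
        · rw [zero_pow hr]; exact tdeg_le_of_forall fun _ _ => tc_zero _ |>.trans rfl
        · rw [tdeg_pow hu0]
      nlinarith
    · rw [← d0_apply, map_mul, map_pow, d0_apply, d0_apply, φ.tc_t_zero, MulMemClass.coe_mul,
        SubmonoidClass.coe_pow, hxi, div_pow, map_pow, mul_div_assoc,
        IsScalarTower.algebraMap_apply Fq[X] (RatFunc Fq) L X]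
      rfl
  have hTV := mul_mem (hle _ hT) (pow_mem hxV r)
  rw [mul_assoc, ← mul_pow, inv_mul_cancel₀ hx0, one_pow, mul_one] at hTV
  have h9 : algebraMap Fq[X] (RatFunc Fq) X ∈ V.comap (algebraMap (RatFunc Fq) _) :=
    ValuationSubring.mem_comap.2 hTV
  rw [hV] at h9
  exact algebraMap_X_notMem_inftyRing h9

end DrinfeldModule

end DrinfeldCM

namespace DrinfeldCM

/-! ### Kernels of endomorphisms -/

open TwistedPoly

section Kernel

variable {Fq : Type*} [Field Fq] [Fintype Fq] {L : Type*} [Field L] [Algebra Fq L]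

theorem derivative_of_mem_qPolynomials {f : L[X]} (hf : f ∈ qPolynomials Fq L) :
    derivative f = C (f.coeff 1) := by
  induction hf using Submodule.span_induction with
  | mem x hx =>
    obtain ⟨i, rfl⟩ := hx
    rcases eq_or_ne i 0 with rfl | hi
    · simp
    · have h1 : ((Fintype.card Fq ^ i : ℕ) : L) = 0 := by
        rw [Nat.cast_pow, ← map_natCast (algebraMap Fq L), FiniteField.cast_card_eq_zero, map_zero,
          zero_pow hi]
      have h2 : 1 ≠ Fintype.card Fq ^ i := (Nat.one_lt_pow hi (one_lt_q (Fq := Fq))).ne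
      rw [derivative_X_pow, h1, coeff_X_pow, if_neg h2]
      simp
  | zero => simp
  | add x y _ _ hx hy => rw [derivative_add, hx, hy, coeff_add, C_add]
  | smul c x _ hx => rw [derivative_smul, hx, coeff_smul, smul_C]

theorem separable_poly {u : TwistedPoly Fq L} (h0 : u.tc 0 ≠ 0) : u.poly.Separable := by
  rw [Polynomial.Separable, derivative_of_mem_qPolynomials u.poly_mem]
  have h1 : u.poly.coeff 1 ≠ 0 := by rwa [tc, pow_zero] at h0
  exact isCoprime_of_isUnit_right ((isUnit_C).2 (Ne.isUnit h1))
where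
  isCoprime_of_isUnit_right {p e : L[X]} (he : IsUnit e) : IsCoprime p e := by
    obtain ⟨e', he'⟩ := he.exists_left_inv
    exact ⟨0, e', by rw [zero_mul, zero_add, he']⟩

variable [IsAlgClosed L]

theorem ncard_setOf_eval_eq_zero {u : TwistedPoly Fq L} (h0 : u.tc 0 ≠ 0) :
    {x : L | u.poly.eval x = 0}.ncard = Fintype.card Fq ^ u.tdeg := by
  classical
  have hu : u ≠ 0 := by rintro rfl; exact h0 (tc_zero _)
  have hp : u.poly ≠ 0 := (separable_poly h0).ne_zero
  rw [← natDegree_eq_pow hu, (IsAlgClosed.splits u.poly).natDegree_eq_card_roots,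
    ← Multiset.toFinset_card_of_nodup (nodup_roots (separable_poly h0)), ← Set.ncard_coe_finset]
  congr 1
  ext x
  simp [hp]

/-- A twisted polynomial vanishing on the kernel of a separable `f` is a left multiple of `f`:
otherwise the remainder of the right division by `f` would have more zeros than its degree. -/
theorem exists_eq_mul_of_forall_eval {f g : TwistedPoly Fq L} (h0 : f.tc 0 ≠ 0)
    (h : ∀ x : L, f.poly.eval x = 0 → g.poly.eval x = 0) : ∃ w, g = w * f := by
  have hf : f ≠ 0 := by rintro rfl; exact h0 (tc_zero _)
  obtain ⟨w, ρ, hw, -, hρ, -⟩ := exists_right_div hf (g.tdeg + 1) g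
    fun i hi => tc_eq_zero_of_tdeg_lt (by omega)
  refine ⟨w, ?_⟩
  suffices ρ = 0 by rw [hw, this, add_zero]
  by_contra hρ0
  have hdeg : ρ.tdeg < f.tdeg := by
    by_contra hle
    exact tc_tdeg_ne_zero hρ0 (hρ _ (not_lt.1 hle))
  have hρp : ρ.poly ≠ 0 := fun hp => hρ0 (TwistedPoly.ext (by rw [hp, poly_zero]))
  have hsub : {x : L | f.poly.eval x = 0} ⊆ {x | ρ.poly.eval x = 0} := by
    intro x hx
    have h1 : g.poly.eval x = 0 := h x hx
    rw [hw, poly_add, poly_mul, eval_add, eval_comp, show f.poly.eval x = 0 from hx,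
      show w.poly.eval 0 = 0 from map_zero (evalHom w), zero_add] at h1
    exact h1
  have hset : {x : L | ρ.poly.eval x = 0} = ρ.poly.rootSet L := by
    ext x
    rw [mem_rootSet_of_ne hρp, coe_aeval_eq_eval]; rfl
  have hcard : {x : L | ρ.poly.eval x = 0}.ncard ≤ ρ.poly.natDegree := by
    classical
    rw [hset, rootSet, Set.ncard_coe_finset]
    refine (Multiset.toFinset_card_le _).trans ?_
    rw [aroots, Algebra.algebraMap_self, Polynomial.map_id]
    exact card_roots' _
  have hfin : {x : L | ρ.poly.eval x = 0}.Finite := by rw [hset]; exact rootSet_finite _ _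
  have h2 := Set.ncard_le_ncard hsub hfin
  rw [ncard_setOf_eval_eq_zero h0] at h2
  rw [natDegree_eq_pow hρ0] at hcard
  exact absurd (h2.trans hcard) (not_le.2 (Nat.pow_lt_pow_right (one_lt_q (Fq := Fq)) hdeg))

end Kernel

theorem natCard_quotient_span {Fq : Type*} [Field Fq] [Fintype Fq] {a : Fq[X]} (ha : a.Monic) :
    Finite (Fq[X] ⧸ Ideal.span {a}) ∧
      Nat.card (Fq[X] ⧸ Ideal.span {a}) = Fintype.card Fq ^ a.natDegree := by
  have : Module.Finite Fq (AdjoinRoot a) := (AdjoinRoot.powerBasis' ha).finite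
  have h1 : Finite (AdjoinRoot a) := Module.finite_of_finite Fq
  refine ⟨h1, ?_⟩
  have h2 := Module.natCard_eq_pow_finrank (K := Fq) (V := AdjoinRoot a)
  rw [(AdjoinRoot.powerBasis' ha).finrank, AdjoinRoot.powerBasis'_dim,
    Nat.card_eq_fintype_card (α := Fq)] at h2
  exact h2

namespace DrinfeldModule

variable {Fq : Type*} [Field Fq] [Fintype Fq] {L : Type*} [Field L] [Algebra Fq L]
  [Algebra Fq[X] L] [IsScalarTower Fq Fq[X] L]
  [IsAlgClosed L] {r : ℕ}

theorem natCard_ker {φ : DrinfeldModule Fq L r} {u : TwistedPoly Fq L} (h : φ.IsMorphism φ u)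
    (h0 : u.tc 0 ≠ 0) : Nat.card h.ker = Fintype.card Fq ^ u.tdeg := by
  rw [← ncard_setOf_eval_eq_zero h0]
  rfl

theorem smul_mem_ker_iff {φ : DrinfeldModule Fq L r} {u : TwistedPoly Fq L} (h : φ.IsMorphism φ u)
    (b : Fq[X]) (x : h.ker) : b • x = 0 ↔ (φ.toAlgHom b).poly.eval (show L from x.1) = 0 := by
  rw [← Subtype.coe_inj]
  rfl

/-- An endomorphism `u` of degree `deg a` dividing `φ_a`, for a prime `a`, has kernel isomorphic to
`Fq[T] / (a)`: the kernel is a vector space over this field, of the same cardinality. -/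
theorem nonempty_ker_equiv {φ : DrinfeldModule Fq L r} {u : TwistedPoly Fq L}
    (h : φ.IsMorphism φ u) (h0 : u.tc 0 ≠ 0) {a : Fq[X]} (ha : a.Monic)
    (hprime : (Ideal.span {a}).IsPrime) (hdeg : u.tdeg = a.natDegree) {w : TwistedPoly Fq L}
    (hw : w * u = φ.toAlgHom a) (ha0 : a.natDegree ≠ 0) :
    Nonempty (h.ker ≃ₗ[Fq[X]] Fq[X] ⧸ Ideal.span {a}) := by
  obtain ⟨hfinA, hcardA⟩ := natCard_quotient_span ha
  have hcard := natCard_ker h h0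
  rw [hdeg, ← hcardA] at hcard
  have hfin : Finite h.ker := by
    refine Nat.finite_of_card_ne_zero ?_
    rw [hcard]
    exact Nat.card_pos.ne'
  have hgt : 1 < Nat.card h.ker := by
    rw [hcard, hcardA]
    exact Nat.one_lt_pow ha0 (one_lt_q (Fq := Fq))
  have : Nontrivial h.ker := Finite.one_lt_card_iff_nontrivial.1 hgt
  obtain ⟨x, hx⟩ := exists_ne (0 : h.ker)
  have hax : a • x = 0 := by
    rw [smul_mem_ker_iff, ← hw, poly_mul, eval_comp]
    have hxu : u.poly.eval (show L from x.1) = 0 := x.2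
    rw [hxu]
    exact map_zero (evalHom w)
  let m : Fq[X] →ₗ[Fq[X]] h.ker := LinearMap.toSpanSingleton Fq[X] h.ker x
  have hmax : (Ideal.span {a}).IsMaximal := hprime.isMaximal (by
    rw [Ne, Ideal.span_singleton_eq_bot]; exact ha.ne_zero)
  have hker : LinearMap.ker m = Ideal.span {a} := by
    refine (hmax.eq_of_le (J := LinearMap.ker m) ?_ ?_).symm
    · intro htop
      have h1 : (1 : Fq[X]) ∈ LinearMap.ker m := by rw [htop]; trivial
      rw [LinearMap.mem_ker, LinearMap.toSpanSingleton_apply, one_smul] at h1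
      exact hx h1
    · rw [Ideal.span_singleton_le_iff_mem]
      exact LinearMap.mem_ker.2 hax
  let e : (Fq[X] ⧸ Ideal.span {a}) →ₗ[Fq[X]] h.ker := Submodule.liftQ _ m hker.ge
  have hinj : Function.Injective e := by
    rw [← LinearMap.ker_eq_bot]
    exact Submodule.ker_liftQ_eq_bot _ _ _ hker.le
  have hbij : Function.Bijective e := (Nat.bijective_iff_injective_and_card _).2 ⟨hinj, hcard.symm⟩
  exact ⟨(LinearEquiv.ofBijective e hbij).symm⟩

end DrinfeldModule

end DrinfeldCM

namespace DrinfeldCM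

/-! ### Endomorphisms with kernel `Fq[T] / (a)` and elements of norm `a` -/

open TwistedPoly

section PrimeNorm

variable {Fq : Type*} [Field Fq]

theorem prime_of_isPrime_span {a : Fq[X]} (ha : a.Monic) (hprime : (Ideal.span {a}).IsPrime) :
    Prime a ∧ a.natDegree ≠ 0 := by
  have h := (Ideal.span_singleton_prime ha.ne_zero).1 hprime
  refine ⟨h, fun h0 => h.not_isUnit ?_⟩
  rw [ha.natDegree_eq_zero.1 h0]
  exact isUnit_one

theorem exists_C_mul_eq_of_associated {a b : Fq[X]} (h : Associated a b) :
    ∃ c : Fq, c ≠ 0 ∧ b = C c * a := by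
  obtain ⟨u, rfl⟩ := h
  obtain ⟨c, hc, hcu⟩ := Polynomial.isUnit_iff.1 u.isUnit
  exact ⟨c, hc.ne_zero, by rw [hcu, mul_comm]⟩

theorem associated_C_mul {a : Fq[X]} {c : Fq} (hc : c ≠ 0) : Associated a (C c * a) :=
  (associated_unit_mul_left a _ (isUnit_C.2 hc.isUnit)).symm

variable {L : Type*} [Field L]
  [Algebra Fq[X] L] [Algebra (RatFunc Fq) L] [IsScalarTower Fq[X] (RatFunc Fq) L]

/-- `α` is integral over `Fq[T]`, of degree `r` and of norm `c a` for some nonzero constant `c`,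
the norm being taken from the field generated by `α`. -/
def HasPrimeNorm (r : ℕ) (a : Fq[X]) (α : L) : Prop :=
  IsIntegral Fq[X] α ∧ (minpoly Fq[X] α).natDegree = r ∧
    ∃ c : Fq, c ≠ 0 ∧ (minpoly Fq[X] α).coeff 0 = C c * a

theorem minpoly_ratFunc {α : L} (h : IsIntegral Fq[X] α) :
    minpoly (RatFunc Fq) α = (minpoly Fq[X] α).map (algebraMap Fq[X] (RatFunc Fq)) :=
  minpoly.isIntegrallyClosed_eq_field_fractions (RatFunc Fq) L h

theorem natDegree_minpoly_ratFunc {α : L} (h : IsIntegral Fq[X] α) :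
    (minpoly (RatFunc Fq) α).natDegree = (minpoly Fq[X] α).natDegree := by
  rw [minpoly_ratFunc h, (minpoly.monic h).natDegree_map]

theorem finrank_adjoin_of_isIntegral {α : L} (h : IsIntegral Fq[X] α) :
    Module.finrank (RatFunc Fq) (IntermediateField.adjoin (RatFunc Fq) {α}) =
      (minpoly Fq[X] α).natDegree := by
  rw [IntermediateField.adjoin.finrank h.tower_top, natDegree_minpoly_ratFunc h]

theorem finiteDimensional_adjoin_of_isIntegral {α : L} (h : IsIntegral Fq[X] α) :
    FiniteDimensional (RatFunc Fq) (IntermediateField.adjoin (RatFunc Fq) {α}) :=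
  IntermediateField.adjoin.finiteDimensional h.tower_top

/-- In a field of degree `r`, an integral element has norm `c a` if and only if it generates the
field and its minimal polynomial has constant coefficient `c a`. -/
theorem norm_eq_iff_hasPrimeNorm {r : ℕ} {a : Fq[X]} (ha : Prime a)
    {K : IntermediateField (RatFunc Fq) L} [FiniteDimensional (RatFunc Fq) K]
    (hK : Module.finrank (RatFunc Fq) K = r) {x : K} (hx : IsIntegral Fq[X] (x : L)) :
    (∃ c : Fq, c ≠ 0 ∧ Algebra.norm (RatFunc Fq) x = algebraMap Fq[X] (RatFunc Fq) (C c * a)) ↔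
      HasPrimeNorm r a (x : L) := by
  obtain ⟨e, he, hN⟩ := exists_norm_eq_coeff_zero_pow K hx
  have hinj := FaithfulSMul.algebraMap_injective Fq[X] (RatFunc Fq)
  have hsign : ∀ (b : Fq[X]) k, Associated ((-1) ^ k * b) b := fun b k =>
    associated_unit_mul_left _ _ ((isUnit_one.neg).pow k)
  constructor
  · rintro ⟨c, hc, hcN⟩
    rw [hN] at hcN
    have h1 := hinj hcN
    have hprime : Prime (C c * a) := (associated_C_mul hc).prime ha
    rw [← h1] at hprime
    -- a prime is not a proper power
    have he1 : e = 1 := by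
      by_contra hne
      exact hprime.irreducible.not_isUnit
        ((not_irreducible_pow hne hprime.irreducible).elim)
    rw [he1, pow_one] at h1
    rw [he1, one_mul, hK] at he
    refine ⟨hx, he, exists_C_mul_eq_of_associated ?_⟩
    refine (associated_C_mul hc).trans ?_
    rw [← h1]
    exact hsign _ _
  · rintro ⟨-, hdeg, c, hc, h0⟩
    have hr : r ≠ 0 := by rw [← hK]; exact Module.finrank_pos.ne'
    rw [hdeg, hK] at he
    have he1 : e = 1 := Nat.eq_of_mul_eq_mul_right (Nat.pos_of_ne_zero hr) (by omega)
    rw [he1, pow_one] at hN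
    obtain ⟨c', hc', h'⟩ := exists_C_mul_eq_of_associated
      ((associated_C_mul hc).trans (h0 ▸ (hsign ((minpoly Fq[X] (x : L)).coeff 0)
        (minpoly Fq[X] (x : L)).natDegree).symm))
    exact ⟨c', hc', by rw [hN, h0, h']⟩

end PrimeNorm

namespace DrinfeldModule

variable {Fq : Type*} [Field Fq] [Fintype Fq] {L : Type*} [Field L] [Algebra Fq L]
  [Algebra Fq[X] L] [Algebra (RatFunc Fq) L] [IsScalarTower Fq Fq[X] L]
  [IsScalarTower Fq[X] (RatFunc Fq) L] {r : ℕ}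

/-- If the derivative of an endomorphism has degree `r` over `Fq(T)`, the endomorphism ring is an
imaginary order of degree `r`. -/
theorem isImaginaryOrder_endImage (φ : DrinfeldModule Fq L r) (hr : r ≠ 0) {α : L}
    (hα : α ∈ φ.endImage) (hdeg : (minpoly Fq[X] α).natDegree = r) :
    fracField φ.endImage = IntermediateField.adjoin (RatFunc Fq) {α} ∧
      IsImaginaryOrder r φ.endImage := by
  have hint := φ.isIntegral_of_mem_endImage hr hα
  have h1 : fracField φ.endImage = IntermediateField.adjoin (RatFunc Fq) {α} :=
    fracField_eq_adjoin (fun x hx => φ.natDegree_minpoly_le hr hx) hα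
      ((natDegree_minpoly_ratFunc hint).trans hdeg)
  have h2 := finiteDimensional_adjoin_of_isIntegral hint
  refine ⟨h1, finite_of_forall_isIntegral (fun β hβ => φ.isIntegral_of_mem_endImage hr hβ)
    (K := IntermediateField.adjoin (RatFunc Fq) {α}) (fun β hβ => ?_), ?_,
    φ.isImaginary_fracField_endImage hr⟩
  · rw [← h1]
    exact IntermediateField.subset_adjoin _ _ hβ
  · rw [h1, finrank_adjoin_of_isIntegral hint, hdeg]

variable [IsAlgClosed L]

theorem tdeg_eq_natDegree_of_ker_equiv {φ : DrinfeldModule Fq L r}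
    {u : TwistedPoly Fq L} (hu : φ.IsMorphism φ u) (hu0 : u ≠ 0) {a : Fq[X]} (ha : a.Monic)
    (e : hu.ker ≃ₗ[Fq[X]] Fq[X] ⧸ Ideal.span {a}) : u.tdeg = a.natDegree := by
  have := faithfulSMul_polynomial Fq L
  have h0 : u.tc 0 ≠ 0 := fun h0 => hu0 (φ.eq_zero_of_tc_zero (isMorphism_iff.1 hu) h0)
  have h1 := natCard_ker hu h0
  rw [Nat.card_congr e.toEquiv, (natCard_quotient_span ha).2] at h1
  exact (Nat.pow_right_injective (one_lt_q (Fq := Fq)) h1).symm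

/-- The derivative of an endomorphism with kernel `Fq[T] / (a)` has degree `r` and norm `c a`. -/
theorem hasPrimeNorm_of_ker_equiv {φ : DrinfeldModule Fq L r} (hr : r ≠ 0)
    {u : TwistedPoly Fq L} (hu : φ.IsMorphism φ u) (hu0 : u ≠ 0) {a : Fq[X]} (ha : a.Monic)
    (hprime : (Ideal.span {a}).IsPrime) (e : hu.ker ≃ₗ[Fq[X]] Fq[X] ⧸ Ideal.span {a}) :
    HasPrimeNorm r a (u.tc 0) := by
  have := faithfulSMul_polynomial Fq L
  obtain ⟨hap, hd0⟩ := prime_of_isPrime_span ha hprime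
  have huc := isMorphism_iff.1 hu
  have hα0 : u.tc 0 ≠ 0 := fun h0 => hu0 (φ.eq_zero_of_tc_zero huc h0)
  have hdeg := tdeg_eq_natDegree_of_ker_equiv hu hu0 ha e
  -- `φ_a` kills the kernel of `u`, so it is a multiple `w u` of `u`
  obtain ⟨w, hw⟩ := exists_eq_mul_of_forall_eval (g := φ.toAlgHom a) hα0 fun x hx => by
    have h1 : a • (⟨x, hx⟩ : hu.ker) = 0 := by
      apply e.injective
      rw [map_smul, map_zero]
      obtain ⟨y, hy⟩ := Ideal.Quotient.mk_surjective (e ⟨x, hx⟩)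
      rw [← hy, ← Ideal.Quotient.mk_eq_mk, ← Submodule.Quotient.mk_smul, Ideal.Quotient.mk_eq_mk,
        Ideal.Quotient.eq_zero_iff_mem, smul_eq_mul]
      exact Ideal.mul_mem_right _ _ (Ideal.mem_span_singleton_self a)
    exact (smul_mem_ker_iff hu a _).1 h1
  have hwc : w * φ.t = φ.t * w := by
    have h1 : (w * φ.t - φ.t * w) * u = 0 := by
      rw [sub_mul, mul_assoc, ← huc, ← mul_assoc, ← hw, mul_assoc, ← hw, sub_eq_zero]
      exact mem_endRing.1 (φ.toAlgHom_mem_endRing a)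
    exact sub_eq_zero.1 ((mul_eq_zero.1 h1).resolve_right hu0)
  have hw0 : w ≠ 0 := by
    rintro rfl
    exact (φ.tdeg_toAlgHom hr ha.ne_zero).1 (by rw [hw, zero_mul])
  have hwdeg : w.tdeg + a.natDegree = r * a.natDegree := by
    rw [← (φ.tdeg_toAlgHom hr ha.ne_zero).2, hw, tdeg_mul hw0 hu0, hdeg]
  have hmul : w.tc 0 * u.tc 0 = algebraMap Fq[X] L a := by
    rw [← φ.tc_zero_toAlgHom, hw, ← d0_apply (w * u), map_mul]; rfl
  have hint := φ.isIntegral_tc_zero hr huc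
  have hintw := φ.isIntegral_tc_zero hr hwc
  let K := IntermediateField.adjoin (RatFunc Fq) {u.tc 0}
  have hfd : FiniteDimensional (RatFunc Fq) K := finiteDimensional_adjoin_of_isIntegral hint
  have hmK : Module.finrank (RatFunc Fq) K = (minpoly Fq[X] (u.tc 0)).natDegree :=
    finrank_adjoin_of_isIntegral hint
  have huK : u.tc 0 ∈ K := IntermediateField.mem_adjoin_simple_self _ _
  have hwK : w.tc 0 ∈ K := by
    rw [eq_div_of_mul_eq hα0 hmul, IsScalarTower.algebraMap_apply Fq[X] (RatFunc Fq) L]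
    exact div_mem (K.algebraMap_mem _) huK
  obtain ⟨e1, he1, hN1⟩ := exists_norm_eq_coeff_zero_pow K (x := ⟨u.tc 0, huK⟩) hint
  obtain ⟨e2, he2, hN2⟩ := exists_norm_eq_coeff_zero_pow K (x := ⟨w.tc 0, hwK⟩) hintw
  have hB1 := φ.natDegree_norm_le hr huc (x := (⟨u.tc 0, huK⟩ : K)) rfl hN1
  have hB2 := φ.natDegree_norm_le hr hwc (x := (⟨w.tc 0, hwK⟩ : K)) rfl hN2
  -- `n1` and `n2` are the norms from `K` of the derivatives of `u` and `w`
  generalize hn2 : ((-1) ^ (minpoly Fq[X] (w.tc 0)).natDegree *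
    (minpoly Fq[X] (w.tc 0)).coeff 0) ^ e2 = n2 at hN2 hB2
  have hmpos : 0 < Module.finrank (RatFunc Fq) K := Module.finrank_pos
  have he1' : e1 = 1 := by
    have h : e1 * (minpoly Fq[X] (u.tc 0)).natDegree = (minpoly Fq[X] (u.tc 0)).natDegree := by
      exact he1.trans hmK
    rw [hmK] at hmpos
    exact Nat.eq_of_mul_eq_mul_right hmpos (by rw [h, one_mul])
  rw [he1', pow_one] at hN1 hB1
  generalize hn1 : (-1) ^ (minpoly Fq[X] (u.tc 0)).natDegree *
    (minpoly Fq[X] (u.tc 0)).coeff 0 = n1 at hN1 hB1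
  have hprod : n1 * n2 = a ^ Module.finrank (RatFunc Fq) K := by
    apply FaithfulSMul.algebraMap_injective Fq[X] (RatFunc Fq)
    rw [map_mul, ← hN1, ← hN2, ← map_mul, map_pow, ← Algebra.norm_algebraMap (S := K)]
    congr 1
    apply Subtype.ext
    change u.tc 0 * w.tc 0 = algebraMap (RatFunc Fq) L (algebraMap Fq[X] (RatFunc Fq) a)
    rw [← IsScalarTower.algebraMap_apply, mul_comm, hmul]
  have hm : Module.finrank (RatFunc Fq) K ≤ r := by
    rw [hmK, ← natDegree_minpoly_ratFunc hint]
    exact (φ.natDegree_minpoly_le hr (IntermediateField.subset_adjoin _ _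
      (mem_endImage.2 ⟨u, huc, rfl⟩))).2
  -- the norm of the derivative of `u` divides a power of `a`, so it is a power of `a` itself
  obtain ⟨s, hs, hass⟩ := (dvd_prime_pow hap _).1 (Dvd.intro _ hprod)
  have hn1d : n1.natDegree = s * a.natDegree := by
    obtain ⟨c, hc, h⟩ := exists_C_mul_eq_of_associated hass.symm
    rw [h, natDegree_C_mul hc, natDegree_pow]
  have hn0 : n1 * n2 ≠ 0 := by rw [hprod]; exact pow_ne_zero _ ha.ne_zero
  have hsum : n1.natDegree + n2.natDegree = Module.finrank (RatFunc Fq) K * a.natDegree := by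
    rw [← natDegree_mul (left_ne_zero_of_mul hn0) (right_ne_zero_of_mul hn0), hprod, natDegree_pow]
  generalize Module.finrank (RatFunc Fq) K = m at *
  have hdpos := Nat.pos_of_ne_zero hd0
  -- the two degree bounds force `m = r s`
  have hle1 : r * s ≤ m := by
    refine Nat.le_of_mul_le_mul_right ?_ hdpos
    rw [hn1d, hdeg] at hB1
    rwa [mul_assoc]
  have hle2 : m ≤ r * s := by
    refine Nat.le_of_mul_le_mul_right (c := a.natDegree) ?_ hdpos
    have h1 : r * n1.natDegree + r * n2.natDegree = r * (m * a.natDegree) := by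
      rw [← mul_add, hsum]
    have h2 : m * w.tdeg + m * a.natDegree = m * (r * a.natDegree) := by rw [← mul_add, hwdeg]
    have h3 : m * (r * a.natDegree) = r * (m * a.natDegree) := by ring
    rw [hn1d] at h1
    have h4 : r * s * a.natDegree = r * (s * a.natDegree) := by ring
    omega
  have hmrs := le_antisymm hle2 hle1
  -- now `r s = m ≤ r` and `m > 0`
  have hs1 : s = 1 := by
    have h1 : s ≠ 0 := by rintro rfl; omega
    have h2 : r * s ≤ r * 1 := by omega
    have h3 := Nat.le_of_mul_le_mul_left h2 (Nat.pos_of_ne_zero hr)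
    omega
  rw [hs1, pow_one] at hass
  refine ⟨hint, by rw [← hmK, hmrs, hs1, mul_one], exists_C_mul_eq_of_associated ?_⟩
  refine hass.symm.trans ?_
  rw [← hn1]
  exact associated_unit_mul_left _ _ ((isUnit_one.neg).pow _)

/-- An endomorphism whose derivative has degree `r` and norm `c a` has kernel `Fq[T] / (a)`. -/
theorem ker_equiv_of_hasPrimeNorm {φ : DrinfeldModule Fq L r} (hr : r ≠ 0)
    {u : TwistedPoly Fq L} (hu : φ.IsMorphism φ u) {a : Fq[X]} (ha : a.Monic)
    (hprime : (Ideal.span {a}).IsPrime) (h : HasPrimeNorm r a (u.tc 0)) :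
    Nonempty (hu.ker ≃ₗ[Fq[X]] Fq[X] ⧸ Ideal.span {a}) := by
  have := faithfulSMul_polynomial Fq L
  obtain ⟨hap, hd0⟩ := prime_of_isPrime_span ha hprime
  have huc := isMorphism_iff.1 hu
  obtain ⟨hint, hdeg, c, hc, hca⟩ := h
  have hα0 : u.tc 0 ≠ 0 := by
    intro h0
    have h1 := minpoly.aeval Fq[X] (u.tc 0)
    rw [h0, ← coeff_zero_eq_aeval_zero', ← h0, hca, h0, FaithfulSMul.algebraMap_eq_zero_iff] at h1
    exact (mul_ne_zero (C_ne_zero.2 hc) ha.ne_zero) h1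
  have hu0 : u ≠ 0 := by rintro rfl; exact hα0 (tc_zero _)
  obtain ⟨w, hwc, hw⟩ := φ.exists_mul_eq_toAlgHom huc (minpoly.aeval Fq[X] (u.tc 0))
  rw [hca] at hw
  have hCa : (C c * a) ≠ 0 := mul_ne_zero (C_ne_zero.2 hc) ha.ne_zero
  have hw0 : w ≠ 0 := by
    rintro rfl
    exact (φ.tdeg_toAlgHom hr hCa).1 (by rw [← hw, zero_mul])
  have hwdeg : w.tdeg + u.tdeg = r * a.natDegree := by
    rw [← tdeg_mul hw0 hu0, hw, (φ.tdeg_toAlgHom hr hCa).2, natDegree_C_mul hc]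
  have hmul : w.tc 0 * u.tc 0 = algebraMap Fq[X] L (C c * a) := by
    rw [← φ.tc_zero_toAlgHom, ← hw, ← d0_apply (w * u), map_mul]; rfl
  have hintw := φ.isIntegral_tc_zero hr hwc
  let K := IntermediateField.adjoin (RatFunc Fq) {u.tc 0}
  have hfd : FiniteDimensional (RatFunc Fq) K := finiteDimensional_adjoin_of_isIntegral hint
  have hmK : Module.finrank (RatFunc Fq) K = r :=
    (finrank_adjoin_of_isIntegral hint).trans hdeg
  have huK : u.tc 0 ∈ K := IntermediateField.mem_adjoin_simple_self _ _
  have hwK : w.tc 0 ∈ K := by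
    rw [eq_div_of_mul_eq hα0 hmul, IsScalarTower.algebraMap_apply Fq[X] (RatFunc Fq) L]
    exact div_mem (K.algebraMap_mem _) huK
  obtain ⟨c', hc', hN1⟩ := (norm_eq_iff_hasPrimeNorm hap hmK (x := ⟨u.tc 0, huK⟩) hint).2
    ⟨hint, hdeg, c, hc, hca⟩
  obtain ⟨e2, he2, hN2⟩ := exists_norm_eq_coeff_zero_pow K (x := ⟨w.tc 0, hwK⟩) hintw
  have hB1 := φ.natDegree_norm_le hr huc (x := (⟨u.tc 0, huK⟩ : K)) rfl hN1
  have hB2 := φ.natDegree_norm_le hr hwc (x := (⟨w.tc 0, hwK⟩ : K)) rfl hN2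
  generalize hn2 : ((-1) ^ (minpoly Fq[X] (w.tc 0)).natDegree *
    (minpoly Fq[X] (w.tc 0)).coeff 0) ^ e2 = n2 at hN2 hB2
  have hprod : (C c' * a) * n2 = (C c * a) ^ r := by
    apply FaithfulSMul.algebraMap_injective Fq[X] (RatFunc Fq)
    rw [map_mul, ← hN1, ← hN2, ← map_mul, map_pow, ← hmK, ← Algebra.norm_algebraMap (S := K)]
    congr 1
    apply Subtype.ext
    change u.tc 0 * w.tc 0 = algebraMap (RatFunc Fq) L (algebraMap Fq[X] (RatFunc Fq) (C c * a))
    rw [← IsScalarTower.algebraMap_apply, mul_comm, hmul]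
  have hn0 : (C c' * a) * n2 ≠ 0 := by rw [hprod]; exact pow_ne_zero _ hCa
  have hsum : a.natDegree + n2.natDegree = r * a.natDegree := by
    rw [← natDegree_C_mul (p := a) hc', ← natDegree_mul (left_ne_zero_of_mul hn0)
      (right_ne_zero_of_mul hn0), hprod, natDegree_pow, natDegree_C_mul hc, natDegree_C_mul hc']
  rw [hmK, natDegree_C_mul hc'] at hB1
  rw [hmK] at hB2
  -- `deg a ≤ deg u` and `(r - 1) deg a ≤ deg w` with `deg u + deg w = r deg a`
  have hB1' := Nat.le_of_mul_le_mul_left hB1 (Nat.pos_of_ne_zero hr)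
  have hB2' := Nat.le_of_mul_le_mul_left hB2 (Nat.pos_of_ne_zero hr)
  have hcw : φ.toAlgHom (C c⁻¹) * w * u = φ.toAlgHom a := by
    rw [mul_assoc, hw, ← map_mul, ← mul_assoc, ← C_mul, inv_mul_cancel₀ hc, C_1, one_mul]
  exact nonempty_ker_equiv hu hα0 ha hprime (by omega) hcw hd0

end DrinfeldModule

end DrinfeldCM

namespace DrinfeldCM

/-! ### Isomorphic and normalised Drinfeld modules -/

open TwistedPoly

namespace TwistedPoly

variable {Fq : Type*} [Field Fq] [Fintype Fq] {L : Type*} [Field L] [Algebra Fq L]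

theorem mono_zero_mul_mono_zero (c d : L) :
    (mono c 0 * mono d 0 : TwistedPoly Fq L) = mono (c * d) 0 := by
  rw [mono_zero_mul]
  exact ext_tc fun i => by simp

theorem mono_one_zero : (mono 1 0 : TwistedPoly Fq L) = 1 := ext_tc fun i => by simp

/-- The unit `c x` of `L⟨x⟩`. -/
def homothety (c : L) (hc : c ≠ 0) : (TwistedPoly Fq L)ˣ where
  val := mono c 0
  inv := mono c⁻¹ 0
  val_inv := by rw [mono_zero_mul_mono_zero, mul_inv_cancel₀ hc, mono_one_zero]
  inv_val := by rw [mono_zero_mul_mono_zero, inv_mul_cancel₀ hc, mono_one_zero]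

theorem exists_eq_homothety (u : (TwistedPoly Fq L)ˣ) : ∃ c hc, u = homothety (Fq := Fq) c hc := by
  obtain ⟨c, hc, h⟩ := exists_of_unit u
  refine ⟨c, hc, Units.ext (TwistedPoly.ext ?_)⟩
  rw [h]
  simp [homothety, mono, poly]

theorem homothety_inv_mul_mul (c : L) (hc : c ≠ 0) (f : TwistedPoly Fq L) :
    ((homothety c hc)⁻¹ : (TwistedPoly Fq L)ˣ).val * f * (homothety c hc).val = scale c f := by
  change mono c⁻¹ 0 * f * mono c 0 = scale c f
  rw [mono_zero_mul, scale]

end TwistedPoly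

namespace DrinfeldModule

variable {Fq : Type*} [Field Fq] [Fintype Fq] {L : Type*} [Field L] [Algebra Fq L]
  [Algebra Fq[X] L] [IsScalarTower Fq Fq[X] L] {r : ℕ}

theorem isMorphism_homothety_iff {φ ψ : DrinfeldModule Fq L r} {c : L} (hc : c ≠ 0) :
    ψ.IsMorphism φ (homothety (Fq := Fq) c hc).val ↔ ψ.t = scale c φ.t := by
  rw [isMorphism_iff, ← homothety_inv_mul_mul c hc, mul_assoc, eq_comm, Units.eq_inv_mul_iff_mul_eq,
    eq_comm]

/-- Two Drinfeld modules are isomorphic if and only if they are conjugate by a homothety. -/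
theorem mk_eq_mk_iff {φ ψ : DrinfeldModule Fq L r} :
    (Quotient.mk _ ψ : IsomClass Fq L r) = Quotient.mk _ φ ↔
      ∃ c : L, c ≠ 0 ∧ ψ.t = scale c φ.t := by
  rw [Quotient.eq]
  constructor
  · rintro ⟨u, hu⟩
    obtain ⟨c, hc, rfl⟩ := exists_eq_homothety u
    exact ⟨c, hc, (isMorphism_homothety_iff hc).1 hu⟩
  · rintro ⟨c, hc, h⟩
    exact ⟨_, (isMorphism_homothety_iff hc).2 h⟩

/-- The Drinfeld module `c⁻¹ φ c`. -/
def scaled (φ : DrinfeldModule Fq L r) (c : L) (hc : c ≠ 0) : DrinfeldModule Fq L r :=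
  ofTwisted (scale c φ.t) (by rw [tc_scale' hc, φ.tc_t_zero]; simp) (by
    intro h
    have h1 := congrArg (fun f => f.tc r) h
    simp only [tc_zero] at h1
    rw [tc_scale' hc] at h1
    have h2 := tc_tdeg_ne_zero φ.t_ne_zero
    rw [φ.tdeg_t] at h2
    exact mul_ne_zero h2 (pow_ne_zero _ hc) h1) (by rw [tdeg_scale hc, φ.tdeg_t])

theorem t_scaled (φ : DrinfeldModule Fq L r) (c : L) (hc : c ≠ 0) :
    (φ.scaled c hc).t = scale c φ.t := t_ofTwisted _ _ _ _

theorem mk_scaled (φ : DrinfeldModule Fq L r) (c : L) (hc : c ≠ 0) :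
    (Quotient.mk _ (φ.scaled c hc) : IsomClass Fq L r) = Quotient.mk _ φ :=
  mk_eq_mk_iff.2 ⟨c, hc, t_scaled φ c hc⟩

theorem scale_commute {φ ψ : DrinfeldModule Fq L r} {c : L} (hc : c ≠ 0) (h : ψ.t = scale c φ.t)
    {u : TwistedPoly Fq L} (hu : u * φ.t = φ.t * u) : scale c u * ψ.t = ψ.t * scale c u := by
  rw [h, ← scale_mul hc, hu, scale_mul hc]

theorem tc_zero_scale {c : L} (hc : c ≠ 0) (u : TwistedPoly Fq L) : (scale c u).tc 0 = u.tc 0 := by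
  rw [tc_scale' hc]; simp

theorem endImage_le_of_scale {φ ψ : DrinfeldModule Fq L r} {c : L} (hc : c ≠ 0)
    (h : ψ.t = scale c φ.t) : φ.endImage ≤ ψ.endImage := by
  intro x hx
  obtain ⟨u, hu, rfl⟩ := mem_endImage.1 hx
  exact mem_endImage.2 ⟨scale c u, scale_commute hc h hu, tc_zero_scale hc u⟩

theorem endImage_eq_of_mk_eq {φ ψ : DrinfeldModule Fq L r}
    (h : (Quotient.mk _ ψ : IsomClass Fq L r) = Quotient.mk _ φ) : ψ.endImage = φ.endImage := by
  obtain ⟨c, hc, h1⟩ := mk_eq_mk_iff.1 h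
  obtain ⟨d, hd, h2⟩ := mk_eq_mk_iff.1 h.symm
  exact le_antisymm (endImage_le_of_scale hd h2) (endImage_le_of_scale hc h1)

/-- Over an algebraically closed field, every Drinfeld module is isomorphic to one with leading
coefficient `1`. -/
theorem exists_scaled_tc_eq_one [IsAlgClosed L] (φ : DrinfeldModule Fq L r) (hr : r ≠ 0) :
    ∃ c hc, (φ.scaled c hc).t.tc r = 1 := by
  have hlead : φ.t.tc r ≠ 0 := by
    have h2 := tc_tdeg_ne_zero φ.t_ne_zero
    rwa [φ.tdeg_t] at h2
  have hq : 0 < Fintype.card Fq ^ r - 1 := by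
    have := Nat.one_lt_pow hr (one_lt_q (Fq := Fq))
    omega
  obtain ⟨c, hc⟩ := IsAlgClosed.exists_pow_nat_eq (φ.t.tc r)⁻¹ hq
  have hc0 : c ≠ 0 := by
    rintro rfl
    rw [zero_pow hq.ne'] at hc
    exact inv_ne_zero hlead hc.symm
  exact ⟨c, hc0, by rw [t_scaled, tc_scale' hc0, hc, mul_inv_cancel₀ hlead]⟩

variable [Algebra (RatFunc Fq) L] [IsScalarTower Fq[X] (RatFunc Fq) L]

theorem le_natDegree_of_eval₂_eq_zero {α : L} (hint : IsIntegral Fq[X] α)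
    (hdeg : (minpoly Fq[X] α).natDegree = r) (p : Fq[X][X]) (hp : p.Monic)
    (h : p.eval₂ (aeval (algebraMap Fq[X] L X) : Fq[X] →ₐ[Fq] L).toRingHom α = 0) :
    r ≤ p.natDegree := by
  have := faithfulSMul_polynomial Fq L
  rw [aeval_algebraMap_X_toRingHom] at h
  rw [← hdeg]
  exact natDegree_le_of_dvd (minpoly.isIntegrallyClosed_dvd hint h) hp.ne_zero

/-- There are finitely many isomorphism classes of Drinfeld modules having an endomorphism of
bounded degree with a given derivative of degree `r`. -/
theorem finite_isomClass [IsAlgClosed L] (hr : r ≠ 0) {α : L} (hint : IsIntegral Fq[X] α)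
    (hdeg : (minpoly Fq[X] α).natDegree = r) (d : ℕ) :
    {x : IsomClass Fq L r | ∃ φ : DrinfeldModule Fq L r, Quotient.mk _ φ = x ∧
      ∃ u : TwistedPoly Fq L, u * φ.t = φ.t * u ∧ u.tc 0 = α ∧ u.tdeg ≤ d}.Finite := by
  have hfin := finite_setOf_endomorphism (Fq := Fq) (algebraMap Fq[X] L X) α hr d
    (le_natDegree_of_eval₂_eq_zero hint hdeg)
  set S := {t : TwistedPoly Fq L | t.tdeg = r ∧ t.tc r = 1 ∧ t.tc 0 = algebraMap Fq[X] L X ∧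
      ∃ u : TwistedPoly Fq L, u * t = t * u ∧ u.tc 0 = α ∧ u.tdeg ≤ d}
  have : Finite S := hfin
  have hS : ∀ t : S, t.1 ≠ 0 := fun t h0 => by
    have := t.2.2.1
    rw [h0, tc_zero] at this
    exact zero_ne_one this
  refine (Set.finite_range fun t : S =>
    (Quotient.mk _ (ofTwisted t.1 t.2.2.2.1 (hS t) t.2.1) : IsomClass Fq L r)).subset ?_
  rintro _ ⟨φ, rfl, u, hu, hα, hd⟩
  obtain ⟨c, hc, h1⟩ := φ.exists_scaled_tc_eq_one hr
  refine ⟨⟨(φ.scaled c hc).t, (φ.scaled c hc).tdeg_t, h1, (φ.scaled c hc).tc_t_zero,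
    scale c u, scale_commute hc (t_scaled φ c hc) hu, by rw [tc_zero_scale hc, hα],
    by rwa [tdeg_scale hc]⟩, ?_⟩
  rw [← mk_scaled φ c hc]
  exact congrArg (Quotient.mk _)
    (ext_t (φ := ofTwisted (φ.scaled c hc).t _ _ _) (t_ofTwisted (φ.scaled c hc).t _ _ _))

/-- The degree of an endomorphism is bounded in terms of the minimal polynomial of its
derivative. -/
theorem tdeg_le_of_monic (φ : DrinfeldModule Fq L r) (hr : r ≠ 0) {u : TwistedPoly Fq L}
    (hu : u * φ.t = φ.t * u) {p : Fq[X][X]} (hp : p.Monic) (h : aeval (u.tc 0) p = 0) {M : ℕ}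
    (hM : ∀ i, (p.coeff i).natDegree ≤ M) : u.tdeg ≤ r * M := by
  have := faithfulSMul_polynomial Fq L
  rcases eq_or_ne u 0 with rfl | hu0
  · exact tdeg_le_of_forall fun _ _ => tc_zero _
  have h1 := (φ.evalPair_eq_zero_iff hu p).2 h
  by_contra! hlt
  rw [evalPair, eval₂_eq_sum_range, Finset.sum_range_succ, hp.coeff_natDegree, map_one,
    one_mul] at h1
  -- otherwise the leading power of `u` has greater degree than all other terms of the equation
  have h2 : (u ^ p.natDegree).tc (p.natDegree * u.tdeg) ≠ 0 := by
    rw [← tdeg_pow hu0]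
    exact tc_tdeg_ne_zero (pow_ne_zero _ hu0)
  have h3 := congrArg (fun f => f.tc (p.natDegree * u.tdeg)) h1
  simp only [tc_add, tc_sum, tc_zero] at h3
  rw [Finset.sum_eq_zero, zero_add] at h3
  · exact h2 h3
  intro i hi
  have hi := Finset.mem_range.1 hi
  refine tc_eq_zero_of_tdeg_lt ((tdeg_mul_le _ _).trans_lt ?_)
  have h4 : (φ.toAlgHom (p.coeff i)).tdeg ≤ r * M :=
    (φ.tdeg_toAlgHom_le hr _).trans (Nat.mul_le_mul_left _ (hM i))
  rw [toAlgHom_eq_aeval] at h4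
  change (aeval φ.t (p.coeff i)).tdeg + (u ^ i).tdeg < _
  rw [tdeg_pow hu0]
  nlinarith

/-- There are finitely many isomorphism classes of Drinfeld modules with a given order of degree
`r` as endomorphism ring. -/
theorem finite_cmClasses [IsAlgClosed L] (hr : r ≠ 0) {O : Subalgebra Fq[X] L}
    (hO : IsImaginaryOrder r O) : (cmClasses r O).Finite := by
  have := faithfulSMul_polynomial Fq L
  have hfinO := hO.finite
  have hintO : ∀ β ∈ O, IsIntegral Fq[X] β := fun β hβ =>
    (Algebra.IsIntegral.isIntegral (R := Fq[X]) (⟨β, hβ⟩ : O)).map O.val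
  have hfd : FiniteDimensional (RatFunc Fq) (fracField O) :=
    FiniteDimensional.of_finrank_pos (by rw [hO.finrank_eq]; exact Nat.pos_of_ne_zero hr)
  -- a multiple `β ∈ O` of a primitive element of the field of fractions; the corresponding element
  -- of `End φ ≅ O` is one of the finitely many conjugates of `β`
  obtain ⟨y, hy⟩ := exists_primitive_element_ratFunc (Fq := Fq) (fracField O)
  obtain ⟨β, hβ, b, hb, hyβ⟩ := (mem_fracField_iff hintO).1 y.2
  have hb' : algebraMap Fq[X] (RatFunc Fq) b ≠ 0 := by
    rwa [Ne, FaithfulSMul.algebraMap_eq_zero_iff]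
  have hβy : β = algebraMap (RatFunc Fq) L (algebraMap Fq[X] (RatFunc Fq) b) * y := by
    rw [hyβ, ← IsScalarTower.algebraMap_apply, mul_div_cancel₀ _ (algebraMap_polynomial_ne_zero hb)]
  have hyadj : (y : L) ∈ IntermediateField.adjoin (RatFunc Fq) {β} := by
    have h1 : (y : L) = algebraMap (RatFunc Fq) L (algebraMap Fq[X] (RatFunc Fq) b)⁻¹ * β := by
      rw [hβy, ← mul_assoc, ← map_mul, inv_mul_cancel₀ hb', map_one, one_mul]
    rw [h1]
    exact mul_mem (IntermediateField.algebraMap_mem _ _)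
      (IntermediateField.mem_adjoin_simple_self _ _)
  have hdeg : (minpoly Fq[X] β).natDegree = r := by
    rw [← finrank_adjoin_of_isIntegral (hintO β hβ), ← hO.finrank_eq]
    have h1 : IntermediateField.adjoin (RatFunc Fq) {β} = fracField O := by
      refine le_antisymm (IntermediateField.adjoin_simple_le_iff.2
        (IntermediateField.subset_adjoin _ _ hβ)) ?_
      have h2 := congrArg (IntermediateField.map (fracField O).val) hy
      rw [IntermediateField.adjoin_map, Set.image_singleton, ← AlgHom.fieldRange_eq_map,
        IntermediateField.fieldRange_val] at h2
      rw [← h2, IntermediateField.adjoin_simple_le_iff]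
      exact hyadj
    rw [h1]
  obtain ⟨M, hM⟩ : ∃ M, ∀ i, ((minpoly Fq[X] β).coeff i).natDegree ≤ M := by
    refine ⟨(minpoly Fq[X] β).support.sup fun i => ((minpoly Fq[X] β).coeff i).natDegree,
      fun i => ?_⟩
    by_cases hi : i ∈ (minpoly Fq[X] β).support
    · exact Finset.le_sup (f := fun i => ((minpoly Fq[X] β).coeff i).natDegree) hi
    · rw [notMem_support_iff.1 hi, natDegree_zero]; exact Nat.zero_le _
  have hroots : {α : L | minpoly Fq[X] α = minpoly Fq[X] β}.Finite := by
    refine ((minpoly Fq[X] β).rootSet_finite L).subset fun α hα => ?_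
    refine (mem_rootSet_of_ne (minpoly.monic (hintO β hβ)).ne_zero).2 ?_
    have h : minpoly Fq[X] α = minpoly Fq[X] β := hα
    rw [← h, minpoly.aeval]
  have hmin : ∀ α : L, minpoly Fq[X] α = minpoly Fq[X] β → IsIntegral Fq[X] α := by
    intro α hα
    by_contra h
    rw [minpoly.eq_zero h] at hα
    exact (minpoly.monic (hintO β hβ)).ne_zero hα.symm
  refine (hroots.biUnion
    (t := fun α => {x : IsomClass Fq L r | ∃ φ : DrinfeldModule Fq L r, Quotient.mk _ φ = x ∧
      ∃ u : TwistedPoly Fq L, u * φ.t = φ.t * u ∧ u.tc 0 = α ∧ u.tdeg ≤ r * M})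
    fun α hα => finite_isomClass hr (hmin α hα) (by rw [hα, hdeg]) _).subset ?_
  rintro x ⟨φ, rfl, ⟨e⟩⟩
  let v := e.symm ⟨β, hβ⟩
  have hv : minpoly Fq[X] ((v : TwistedPoly Fq L).tc 0) = minpoly Fq[X] β := by
    have h1 := minpoly.algEquiv_eq φ.endEquiv v
    have h2 := minpoly.algHom_eq φ.endImage.val Subtype.val_injective (φ.endEquiv v)
    have h3 := minpoly.algEquiv_eq e.symm ⟨β, hβ⟩
    have h4 := minpoly.algHom_eq O.val Subtype.val_injective ⟨β, hβ⟩
    exact h2.trans (h1.trans (h3.trans h4.symm))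
  refine Set.mem_biUnion (x := (v : TwistedPoly Fq L).tc 0) hv
    ⟨φ, rfl, v, mem_endRing.1 v.2, rfl, ?_⟩
  refine φ.tdeg_le_of_monic hr (mem_endRing.1 v.2) (minpoly.monic (hintO β hβ)) ?_ hM
  rw [← hv, minpoly.aeval]

end DrinfeldModule

end DrinfeldCM

namespace DrinfeldCM

/-! ### Norm equations in imaginary orders -/

section NormClasses

variable {Fq : Type*} [Field Fq] {L : Type*} [Field L]
  [Algebra Fq[X] L] [Algebra (RatFunc Fq) L] [IsScalarTower Fq[X] (RatFunc Fq) L]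
  {r : ℕ} {a : Fq[X]}

theorem isIntegral_of_mem_order {O : Subalgebra Fq[X] L} (hO : Module.Finite Fq[X] O) {β : L}
    (hβ : β ∈ O) : IsIntegral Fq[X] β :=
  (Algebra.IsIntegral.isIntegral (R := Fq[X]) (⟨β, hβ⟩ : O)).map O.val

/-- Since `r ≥ 2` and `a` is prime, elements of norm `c a` are automatically primitive. -/
theorem normClasses_eq {O : Subalgebra Fq[X] L} (hr : 2 ≤ r) (hO : IsImaginaryOrder r O)
    (ha : Prime a) : normClasses O a = Associates.mk '' {u : O | HasPrimeNorm r a (u : L)} := by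
  have hfd : FiniteDimensional (RatFunc Fq) (fracField O) :=
    FiniteDimensional.of_finrank_pos (by rw [hO.finrank_eq]; omega)
  have hmem : ∀ u : O, (u : L) ∈ fracField O := fun u => IntermediateField.subset_adjoin _ _ u.2
  have key : ∀ u : O, (∃ c : Fq, c ≠ 0 ∧ fieldNorm O u =
      algebraMap Fq[X] (RatFunc Fq) (C c * a)) ↔ HasPrimeNorm r a (u : L) := fun u =>
    norm_eq_iff_hasPrimeNorm ha hO.finrank_eq (x := ⟨u, hmem u⟩)
      (isIntegral_of_mem_order hO.finite u.2)
  rw [normClasses]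
  congr 1
  ext u
  refine ⟨fun h => (key u).1 h.2, fun h => ⟨?_, (key u).2 h⟩⟩
  rintro d β rfl
  obtain ⟨c, hc, hN⟩ := (key _).2 h
  obtain ⟨e, -, hNβ⟩ := exists_norm_eq_coeff_zero_pow (fracField O) (x := ⟨β, hmem β⟩)
    (isIntegral_of_mem_order hO.finite β.2)
  have h1 : fieldNorm O (d • β) = algebraMap Fq[X] (RatFunc Fq) d ^ r *
      Algebra.norm (RatFunc Fq) (⟨β, hmem β⟩ : fracField O) := by
    rw [← hO.finrank_eq, ← Algebra.norm_algebraMap (S := fracField O), ← map_mul, fieldNorm]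
    congr 1
    apply Subtype.ext
    change (d • (β : L)) = algebraMap (RatFunc Fq) L (algebraMap Fq[X] (RatFunc Fq) d) * (β : L)
    rw [← IsScalarTower.algebraMap_apply, Algebra.smul_def]
  -- if `u = d β`, then `d ^ r` divides the irreducible polynomial `c a`
  rw [h1, hNβ, ← map_pow, ← map_mul] at hN
  have h2 := FaithfulSMul.algebraMap_injective Fq[X] (RatFunc Fq) hN
  have hirr : Irreducible (C c * a) := ((associated_C_mul hc).prime ha).irreducible
  rw [← h2, show r = 1 + (r - 1) by omega, pow_add, pow_one, mul_assoc] at hirr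
  rcases hirr.isUnit_or_isUnit rfl with h3 | h3
  · exact h3
  · have h4 := isUnit_of_mul_isUnit_left h3
    exact (isUnit_pow_iff (by omega)).1 h4

theorem hasPrimeNorm_algEquiv {O O' : Subalgebra Fq[X] L} (e : O ≃ₐ[Fq[X]] O') {u : O}
    (h : HasPrimeNorm r a (u : L)) : HasPrimeNorm r a (e u : L) := by
  have h1 : minpoly Fq[X] (e u : L) = minpoly Fq[X] (u : L) :=
    (minpoly.algHom_eq O'.val Subtype.val_injective (e u)).trans ((minpoly.algEquiv_eq e u).trans
      (minpoly.algHom_eq O.val Subtype.val_injective u).symm)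
  refine ⟨?_, by rw [h1]; exact h.2⟩
  have h2 : IsIntegral Fq[X] u := (isIntegral_algHom_iff O.val Subtype.val_injective).1 h.1
  exact (h2.map e).map O'.val

/-- The exponent only depends on the isomorphism class of the order. -/
theorem gammaExp_eq_of_algEquiv {O O' : Subalgebra Fq[X] L} (hr : 2 ≤ r)
    (hO : IsImaginaryOrder r O) (hO' : IsImaginaryOrder r O') (ha : Prime a)
    (e : O ≃ₐ[Fq[X]] O') : gammaExp O a = gammaExp O' a := by
  rw [gammaExp, gammaExp, normClasses_eq hr hO ha, normClasses_eq hr hO' ha]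
  let E : Associates O → Associates O' := Quotient.map e fun x y ⟨v, hv⟩ =>
    ⟨Units.map (e : O →* O') v, by rw [← hv, map_mul]; rfl⟩
  refine Set.ncard_congr (fun x _ => E x) ?_ ?_ ?_
  · rintro _ ⟨u, hu, rfl⟩
    exact ⟨e u, hasPrimeNorm_algEquiv e hu, rfl⟩
  · rintro _ _ ⟨u, hu, rfl⟩ ⟨v, hv, rfl⟩ h
    have h1 : Associates.mk (e u) = Associates.mk (e v) := h
    rw [Associates.mk_eq_mk_iff_associated] at h1 ⊢
    obtain ⟨w, hw⟩ := h1
    refine ⟨Units.map (e.symm : O' →* O) w, e.injective ?_⟩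
    rw [← hw, map_mul]
    congr 1
    exact e.apply_symm_apply _
  · rintro _ ⟨u, hu, rfl⟩
    exact ⟨Associates.mk (e.symm u), ⟨e.symm u, hasPrimeNorm_algEquiv e.symm hu, rfl⟩,
      congrArg Associates.mk (e.apply_symm_apply u)⟩

theorem finite_quotient_span_singleton [Fintype Fq] {c : Fq[X]} (hc : c ≠ 0) :
    Finite (Fq[X] ⧸ Ideal.span {c}) := by
  have h := (natCard_quotient_span (Polynomial.monic_mul_leadingCoeff_inv hc)).1
  rwa [Ideal.span_singleton_mul_right_unit] at h
  exact isUnit_C.2 (inv_ne_zero (leadingCoeff_ne_zero.2 hc)).isUnit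

theorem finite_quotient_smul_top [Fintype Fq] {M : Type*} [AddCommGroup M] [Module Fq[X] M]
    [Module.Finite Fq[X] M] {c : Fq[X]} (hc : c ≠ 0) :
    Finite (M ⧸ (Ideal.span {c} • (⊤ : Submodule Fq[X] M))) := by
  have := finite_quotient_span_singleton hc
  have : Finite (M ⧸ (⊤ : Submodule Fq[X] M)) := inferInstance
  exact Submodule.finite_quotient_smul _ Module.Finite.fg_top

theorem mem_span_singleton_smul_top {M : Type*} [AddCommGroup M] [Module Fq[X] M] {c : Fq[X]}
    {x : M} : x ∈ Ideal.span {c} • (⊤ : Submodule Fq[X] M) ↔ ∃ y, x = c • y := by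
  rw [Submodule.ideal_span_singleton_smul, Submodule.mem_smul_pointwise_iff_exists]
  exact ⟨fun ⟨y, _, h⟩ => ⟨y, h.symm⟩, fun ⟨y, h⟩ => ⟨y, trivial, h.symm⟩⟩

/-- There are finitely many classes of elements of norm `c a`: such elements divide `a`, so they
are associated if they are congruent modulo `a`. -/
theorem finite_normClasses [Fintype Fq] {O : Subalgebra Fq[X] L} (hr : 2 ≤ r)
    (hO : IsImaginaryOrder r O) (ha : Prime a) : (normClasses O a).Finite := by
  have hfinO := hO.finite
  have hQ := finite_quotient_smul_top (M := O) ha.ne_zero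
  have hdvd : ∀ u : O, HasPrimeNorm r a (u : L) → u ∣ algebraMap Fq[X] O a := by
    rintro u ⟨hint, -, c, hc, hca⟩
    have h := minpoly.aeval Fq[X] (u : L)
    rw [← (minpoly Fq[X] (u : L)).divX_mul_X_add, map_add, map_mul, aeval_X, aeval_C, hca] at h
    have h1 : (aeval u (minpoly Fq[X] (u : L)).divX : O) * u +
        algebraMap Fq[X] O (C c * a) = 0 := by
      apply Subtype.val_injective
      refine Eq.trans ?_ h
      have h2 : ((aeval u (minpoly Fq[X] (u : L)).divX : O) : L) =
          aeval (u : L) (minpoly Fq[X] (u : L)).divX :=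
        (aeval_algHom_apply O.val u _).symm
      rw [← h2]
      rfl
    have h3 : u ∣ algebraMap Fq[X] O (C c * a) :=
      ⟨-(aeval u (minpoly Fq[X] (u : L)).divX : O), by
        rw [eq_neg_of_add_eq_zero_right h1]; ring⟩
    have h4 := h3.mul_left (algebraMap Fq[X] O (C c⁻¹))
    rwa [← map_mul, ← mul_assoc, ← C_mul, inv_mul_cancel₀ hc, C_1, one_mul] at h4
  have hcong : ∀ u v : O, HasPrimeNorm r a (u : L) →
      Submodule.Quotient.mk (p := Ideal.span {a} • (⊤ : Submodule Fq[X] O)) u =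
        Submodule.Quotient.mk v → u ∣ v := by
    intro u v hu h
    obtain ⟨y, hy⟩ := mem_span_singleton_smul_top.1 ((Submodule.Quotient.eq _).1 h)
    have h1 : v = u - algebraMap Fq[X] O a * y := by rw [← Algebra.smul_def, ← hy, sub_sub_cancel]
    rw [h1]
    exact dvd_sub dvd_rfl ((hdvd u hu).mul_right y)
  rw [normClasses_eq hr hO ha]
  refine Set.Finite.of_surjOn (s := Submodule.Quotient.mk (p := Ideal.span {a} •
    (⊤ : Submodule Fq[X] O)) '' {u : O | HasPrimeNorm r a (u : L)})
    (fun q => Associates.mk (Function.invFunOn (Submodule.Quotient.mk (p := Ideal.span {a} •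
      (⊤ : Submodule Fq[X] O))) {u : O | HasPrimeNorm r a (u : L)} q)) ?_ (Set.toFinite _)
  rintro _ ⟨u, hu, rfl⟩
  refine ⟨_, ⟨u, hu, rfl⟩, ?_⟩
  have hq : Submodule.Quotient.mk (p := Ideal.span {a} • (⊤ : Submodule Fq[X] O)) u ∈
    Submodule.Quotient.mk (p := Ideal.span {a} • (⊤ : Submodule Fq[X] O)) ''
      {u : O | HasPrimeNorm r a (u : L)} := ⟨u, hu, rfl⟩
  have h1 := Function.invFunOn_mem hq
  have h2 := Function.invFunOn_eq hq
  exact Associates.mk_eq_mk_iff_associated.2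
    (associated_of_dvd_dvd (hcong _ _ h1 h2) (hcong _ _ hu h2.symm))

end NormClasses

end DrinfeldCM

namespace DrinfeldCM

/-! ### Elements of prime norm in imaginary fields -/

section Imaginary

variable {Fq : Type*} [Field Fq] {L : Type*} [Field L]
  [Algebra Fq[X] L] [Algebra (RatFunc Fq) L] [IsScalarTower Fq[X] (RatFunc Fq) L]
  {r : ℕ} {a : Fq[X]}

/-- The valuation ring of the place at infinity is a maximal subring of `Fq(T)`. -/
theorem eq_inftyRing_or_eq_top {W : ValuationSubring (RatFunc Fq)} (hW : inftyRing Fq ≤ W) :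
    W = inftyRing Fq ∨ ∀ x, x ∈ W := by
  refine or_iff_not_imp_left.2 fun hne x => ?_
  obtain ⟨z, hzW, hz⟩ : ∃ z ∈ W, z ∉ inftyRing Fq := by
    by_contra! h
    exact hne (le_antisymm h hW)
  obtain ⟨p, b, hb, rfl⟩ := exists_eq_div z
  have hp : p ≠ 0 := by rintro rfl; rw [map_zero, zero_div] at hz; exact hz (zero_mem _)
  rw [div_mem_inftyRing hp hb, not_le] at hz
  have hne : ∀ {q : Fq[X]}, q ≠ 0 → algebraMap Fq[X] (RatFunc Fq) q ≠ 0 := fun h => by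
    rwa [Ne, FaithfulSMul.algebraMap_eq_zero_iff]
  -- `T` is a product of `z = p / b` and `T b / p`, and every `x` is a product of a power of `T` and
  -- an element of `inftyRing Fq`
  have hT : algebraMap Fq[X] (RatFunc Fq) X ∈ W := by
    have h1 : algebraMap Fq[X] (RatFunc Fq) X = algebraMap Fq[X] (RatFunc Fq) p /
        algebraMap Fq[X] (RatFunc Fq) b * (algebraMap Fq[X] (RatFunc Fq) (X * b) /
          algebraMap Fq[X] (RatFunc Fq) p) := by
      have h2 := hne hp
      have h3 := hne hb
      rw [map_mul]
      field_simp
    rw [h1]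
    refine mul_mem hzW (hW (div_mem_inftyRing_of_le hp ?_))
    rw [natDegree_X_mul hb]
    exact hz
  obtain ⟨p', b', hb', rfl⟩ := exists_eq_div x
  have h1 : algebraMap Fq[X] (RatFunc Fq) p' / algebraMap Fq[X] (RatFunc Fq) b' =
      algebraMap Fq[X] (RatFunc Fq) X ^ p'.natDegree * (algebraMap Fq[X] (RatFunc Fq) p' /
        algebraMap Fq[X] (RatFunc Fq) (b' * X ^ p'.natDegree)) := by
    have h3 := hne hb'
    have h4 := hne (X_ne_zero (R := Fq))
    rw [map_mul, map_pow]
    field_simp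
  rw [h1]
  refine mul_mem (pow_mem hT _) (hW (div_mem_inftyRing_of_le
    (mul_ne_zero hb' (pow_ne_zero _ X_ne_zero)) ?_))
  rw [natDegree_mul_X_pow _ hb']
  omega

/-- If there is a unique place over `∞`, its valuation ring is the integral closure of the valuation
ring of `∞`. -/
theorem isIntegral_of_mem_place {K : IntermediateField (RatFunc Fq) L}
    [FiniteDimensional (RatFunc Fq) K] {V : ValuationSubring K}
    (huniq : ∀ W : ValuationSubring K, W.comap (algebraMap (RatFunc Fq) K) = inftyRing Fq → W = V)
    {y : K} (hy : y ∈ V) : IsIntegral (inftyRing Fq) y := by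
  -- a valuation ring containing that of `∞` lies either over `∞` or over all of `Fq(T)`
  refine isIntegralElem_of_forall_valuationSubring (algebraMap (inftyRing Fq) K) y fun W hW => ?_
  have hle : inftyRing Fq ≤ W.comap (algebraMap (RatFunc Fq) K) := fun z hz =>
    ValuationSubring.mem_comap.2 (hW ⟨z, hz⟩)
  rcases eq_inftyRing_or_eq_top hle with h | h
  · rw [huniq W h]; exact hy
  · let ι : RatFunc Fq →+* W := RingHom.codRestrict (algebraMap (RatFunc Fq) K) W fun z =>
      ValuationSubring.mem_comap.1 (h z)
    have h1 : IsIntegral (RatFunc Fq) y := Algebra.IsIntegral.isIntegral y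
    have h2 : IsIntegral W y := h1.map_of_comp_eq ι (RingHom.id K) rfl
    obtain ⟨z, hz⟩ := IsIntegrallyClosed.isIntegral_iff.1 h2
    rw [← hz]
    exact z.2

theorem eval₂_mem_place {K : IntermediateField (RatFunc Fq) L} {V : ValuationSubring K}
    (hV : V.comap (algebraMap (RatFunc Fq) K) = inftyRing Fq) {z : K} (hz : z ∈ V)
    (Q : (inftyRing Fq)[X]) : aeval z Q ∈ V := by
  rw [aeval_eq_sum_range]
  refine sum_mem fun i _ => ?_
  rw [Algebra.smul_def]
  refine mul_mem ?_ (pow_mem hz i)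
  have h1 : ((Q.coeff i : inftyRing Fq) : RatFunc Fq) ∈ V.comap (algebraMap (RatFunc Fq) K) := by
    rw [hV]; exact (Q.coeff i).2
  exact ValuationSubring.mem_comap.1 h1

/-- If there is a unique place over `∞`, elements whose norm is a constant are units at this
place. -/
theorem mem_place_of_norm_eq {K : IntermediateField (RatFunc Fq) L}
    [FiniteDimensional (RatFunc Fq) K] {V : ValuationSubring K}
    (hV : V.comap (algebraMap (RatFunc Fq) K) = inftyRing Fq)
    (huniq : ∀ W : ValuationSubring K, W.comap (algebraMap (RatFunc Fq) K) = inftyRing Fq → W = V)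
    {y : K} {c : Fq} (hc : c ≠ 0)
    (hN : Algebra.norm (RatFunc Fq) y = algebraMap Fq[X] (RatFunc Fq) (C c)) : y ∈ V := by
  refine (V.mem_or_inv_mem y).elim id fun hz => ?_
  have hy0 : y ≠ 0 := by
    rintro rfl
    rw [Algebra.norm_zero, eq_comm, FaithfulSMul.algebraMap_eq_zero_iff, C_eq_zero] at hN
    exact hc hN
  -- the inverse of `y` is integral at infinity with unit norm, so `y` is a polynomial in it
  have hint := isIntegral_of_mem_place huniq hz
  have hzK : IsIntegral (RatFunc Fq) y⁻¹ := Algebra.IsIntegral.isIntegral _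
  have hmin : minpoly (RatFunc Fq) y⁻¹ = (minpoly (inftyRing Fq) y⁻¹).map
      (algebraMap (inftyRing Fq) (RatFunc Fq)) :=
    minpoly.isIntegrallyClosed_eq_field_fractions (RatFunc Fq) K hint
  set P := minpoly (inftyRing Fq) y⁻¹ with hP
  -- the constant coefficient is a unit at infinity, since a power of it is a constant
  have hc0 : (((P.coeff 0 : inftyRing Fq) : RatFunc Fq))⁻¹ ∈ inftyRing Fq := by
    have hN' : Algebra.norm (RatFunc Fq) y⁻¹ = algebraMap Fq[X] (RatFunc Fq) (C c⁻¹) := by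
      have h1 : Algebra.norm (RatFunc Fq) y⁻¹ * algebraMap Fq[X] (RatFunc Fq) (C c) = 1 := by
        rw [← hN, ← map_mul, inv_mul_cancel₀ hy0, map_one]
      rw [eq_inv_of_mul_eq_one_left h1, eq_comm]
      refine eq_inv_of_mul_eq_one_left ?_
      rw [← map_mul, ← C_mul, inv_mul_cancel₀ hc, C_1, map_one]
    rw [Algebra.norm_eq_norm_adjoin, ← IntermediateField.adjoin.powerBasis_gen hzK,
      Algebra.PowerBasis.norm_gen_eq_coeff_zero_minpoly, IntermediateField.adjoin.powerBasis_gen,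
      IntermediateField.minpoly_gen, hmin, coeff_map] at hN'
    set e := Module.finrank (IntermediateField.adjoin (RatFunc Fq) {y⁻¹}) K
    have he : e ≠ 0 := Module.finrank_pos.ne'
    set s : RatFunc Fq := (-1) ^ (IntermediateField.adjoin.powerBasis hzK).dim
    have hs : s * s = 1 := by
      rw [← pow_add, ← two_mul, pow_mul, neg_one_sq, one_pow]
    have hCmem : algebraMap Fq[X] (RatFunc Fq) (C c) ∈ inftyRing Fq := by
      have := div_mem_inftyRing_of_le (p := C c) (b := (1 : Fq[X])) one_ne_zero (by simp)
      rwa [map_one, div_one] at this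
    have hmem : s * algebraMap (inftyRing Fq) (RatFunc Fq) (P.coeff 0) ∈ inftyRing Fq :=
      mul_mem (pow_mem (neg_mem (one_mem _)) _) (P.coeff 0).2
    have h2 : (P.coeff 0 : RatFunc Fq) * (s * (s * algebraMap (inftyRing Fq) (RatFunc Fq)
        (P.coeff 0)) ^ (e - 1) * algebraMap Fq[X] (RatFunc Fq) (C c)) = 1 := by
      have h3 : (s * algebraMap (inftyRing Fq) (RatFunc Fq) (P.coeff 0)) ^ (e - 1) *
          (s * algebraMap (inftyRing Fq) (RatFunc Fq) (P.coeff 0)) =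
            algebraMap Fq[X] (RatFunc Fq) (C c⁻¹) := by
        rw [← pow_succ, Nat.sub_add_cancel (Nat.pos_of_ne_zero he), hN']
      have h4 : algebraMap Fq[X] (RatFunc Fq) (C c⁻¹) *
          algebraMap Fq[X] (RatFunc Fq) (C c) = 1 := by
        rw [← map_mul, ← C_mul, inv_mul_cancel₀ hc, C_1, map_one]
      rw [← h4, ← h3]
      change (P.coeff 0 : RatFunc Fq) * (s * (s * (P.coeff 0 : RatFunc Fq)) ^ (e - 1) * _) =
        (s * (P.coeff 0 : RatFunc Fq)) ^ (e - 1) * (s * (P.coeff 0 : RatFunc Fq)) * _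
      ring
    rw [inv_eq_of_mul_eq_one_right h2]
    exact mul_mem (mul_mem (pow_mem (neg_mem (one_mem _)) _) (pow_mem hmem _)) hCmem
  have h0 : (P.coeff 0 : RatFunc Fq) ≠ 0 := by
    intro h0
    have h1 : (minpoly (RatFunc Fq) y⁻¹).coeff 0 = 0 := by
      rw [hmin, coeff_map]; exact h0
    exact minpoly.coeff_zero_ne_zero hzK (inv_ne_zero hy0) h1
  have h1 : aeval y⁻¹ P = 0 := minpoly.aeval _ _
  rw [← P.divX_mul_X_add, map_add, map_mul, aeval_X, aeval_C] at h1
  have h2 : y = -(aeval y⁻¹ P.divX) * algebraMap (RatFunc Fq) K (P.coeff 0 : RatFunc Fq)⁻¹ := by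
    have h3 : algebraMap (RatFunc Fq) K (P.coeff 0 : RatFunc Fq) = -(aeval y⁻¹ P.divX * y⁻¹) :=
      eq_neg_of_add_eq_zero_right h1
    have h5 : algebraMap (RatFunc Fq) K (P.coeff 0 : RatFunc Fq) ≠ 0 := by
      rwa [Ne, map_eq_zero]
    rw [map_inv₀, eq_mul_inv_iff_mul_eq₀ h5, h3, mul_neg, mul_comm _ y⁻¹, ← mul_assoc,
      mul_inv_cancel₀ hy0, one_mul]
  rw [h2]
  refine mul_mem (neg_mem (eval₂_mem_place hV hz _)) (ValuationSubring.mem_comap.1 ?_)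
  rw [hV]
  exact hc0

/-- An element of prime norm `c a` generating an imaginary field has absolute value `|a| ^ (1 / r)`
at infinity. This bounds the coefficients of its minimal polynomial. -/
theorem natDegree_coeff_minpoly_le (hr : r ≠ 0) (ha : Prime a) {α : L} (hα : HasPrimeNorm r a α)
    (himag : IsImaginary (IntermediateField.adjoin (RatFunc Fq) {α})) (i : ℕ) :
    ((minpoly Fq[X] α).coeff i).natDegree ≤ r * a.natDegree := by
  have hint := hα.1
  let K := IntermediateField.adjoin (RatFunc Fq) {α}
  have hfd : FiniteDimensional (RatFunc Fq) K := finiteDimensional_adjoin_of_isIntegral hint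
  have hαK : α ∈ K := IntermediateField.mem_adjoin_simple_self _ _
  have hfr : Module.finrank (RatFunc Fq) K = r := (finrank_adjoin_of_isIntegral hint).trans hα.2.1
  obtain ⟨V, hV, huniq⟩ := isImaginary_iff.1 himag
  obtain ⟨c, hc, hN⟩ := (norm_eq_iff_hasPrimeNorm ha hfr (x := ⟨α, hαK⟩) hint).2 hα
  have ha' : algebraMap Fq[X] (RatFunc Fq) a ≠ 0 := by
    rw [Ne, FaithfulSMul.algebraMap_eq_zero_iff]; exact ha.ne_zero
  -- `y = α ^ r / a` has constant norm
  let y : K := (⟨α, hαK⟩ : K) ^ r * algebraMap (RatFunc Fq) K (algebraMap Fq[X] (RatFunc Fq) a)⁻¹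
  have hNy : Algebra.norm (RatFunc Fq) y = algebraMap Fq[X] (RatFunc Fq) (C (c ^ r)) := by
    rw [map_mul, map_pow, hN, Algebra.norm_algebraMap, hfr, ← mul_pow, map_mul, mul_assoc,
      mul_inv_cancel₀ ha', mul_one, C_pow, map_pow]
  have hyV := mem_place_of_norm_eq hV huniq (pow_ne_zero r hc) hNy
  have hyint := isIntegral_of_mem_place huniq hyV
  have hyL : (y : L) = α ^ r * (algebraMap Fq[X] L a)⁻¹ := by
    rw [IsScalarTower.algebraMap_apply Fq[X] (RatFunc Fq) L, ← map_inv₀]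
    rfl
  set d := a.natDegree with hd
  have hXd : (X : Fq[X]) ^ d ≠ 0 := pow_ne_zero _ X_ne_zero
  have hXL := algebraMap_polynomial_ne_zero (L := L) hXd
  -- hence `α / T ^ d` is integral at infinity
  have hx : IsIntegral (inftyRing Fq) (α / algebraMap Fq[X] L (X ^ d)) := by
    refine IsIntegral.of_pow (Nat.pos_of_ne_zero hr) ?_
    have h1 : (algebraMap Fq[X] (RatFunc Fq) a / algebraMap Fq[X] (RatFunc Fq) (X ^ (d * r))) ∈
        inftyRing Fq := by
      refine div_mem_inftyRing_of_le (pow_ne_zero _ X_ne_zero) ?_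
      rw [natDegree_X_pow]
      exact Nat.le_mul_of_pos_right _ (Nat.pos_of_ne_zero hr)
    have h2 : IsIntegral (inftyRing Fq) (algebraMap (inftyRing Fq) L ⟨_, h1⟩) :=
      isIntegral_algebraMap
    have h3 : IsIntegral (inftyRing Fq) (y : L) :=
      hyint.map (IsScalarTower.toAlgHom (inftyRing Fq) K L)
    have h4 : (α / algebraMap Fq[X] L (X ^ d)) ^ r =
        (y : L) * algebraMap (inftyRing Fq) L ⟨_, h1⟩ := by
      have h5 : algebraMap (inftyRing Fq) L ⟨_, h1⟩ =
          algebraMap Fq[X] L a / algebraMap Fq[X] L (X ^ (d * r)) := by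
        rw [IsScalarTower.algebraMap_apply Fq[X] (RatFunc Fq) L a,
          IsScalarTower.algebraMap_apply Fq[X] (RatFunc Fq) L (X ^ (d * r)),
          ← map_div₀ (algebraMap (RatFunc Fq) L)]
        rfl
      have haL := algebraMap_polynomial_ne_zero (L := L) ha.ne_zero
      rw [h5, hyL, div_pow, ← map_pow, ← pow_mul]
      field_simp
    rw [h4]
    exact h3.mul h2
  have hxF : IsIntegral (RatFunc Fq) (α / algebraMap Fq[X] L (X ^ d)) := hx.tower_top
  have hαF : IsIntegral (RatFunc Fq) α := hint.tower_top
  have hmx := minpoly.isIntegrallyClosed_eq_field_fractions (RatFunc Fq) L hx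
  have hmα := minpoly_ratFunc hint
  have hroot : aeval α ((minpoly (RatFunc Fq) (α / algebraMap Fq[X] L (X ^ d))).scaleRoots
      (algebraMap Fq[X] (RatFunc Fq) (X ^ d))) = 0 := by
    have h1 := scaleRoots_eval₂_eq_zero (s := algebraMap Fq[X] (RatFunc Fq) (X ^ d))
      (algebraMap (RatFunc Fq) L) (minpoly.aeval (RatFunc Fq) (α / algebraMap Fq[X] L (X ^ d)))
    rwa [← IsScalarTower.algebraMap_apply, mul_div_cancel₀ _ hXL] at h1
  have heq : minpoly (RatFunc Fq) α =
      (minpoly (RatFunc Fq) (α / algebraMap Fq[X] L (X ^ d))).scaleRoots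
        (algebraMap Fq[X] (RatFunc Fq) (X ^ d)) := by
    refine (eq_of_monic_of_dvd_of_natDegree_le (minpoly.monic hαF)
      ((monic_scaleRoots_iff _).2 (minpoly.monic hxF)) (minpoly.dvd _ _ hroot) ?_).symm
    rw [natDegree_scaleRoots]
    have h1 := natDegree_le_of_dvd (minpoly.dvd _ _ (aeval_div_scaleRoots (minpoly.aeval Fq[X] α)
      (X ^ d))) ((monic_scaleRoots_iff _).2 ((minpoly.monic hint).map _)).ne_zero
    rwa [natDegree_scaleRoots, ← hmα] at h1
  rcases eq_or_ne ((minpoly Fq[X] α).coeff i) 0 with h0 | h0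
  · rw [h0, natDegree_zero]; exact Nat.zero_le _
  have h1 := congrArg (fun p => p.coeff i) heq
  simp only [coeff_scaleRoots] at h1
  rw [hmα, coeff_map] at h1
  set k := (minpoly (RatFunc Fq) (α / algebraMap Fq[X] L (X ^ d))).natDegree - i with hk
  have hkr : k ≤ r := by
    have h2 := congrArg natDegree heq
    rw [natDegree_scaleRoots, natDegree_minpoly_ratFunc hint, hα.2.1] at h2
    omega
  have hXF : algebraMap Fq[X] (RatFunc Fq) ((X ^ d) ^ k) ≠ 0 := by
    rw [Ne, FaithfulSMul.algebraMap_eq_zero_iff]; exact pow_ne_zero _ hXd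
  have h2 : algebraMap Fq[X] (RatFunc Fq) ((minpoly Fq[X] α).coeff i) /
      algebraMap Fq[X] (RatFunc Fq) ((X ^ d) ^ k) ∈ inftyRing Fq := by
    rw [h1, ← map_pow, mul_div_cancel_right₀ _ hXF]
    have h3 : minpoly (RatFunc Fq) (α / algebraMap Fq[X] L (X ^ d)) =
      (minpoly (inftyRing Fq) (α / algebraMap Fq[X] L (X ^ d))).map
        (algebraMap (inftyRing Fq) (RatFunc Fq)) := hmx
    rw [h3, coeff_map]
    exact Subtype.prop _
  rw [div_mem_inftyRing h0 (pow_ne_zero _ hXd), natDegree_pow, natDegree_X_pow] at h2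
  exact h2.trans (Nat.mul_le_mul_right _ hkr)

end Imaginary

end DrinfeldCM

namespace DrinfeldCM

/-! ### Finiteness of the set of orders representing a prime norm -/

section FiniteOrders

variable {Fq : Type*} [Field Fq] [Fintype Fq] {L : Type*} [Field L]
  [Algebra Fq[X] L] [Algebra (RatFunc Fq) L] [IsScalarTower Fq[X] (RatFunc Fq) L]
  {r : ℕ} {a : Fq[X]}

variable (Fq) in
theorem finite_setOf_natDegree_le (r M : ℕ) :
    {p : Fq[X][X] | p.natDegree ≤ r ∧ ∀ i, (p.coeff i).natDegree ≤ M}.Finite := by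
  refine Set.Finite.of_injOn (t := Set.univ) (f := fun p : Fq[X][X] =>
    fun (i : Fin (r + 1)) (j : Fin (M + 1)) => (p.coeff i).coeff j) (Set.mapsTo_univ _ _) ?_
    Set.finite_univ
  rintro p ⟨hp, hpM⟩ p' ⟨hp', hpM'⟩ h
  ext i j
  rcases lt_or_ge r i with hi | hi
  · rw [coeff_eq_zero_of_natDegree_lt (hp.trans_lt hi),
      coeff_eq_zero_of_natDegree_lt (hp'.trans_lt hi)]
  rcases lt_or_ge M j with hj | hj
  · rw [coeff_eq_zero_of_natDegree_lt ((hpM i).trans_lt hj),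
      coeff_eq_zero_of_natDegree_lt ((hpM' i).trans_lt hj)]
  · exact congrFun (congrFun h ⟨i, Nat.lt_succ_of_le hi⟩) ⟨j, Nat.lt_succ_of_le hj⟩

variable (L) in
/-- There are finitely many elements of prime norm generating an imaginary field of degree `r`. -/
theorem finite_setOf_hasPrimeNorm (hr : r ≠ 0) (ha : Prime a) :
    {α : L | HasPrimeNorm r a α ∧
      IsImaginary (IntermediateField.adjoin (RatFunc Fq) {α})}.Finite := by
  refine ((finite_setOf_natDegree_le Fq r (r * a.natDegree)).biUnion
    (t := fun p => (p.rootSet L)) fun p _ => rootSet_finite p L).subset ?_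
  rintro α ⟨hα, himag⟩
  refine Set.mem_biUnion (x := minpoly Fq[X] α) ⟨hα.2.1.le,
    natDegree_coeff_minpoly_le hr ha hα himag⟩ ?_
  have := faithfulSMul_polynomial Fq L
  exact (mem_rootSet_of_ne (minpoly.monic hα.1).ne_zero).2 (minpoly.aeval _ _)

/-- The integral closure of `Fq[T]` in an intermediate field. -/
def integralElements (K : IntermediateField (RatFunc Fq) L) : Subalgebra Fq[X] L :=
  integralClosure Fq[X] L ⊓ K.toSubalgebra.restrictScalars Fq[X]

/-- If every element of a finite algebra `B` has a nonzero multiplier into `A`, there is a common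
nonzero multiplier. -/
theorem exists_smul_mem {A B : Subalgebra Fq[X] L} (hB : Module.Finite Fq[X] B)
    (h : ∀ β ∈ B, ∃ b : Fq[X], b ≠ 0 ∧ b • β ∈ A) :
    ∃ c : Fq[X], c ≠ 0 ∧ ∀ β ∈ B, c • β ∈ A := by
  obtain ⟨S, hS⟩ := Module.Finite.fg_top (R := Fq[X]) (M := B)
  choose! b hb hbA using h
  refine ⟨∏ s ∈ S, b s, Finset.prod_ne_zero_iff.2 fun s _ => hb s s.2, fun β hβ => ?_⟩
  have h1 : (⟨β, hβ⟩ : B) ∈ Submodule.span Fq[X] (S : Set B) := by rw [hS]; trivial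
  have h2 : ∀ z : B, z ∈ Submodule.span Fq[X] (S : Set B) → (∏ s ∈ S, b s) • (z : L) ∈ A := by
    intro z hz
    induction hz using Submodule.span_induction with
    | mem z hz =>
      have h3 : b z ∣ ∏ s ∈ S, b s := Finset.dvd_prod_of_mem (fun s : B => b s) hz
      obtain ⟨e, he⟩ := h3
      rw [he, mul_comm, mul_smul]
      exact A.smul_mem (hbA z z.2) e
    | zero => rw [ZeroMemClass.coe_zero, smul_zero]; exact zero_mem _
    | add x y _ _ hx hy => rw [AddMemClass.coe_add, smul_add]; exact add_mem hx hy
    | smul e x _ hx =>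
      rw [SetLike.val_smul, smul_comm]
      exact A.smul_mem hx e
  exact h2 ⟨β, hβ⟩ h1

/-- There are finitely many orders with a given field of fractions that contain a given generator
of this field. -/
theorem finite_setOf_order {α : L} (hint : IsIntegral Fq[X] α) :
    {O : Subalgebra Fq[X] L | Module.Finite Fq[X] O ∧ α ∈ O ∧
      fracField O = IntermediateField.adjoin (RatFunc Fq) {α}}.Finite := by
  set K := IntermediateField.adjoin (RatFunc Fq) {α} with hK
  have hfd : FiniteDimensional (RatFunc Fq) K := finiteDimensional_adjoin_of_isIntegral hint
  let B := integralElements K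
  have hB : Module.Finite Fq[X] B := finite_of_forall_isIntegral (fun β hβ => hβ.1)
    (K := K) fun β hβ => hβ.2
  let A := Algebra.adjoin Fq[X] {α}
  have hAint : ∀ β ∈ A, IsIntegral Fq[X] β := fun β hβ =>
    (Algebra.adjoin_le (S := integralClosure Fq[X] L) (Set.singleton_subset_iff.2 hint) : A ≤ _) hβ
  have hAK : K ≤ fracField A := IntermediateField.adjoin_simple_le_iff.2
    (IntermediateField.subset_adjoin _ _ (Algebra.self_mem_adjoin_singleton _ α))
  obtain ⟨c, hc, hcB⟩ := exists_smul_mem (A := A) hB fun β hβ => by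
    obtain ⟨γ, hγ, b, hb, h⟩ := (mem_fracField_iff hAint).1 (hAK hβ.2)
    refine ⟨b, hb, ?_⟩
    rwa [h, Algebra.smul_def, mul_div_cancel₀ _ (algebraMap_polynomial_ne_zero hb)]
  -- since `c B ⊆ Fq[T][α] ⊆ O ⊆ B`, an order is determined by its image in the finite set `B / c B`
  have hQ := finite_quotient_smul_top (M := B) hc
  refine Set.Finite.of_injOn (t := Set.univ) (f := fun O : Subalgebra Fq[X] L =>
    Submodule.Quotient.mk (p := Ideal.span {c} • (⊤ : Submodule Fq[X] B)) '' {x : B | (x : L) ∈ O})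
    (Set.mapsTo_univ _ _) ?_ Set.finite_univ
  have key : ∀ O O' : Subalgebra Fq[X] L, Module.Finite Fq[X] O →
      fracField O = K → α ∈ O' →
      Submodule.Quotient.mk (p := Ideal.span {c} • (⊤ : Submodule Fq[X] B)) ''
          {x : B | (x : L) ∈ O} =
        Submodule.Quotient.mk (p := Ideal.span {c} • (⊤ : Submodule Fq[X] B)) ''
          {x : B | (x : L) ∈ O'} → O ≤ O' := by
    intro O O' hO hOK hα' h x hx
    have hxB : x ∈ B := ⟨isIntegral_of_mem_order hO hx, by
      rw [← hOK]; exact IntermediateField.subset_adjoin _ _ hx⟩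
    obtain ⟨x', hx', hxx'⟩ := h.le ⟨(⟨x, hxB⟩ : B), hx, rfl⟩
    obtain ⟨y, hy⟩ := mem_span_singleton_smul_top.1 ((Submodule.Quotient.eq _).1 hxx')
    have h1 : x = (x' : L) - c • (y : L) := by
      have h2 := congrArg (fun z : B => (z : L)) hy
      simp only [AddSubgroupClass.coe_sub, SetLike.val_smul] at h2
      rw [← h2, sub_sub_cancel]
    rw [h1]
    exact sub_mem hx' ((Algebra.adjoin_le (S := O') (Set.singleton_subset_iff.2 hα') : A ≤ O')
      (hcB y y.2))
  rintro O ⟨hO, hαO, hOK⟩ O' ⟨hO', hαO', hOK'⟩ h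
  exact le_antisymm (key O O' hO hOK hαO' h) (key O' O hO' hOK' hαO h.symm)

theorem exists_hasPrimeNorm_of_gammaExp_ne_zero {O : Subalgebra Fq[X] L} (hr : 2 ≤ r)
    (hO : IsImaginaryOrder r O) (ha : Prime a) (h : gammaExp O a ≠ 0) :
    ∃ u : O, HasPrimeNorm r a (u : L) := by
  obtain ⟨_, hx⟩ := Set.nonempty_of_ncard_ne_zero h
  rw [normClasses_eq hr hO ha] at hx
  obtain ⟨u, hu, -⟩ := hx
  exact ⟨u, hu⟩

variable (L) in
/-- Finitely many imaginary orders contain an element of norm `c a`. -/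
theorem finite_setOf_gammaExp_ne_zero (hr : 2 ≤ r) (ha : Prime a) :
    {O : Subalgebra Fq[X] L | IsImaginaryOrder r O ∧ gammaExp O a ≠ 0}.Finite := by
  refine ((finite_setOf_hasPrimeNorm L (r := r) (by omega) ha).biUnion
    (t := fun α => {O : Subalgebra Fq[X] L | Module.Finite Fq[X] O ∧ α ∈ O ∧
      fracField O = IntermediateField.adjoin (RatFunc Fq) {α}})
    fun α hα => finite_setOf_order hα.1.1).subset ?_
  rintro O ⟨hO, hγ⟩
  obtain ⟨u, hu⟩ := exists_hasPrimeNorm_of_gammaExp_ne_zero hr hO ha hγ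
  have hfd : FiniteDimensional (RatFunc Fq) (fracField O) :=
    FiniteDimensional.of_finrank_pos (by rw [hO.finrank_eq]; omega)
  have hle : IntermediateField.adjoin (RatFunc Fq) {(u : L)} ≤ fracField O :=
    IntermediateField.adjoin_simple_le_iff.2 (IntermediateField.subset_adjoin _ _ u.2)
  have heq := IntermediateField.eq_of_le_of_finrank_eq hle
    (by rw [hO.finrank_eq, finrank_adjoin_of_isIntegral hu.1, hu.2.1])
  exact Set.mem_biUnion (x := (u : L)) ⟨hu, by rw [heq]; exact hO.imaginary⟩
    ⟨hO.finite, u.2, heq.symm⟩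

end FiniteOrders

end DrinfeldCM

namespace DrinfeldCM

/-! ### Self-isogenies of a fixed Drinfeld module -/

open TwistedPoly DrinfeldModule

variable {Fq : Type*} [Field Fq] [Fintype Fq] {L : Type*} [Field L] [Algebra Fq L]
  [Algebra Fq[X] L] [Algebra (RatFunc Fq) L] [IsScalarTower Fq Fq[X] L]
  [IsScalarTower Fq[X] (RatFunc Fq) L] {r : ℕ} {a : Fq[X]}

theorem mk_mem_cmClasses_iff (φ : DrinfeldModule Fq L r) (O : Subalgebra Fq[X] L) :
    (Quotient.mk _ φ : IsomClass Fq L r) ∈ cmClasses r O ↔ Nonempty (φ.endImage ≃ₐ[Fq[X]] O) := by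
  have := faithfulSMul_polynomial Fq L
  constructor
  · rintro ⟨ψ, h, ⟨e⟩⟩
    rw [← endImage_eq_of_mk_eq h]
    exact ⟨ψ.endEquiv.symm.trans e⟩
  · rintro ⟨e⟩
    exact ⟨φ, rfl, ⟨φ.endEquiv.trans e⟩⟩

namespace CyclicSelfIsogeny

theorem f_ne_zero (s : CyclicSelfIsogeny Fq L r a) : s.f ≠ 0 := by
  intro h
  have h1 := s.monic
  rw [h, poly_zero] at h1
  exact h1.ne_zero rfl

theorem commute (s : CyclicSelfIsogeny Fq L r a) : s.f * s.φ.t = s.φ.t * s.f :=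
  isMorphism_iff.1 s.isMorphism

theorem tc_zero_mem (s : CyclicSelfIsogeny Fq L r a) : s.f.tc 0 ∈ s.φ.endImage :=
  mem_endImage.2 ⟨s.f, s.commute, rfl⟩

/-- The derivatives of equivalent self-isogenies differ by the derivative of an automorphism. -/
theorem exists_unit_of_equiv {s s' : CyclicSelfIsogeny Fq L r a} (h : s ≈ s') :
    ∃ w ∈ s.φ.endImage, ∃ w' ∈ s.φ.endImage, w * w' = 1 ∧ s'.f.tc 0 = s.f.tc 0 * w := by
  obtain ⟨c, d, hc, hd, h⟩ := h
  have hcd : s.φ.IsMorphism s.φ (d * c⁻¹ : (TwistedPoly Fq L)ˣ) := by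
    rw [Units.val_mul]; exact hd.mul hc.inv
  have hdc : s.φ.IsMorphism s.φ (c * d⁻¹ : (TwistedPoly Fq L)ˣ) := by
    rw [Units.val_mul]; exact hc.mul hd.inv
  refine ⟨_, mem_endImage.2 ⟨_, isMorphism_iff.1 hcd, rfl⟩, _,
    mem_endImage.2 ⟨_, isMorphism_iff.1 hdc, rfl⟩, ?_, ?_⟩
  · rw [← d0_apply, ← d0_apply, ← map_mul, ← Units.val_mul]
    simp
  · rw [h, ← d0_apply, ← d0_apply, ← d0_apply, Units.val_mul, map_mul, map_mul, map_mul]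
    ring

/-- Conversely, self-isogenies of isomorphic Drinfeld modules are equivalent if their derivatives
differ by a unit of the endomorphism ring. -/
theorem equiv_of_tc_zero {s s' : CyclicSelfIsogeny Fq L r a}
    (hφ : (Quotient.mk _ s'.φ : IsomClass Fq L r) = Quotient.mk _ s.φ) {w w' : L}
    (hw : w ∈ s.φ.endImage) (hw' : w' ∈ s.φ.endImage) (hww : w * w' = 1)
    (h : s'.f.tc 0 = s.f.tc 0 * w) : s ≈ s' := by
  have := faithfulSMul_polynomial Fq L
  obtain ⟨c, hc⟩ := Quotient.eq.1 hφ
  obtain ⟨u, hu, rfl⟩ := mem_endImage.1 hw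
  obtain ⟨v, hv, rfl⟩ := mem_endImage.1 hw'
  have huv : u * v = 1 := s.φ.eq_of_tc_zero_eq (Commute.mul_left (show Commute u s.φ.t from hu) hv)
    (by rw [one_mul, mul_one]) (by rw [← d0_apply, ← d0_apply, map_mul, map_one]; exact hww)
  have hvu : v * u = 1 := by rw [s.φ.commute_of_mem_endRing hv hu, huv]
  let e : (TwistedPoly Fq L)ˣ := ⟨u, v, huv, hvu⟩
  have he : s.φ.IsMorphism s.φ e := isMorphism_iff.2 hu
  have hd : s'.φ.IsMorphism s.φ (e * c : (TwistedPoly Fq L)ˣ) := by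
    rw [Units.val_mul]; exact he.mul hc
  refine ⟨c, e * c, hc, hd, s'.φ.eq_of_tc_zero_eq s'.commute
    (isMorphism_iff.1 ((hc.inv.mul s.isMorphism).mul hd)) ?_⟩
  have h1 : d0 ((c⁻¹ : (TwistedPoly Fq L)ˣ) : TwistedPoly Fq L) *
      d0 (c : TwistedPoly Fq L) = 1 := by
    rw [← map_mul, ← Units.val_mul]; simp
  rw [h, Units.val_mul, ← d0_apply (_ * _), map_mul, map_mul, map_mul, d0_apply, d0_apply]
  change s.f.tc 0 * u.tc 0 = d0 ((c⁻¹ : (TwistedPoly Fq L)ˣ) : TwistedPoly Fq L) * s.f.tc 0 *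
    (u.tc 0 * d0 (c : TwistedPoly Fq L))
  linear_combination (-s.f.tc 0 * u.tc 0) * h1

variable [IsAlgClosed L]

theorem hasPrimeNorm (s : CyclicSelfIsogeny Fq L r a) (hr : 2 ≤ r) (ha : a.Monic)
    (hprime : (Ideal.span {a}).IsPrime) : HasPrimeNorm r a (s.f.tc 0) :=
  hasPrimeNorm_of_ker_equiv (by omega) s.isMorphism s.f_ne_zero ha hprime s.cyclic.some

theorem isImaginaryOrder (s : CyclicSelfIsogeny Fq L r a) (hr : 2 ≤ r) (ha : a.Monic)
    (hprime : (Ideal.span {a}).IsPrime) : IsImaginaryOrder r s.φ.endImage :=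
  (isImaginaryOrder_endImage s.φ (by omega) s.tc_zero_mem (s.hasPrimeNorm hr ha hprime).2.1).2

/-- An endomorphism whose derivative has norm `c a` is conjugate to a monic self-isogeny. -/
theorem exists_of_hasPrimeNorm (hr : 2 ≤ r) (ha : a.Monic) (hprime : (Ideal.span {a}).IsPrime)
    (φ : DrinfeldModule Fq L r) {α : L} (hα : α ∈ φ.endImage) (h : HasPrimeNorm r a α) :
    ∃ s : CyclicSelfIsogeny Fq L r a, (Quotient.mk _ s.φ : IsomClass Fq L r) = Quotient.mk _ φ ∧
      s.f.tc 0 = α := by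
  have := faithfulSMul_polynomial Fq L
  obtain ⟨u, hu, rfl⟩ := mem_endImage.1 hα
  obtain ⟨hap, hd0⟩ := prime_of_isPrime_span ha hprime
  have hu0 : u ≠ 0 := by
    rintro rfl
    have h1 := h.2.2
    rw [tc_zero] at h1
    obtain ⟨c, hc, h1⟩ := h1
    have h2 := minpoly.aeval Fq[X] (0 : L)
    rw [← coeff_zero_eq_aeval_zero', h1, FaithfulSMul.algebraMap_eq_zero_iff] at h2
    exact mul_ne_zero (C_ne_zero.2 hc) ha.ne_zero h2
  have hdeg : u.tdeg = a.natDegree := by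
    obtain ⟨e⟩ := ker_equiv_of_hasPrimeNorm (by omega) (isMorphism_iff.2 hu) ha hprime h
    exact tdeg_eq_natDegree_of_ker_equiv (isMorphism_iff.2 hu) hu0 ha e
  have hq : 0 < Fintype.card Fq ^ u.tdeg - 1 := by
    have := Nat.one_lt_pow (hdeg ▸ hd0) (one_lt_q (Fq := Fq))
    omega
  -- the constant `c` is chosen such that the leading coefficient of `c⁻¹ u c` is `1`
  obtain ⟨c, hc⟩ := IsAlgClosed.exists_pow_nat_eq (u.tc u.tdeg)⁻¹ hq
  have hlead := tc_tdeg_ne_zero hu0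
  have hc0 : c ≠ 0 := by
    rintro rfl
    rw [zero_pow hq.ne'] at hc
    exact inv_ne_zero hlead hc.symm
  have hmor : (φ.scaled c hc0).IsMorphism (φ.scaled c hc0) (scale c u) :=
    isMorphism_iff.2 (scale_commute hc0 (t_scaled φ c hc0) hu)
  have htc := tc_zero_scale hc0 u
  refine ⟨⟨φ.scaled c hc0, scale c u, hmor, ?_, ker_equiv_of_hasPrimeNorm (by omega) hmor ha hprime
    (by rwa [htc])⟩, mk_scaled φ c hc0, htc⟩
  have h0 : scale c u ≠ 0 := by
    intro h0
    have h1 := congrArg (fun f => f.tc u.tdeg) h0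
    simp only [tc_zero] at h1
    rw [tc_scale' hc0] at h1
    exact mul_ne_zero hlead (pow_ne_zero _ hc0) h1
  rw [Monic, ← tc_tdeg_eq_leadingCoeff h0, tdeg_scale hc0, tc_scale' hc0, hc,
    mul_inv_cancel₀ hlead]

end CyclicSelfIsogeny

theorem baseClass_mk (s : CyclicSelfIsogeny Fq L r a) :
    baseClass Fq L (Quotient.mk _ s : CyclicSelfIsogenyClass Fq L r a) = Quotient.mk _ s.φ := rfl

variable [IsAlgClosed L]

open Classical in
/-- The classes of self-isogenies of a Drinfeld module `φ` correspond, by the derivative, to the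
classes of elements of norm `c a` in its endomorphism ring. -/
theorem finite_and_ncard_fibre (hr : 2 ≤ r) (ha : a.Monic) (hprime : (Ideal.span {a}).IsPrime)
    (φ : DrinfeldModule Fq L r) (hφ : IsImaginaryOrder r φ.endImage) :
    {S : CyclicSelfIsogenyClass Fq L r a | baseClass Fq L S = Quotient.mk _ φ}.Finite ∧
    {S : CyclicSelfIsogenyClass Fq L r a | baseClass Fq L S = Quotient.mk _ φ}.ncard =
      gammaExp φ.endImage a := by
  have hap := (prime_of_isPrime_span ha hprime).1
  -- outside of the fibre over the class of `φ` the value of `f` is irrelevant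
  let f : CyclicSelfIsogenyClass Fq L r a → Associates φ.endImage := fun S =>
    if h : S.out.f.tc 0 ∈ φ.endImage then Associates.mk ⟨S.out.f.tc 0, h⟩ else 1
  have hout : ∀ S : CyclicSelfIsogenyClass Fq L r a,
      baseClass Fq L S = Quotient.mk _ S.out.φ := fun S => by
    rw [← baseClass_mk, Quotient.out_eq]
  have hbij : Set.BijOn f {S | baseClass Fq L S = Quotient.mk _ φ} (normClasses φ.endImage a) := by
    rw [normClasses_eq hr hφ hap]
    have hf : ∀ S : CyclicSelfIsogenyClass Fq L r a, baseClass Fq L S = Quotient.mk _ φ →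
        ∃ h : S.out.f.tc 0 ∈ φ.endImage, f S = Associates.mk ⟨S.out.f.tc 0, h⟩ := by
      intro S hS
      have h : S.out.f.tc 0 ∈ φ.endImage := by
        rw [← endImage_eq_of_mk_eq ((hout S).symm.trans hS)]
        exact S.out.tc_zero_mem
      exact ⟨h, dif_pos h⟩
    refine ⟨fun S hS => ?_, fun S hS S' hS' hSS => ?_, ?_⟩
    · obtain ⟨h, hfS⟩ := hf S hS
      exact ⟨⟨_, h⟩, S.out.hasPrimeNorm hr ha hprime, hfS.symm⟩
    · obtain ⟨h, hfS⟩ := hf S hS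
      obtain ⟨h', hfS'⟩ := hf S' hS'
      rw [hfS, hfS', Associates.mk_eq_mk_iff_associated] at hSS
      obtain ⟨w, hw⟩ := hSS
      have hO := endImage_eq_of_mk_eq ((hout S).symm.trans hS)
      rw [← Quotient.out_eq S, ← Quotient.out_eq S']
      refine Quotient.sound (CyclicSelfIsogeny.equiv_of_tc_zero
        ((hout S').symm.trans ((hS'.trans hS.symm).trans (hout S)))
        (w := ((w : φ.endImage) : L)) (w' := ((w⁻¹ : φ.endImageˣ) : φ.endImage)) ?_ ?_ ?_ ?_)
      · rw [hO]; exact Subtype.prop _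
      · rw [hO]; exact Subtype.prop _
      · exact congrArg Subtype.val w.mul_inv
      · exact (congrArg Subtype.val hw).symm
    · rintro _ ⟨u, hu, rfl⟩
      obtain ⟨s, hs, hsu⟩ := CyclicSelfIsogeny.exists_of_hasPrimeNorm hr ha hprime φ u.2 hu
      refine ⟨Quotient.mk _ s, hs, ?_⟩
      obtain ⟨h, hfS⟩ := hf (Quotient.mk _ s) hs
      rw [hfS, Associates.mk_eq_mk_iff_associated]
      have hO := endImage_eq_of_mk_eq hs
      obtain ⟨w, hw, w', hw', hww, hα⟩ := CyclicSelfIsogeny.exists_unit_of_equiv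
        (Setoid.symm (Quotient.mk_out s))
      rw [hO] at hw hw'
      refine Associated.symm ⟨⟨⟨w, hw⟩, ⟨w', hw'⟩, Subtype.ext hww,
        Subtype.ext ((mul_comm _ _).trans hww)⟩, Subtype.ext ?_⟩
      refine Eq.trans ?_ hα.symm
      rw [hsu]; rfl
  refine ⟨hbij.finite_iff_finite.2 (finite_normClasses hr hφ hap), ?_⟩
  rw [gammaExp, ← hbij.image_eq, hbij.injOn.ncard_image]

variable (Fq L) in
theorem finite_cyclicSelfIsogenyClass (hr : 2 ≤ r) (ha : a.Monic)
    (hprime : (Ideal.span {a}).IsPrime) : Finite (CyclicSelfIsogenyClass Fq L r a) := by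
  have hap := (prime_of_isPrime_span ha hprime).1
  -- finitely many derivatives, and finitely many base classes for each of them
  have h1 : (Set.range
      (baseClass Fq L : CyclicSelfIsogenyClass Fq L r a → IsomClass Fq L r)).Finite := by
    refine ((finite_setOf_hasPrimeNorm L (r := r) (by omega) hap).biUnion
      (t := fun α => {x : IsomClass Fq L r | ∃ φ : DrinfeldModule Fq L r, Quotient.mk _ φ = x ∧
        ∃ u : TwistedPoly Fq L, u * φ.t = φ.t * u ∧ u.tc 0 = α ∧ u.tdeg ≤ a.natDegree})
      fun α hα => finite_isomClass (by omega) hα.1.1 hα.1.2.1 _).subset ?_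
    rintro _ ⟨S, rfl⟩
    induction S using Quotient.inductionOn with
    | _ s =>
    have hs := s.hasPrimeNorm hr ha hprime
    have hO := isImaginaryOrder_endImage s.φ (by omega) s.tc_zero_mem hs.2.1
    refine Set.mem_biUnion (x := s.f.tc 0) ⟨hs, by rw [← hO.1]; exact hO.2.imaginary⟩
      ⟨s.φ, rfl, s.f, s.commute, rfl, ?_⟩
    exact (tdeg_eq_natDegree_of_ker_equiv s.isMorphism s.f_ne_zero ha s.cyclic.some).le
  rw [← Set.finite_univ_iff]
  refine (h1.biUnion (t := fun x => {S : CyclicSelfIsogenyClass Fq L r a | baseClass Fq L S = x})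
    ?_).subset fun S _ => Set.mem_biUnion (x := baseClass Fq L S) ⟨S, rfl⟩ rfl
  rintro _ ⟨S, rfl⟩
  induction S using Quotient.inductionOn with
  | _ s => exact (finite_and_ncard_fibre hr ha hprime s.φ (s.isImaginaryOrder hr ha hprime)).1

end DrinfeldCM

namespace DrinfeldCM

/-! ### The product formula -/

open TwistedPoly DrinfeldModule

theorem finprod_mem_const_eq {α M : Type*} [CommMonoid M] {s : Set α} (hs : s.Finite) (b : M) :
    ∏ᶠ x ∈ s, b = b ^ s.ncard := by
  rw [finprod_mem_eq_finite_toFinset_prod _ hs, Finset.prod_const, Set.ncard_eq_toFinset_card _ hs]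

variable {Fq : Type*} [Field Fq] [Fintype Fq] {L : Type*} [Field L] [Algebra Fq L]
  [Algebra Fq[X] L] [Algebra (RatFunc Fq) L] [IsScalarTower Fq Fq[X] L]
  [IsScalarTower Fq[X] (RatFunc Fq) L] [IsAlgClosed L] {r : ℕ} {a : Fq[X]}

/-- If an order with nonzero exponent is the endomorphism ring of `φ`, then the image of this ring
in `L` is an imaginary order with the same exponent. -/
theorem isImaginaryOrder_of_mem_cmClasses (hr : 2 ≤ r) (ha : Prime a) {O : Subalgebra Fq[X] L}
    (hO : IsImaginaryOrder r O) (hγ : gammaExp O a ≠ 0) {φ : DrinfeldModule Fq L r}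
    (h : (Quotient.mk _ φ : IsomClass Fq L r) ∈ cmClasses r O) :
    IsImaginaryOrder r φ.endImage ∧ gammaExp φ.endImage a = gammaExp O a := by
  obtain ⟨e⟩ := (mk_mem_cmClasses_iff φ O).1 h
  obtain ⟨u, hu⟩ := exists_hasPrimeNorm_of_gammaExp_ne_zero hr hO ha hγ
  have hu' := hasPrimeNorm_algEquiv e.symm hu
  have him := (isImaginaryOrder_endImage φ (by omega) (e.symm u).2 hu'.2.1).2
  exact ⟨him, gammaExp_eq_of_algEquiv hr him hO ha e⟩

/-- The modular polynomial is the product of the class polynomials: the classes of self-isogenies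
are sorted by the endomorphism ring of the underlying Drinfeld module. -/
theorem modularPoly_eq_finprod (hr : 2 ≤ r) (ha : a.Monic) (hprime : (Ideal.span {a}).IsPrime)
    {δ : ℕ → ℕ} (hδ : IsBasicExponent (Fintype.card Fq) r δ) {R : Set (Subalgebra Fq[X] L)}
    (hR : IsOrderReps r R) :
    {O ∈ R | gammaExp O a ≠ 0}.Finite ∧
      modularPoly Fq L hδ a = ∏ᶠ O ∈ R, hilbertClassPoly hδ O ^ gammaExp O a := by
  have hap := (prime_of_isPrime_span ha hprime).1
  have hfinR : {O ∈ R | gammaExp O a ≠ 0}.Finite :=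
    (finite_setOf_gammaExp_ne_zero L hr hap).subset fun O hO => ⟨hR.1 O hO.1, hO.2⟩
  refine ⟨hfinR, ?_⟩
  have hfin := finite_cyclicSelfIsogenyClass Fq L hr ha hprime
  set R' := {O ∈ R | gammaExp O a ≠ 0} with hR'
  let F : IsomClass Fq L r → L[X] := fun x => X - C (jClass Fq L hδ x)
  have h1 : ∏ᶠ O ∈ R, hilbertClassPoly hδ O ^ gammaExp O a =
      ∏ᶠ O ∈ R', hilbertClassPoly hδ O ^ gammaExp O a := by
    refine finprod_mem_inter_mulSupport_eq' _ _ _ fun O hO => ?_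
    refine ⟨fun h => ⟨h, fun h0 => hO ?_⟩, fun h => h.1⟩
    change hilbertClassPoly hδ O ^ gammaExp O a = 1
    rw [h0, pow_zero]
  -- every class of pairs lies over exactly one order in `R'`
  have hunion : (Set.univ : Set (CyclicSelfIsogenyClass Fq L r a)) =
      ⋃ O ∈ R', {S | baseClass Fq L S ∈ cmClasses r O} := by
    symm
    rw [Set.eq_univ_iff_forall]
    intro S
    induction S using Quotient.inductionOn with
    | _ s =>
    have hO := s.isImaginaryOrder hr ha hprime
    obtain ⟨O', ⟨hO'R, ⟨e⟩⟩, -⟩ := hR.2 _ hO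
    have hγ := gammaExp_eq_of_algEquiv hr hO (hR.1 _ hO'R) hap e
    have hfib := finite_and_ncard_fibre hr ha hprime s.φ hO
    refine Set.mem_biUnion (x := O') ⟨hO'R, ?_⟩ ((mk_mem_cmClasses_iff s.φ O').2 ⟨e⟩)
    rw [← hγ, ← hfib.2]
    exact (Set.ncard_pos hfib.1).2 ⟨Quotient.mk _ s, rfl⟩ |>.ne'
  have hdisj : R'.PairwiseDisjoint fun O =>
      {S : CyclicSelfIsogenyClass Fq L r a | baseClass Fq L S ∈ cmClasses r O} := by
    intro O hO O' hO' hne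
    refine Set.disjoint_left.2 fun S hS hS' => hne ?_
    induction S using Quotient.inductionOn with
    | _ s =>
    obtain ⟨e⟩ := (mk_mem_cmClasses_iff s.φ O).1 hS
    obtain ⟨e'⟩ := (mk_mem_cmClasses_iff s.φ O').1 hS'
    exact (hR.2 _ (s.isImaginaryOrder hr ha hprime)).unique ⟨hO.1, ⟨e⟩⟩ ⟨hO'.1, ⟨e'⟩⟩
  rw [h1, modularPoly, ← finprod_mem_univ, hunion,
    finprod_mem_biUnion hdisj hfinR fun _ _ => Set.toFinite _]
  refine finprod_mem_congr rfl fun O hO => ?_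
  have hcm := finite_cmClasses (by omega) (hR.1 O hO.1)
  -- the factors belonging to `O` are grouped by the class of the underlying Drinfeld module
  have hpre : {S : CyclicSelfIsogenyClass Fq L r a | baseClass Fq L S ∈ cmClasses r O} =
      ⋃ x ∈ cmClasses r O, {S | baseClass Fq L S = x} := by
    ext S
    simp
  rw [hpre, finprod_mem_biUnion (fun x _ y _ hne => Set.disjoint_left.2 fun S hS hS' =>
    hne (hS.symm.trans hS')) hcm fun _ _ => Set.toFinite _]
  refine Eq.trans ?_ ((powMonoidHom (gammaExp O a)).map_finprod_mem F hcm).symm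
  refine finprod_mem_congr rfl fun x hx => ?_
  rw [finprod_mem_congr rfl (g := fun _ => F x) fun S hS => by
    rw [show baseClass Fq L S = x from hS], finprod_mem_const_eq (Set.toFinite _)]
  congr 1
  induction x using Quotient.inductionOn with
  | _ φ =>
  obtain ⟨him, hγ⟩ := isImaginaryOrder_of_mem_cmClasses hr hap (hR.1 O hO.1) hO.2 hx
  rw [← hγ, (finite_and_ncard_fibre hr ha hprime φ him).2]

end DrinfeldCM

namespace DrinfeldCM

/-! ### Integrality and Galois invariance of the modular polynomial -/

open TwistedPoly DrinfeldModule

namespace TwistedPoly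

variable {Fq : Type*} [Field Fq] [Fintype Fq] {L : Type*} [Field L] [Algebra Fq L]

/-- A ring homomorphism acts on twisted polynomials through the coefficients. -/
def conj (τ : L →+* L) : TwistedPoly Fq L →+* TwistedPoly Fq L where
  toFun f := ⟨f.poly.map τ, by
    obtain ⟨N, hN⟩ := f.exists_tc_eq_zero
    have h : f.poly = ∑ i ∈ Finset.range N, C (f.tc i) * X ^ (Fintype.card Fq ^ i) := by
      conv_lhs => rw [eq_sum_mono f hN]
      exact map_sum (Submodule.subtype (qPolynomials Fq L)) _ _
    rw [h, Polynomial.map_sum]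
    refine Submodule.sum_mem _ fun i _ => ?_
    rw [Polynomial.map_mul, Polynomial.map_pow, map_C, map_X]
    exact monomial_mem _ i⟩
  map_one' := TwistedPoly.ext (by change (X : L[X]).map τ = X; simp)
  map_mul' f g := TwistedPoly.ext (Polynomial.map_comp τ f.poly g.poly)
  map_zero' := TwistedPoly.ext (Polynomial.map_zero τ)
  map_add' f g := TwistedPoly.ext (Polynomial.map_add τ)

theorem poly_conj (τ : L →+* L) (f : TwistedPoly Fq L) : (conj τ f).poly = f.poly.map τ := rfl

@[simp] theorem tc_conj (τ : L →+* L) (f : TwistedPoly Fq L) (i : ℕ) :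
    (conj τ f).tc i = τ (f.tc i) := coeff_map _ _

theorem tdeg_conj (τ : L →+* L) (f : TwistedPoly Fq L) : (conj τ f).tdeg = f.tdeg := by
  rw [tdeg, poly_conj, natDegree_map, ← tdeg]

end TwistedPoly

section Conj

variable {Fq : Type*} [Field Fq] [Fintype Fq] {L : Type*} [Field L] [Algebra Fq L]
  [Algebra Fq[X] L] [Algebra (RatFunc Fq) L] [IsScalarTower Fq Fq[X] L]
  [IsScalarTower Fq[X] (RatFunc Fq) L] {r : ℕ} {a : Fq[X]}

/-- The Drinfeld module `φ` with an automorphism of `L` applied to all coefficients. -/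
def DrinfeldModule.conj (τ : L ≃ₐ[Fq[X]] L) (φ : DrinfeldModule Fq L r) : DrinfeldModule Fq L r :=
  ofTwisted (TwistedPoly.conj (τ : L →+* L) φ.t)
    (by rw [tc_conj, φ.tc_t_zero]; exact τ.commutes X)
    (fun h => by
      have h1 := congrArg (fun f => f.tc r) h
      simp only [tc_zero, tc_conj, RingHom.coe_coe, map_eq_zero] at h1
      have h2 := tc_tdeg_ne_zero φ.t_ne_zero
      rw [φ.tdeg_t] at h2
      exact h2 h1)
    (by rw [tdeg_conj, φ.tdeg_t])

theorem DrinfeldModule.t_conj (τ : L ≃ₐ[Fq[X]] L) (φ : DrinfeldModule Fq L r) :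
    (φ.conj τ).t = TwistedPoly.conj (τ : L →+* L) φ.t := t_ofTwisted _ _ _ _

theorem DrinfeldModule.IsMorphism.conj (τ : L ≃ₐ[Fq[X]] L) {φ ψ : DrinfeldModule Fq L r}
    {u : TwistedPoly Fq L} (h : φ.IsMorphism ψ u) :
    (φ.conj τ).IsMorphism (ψ.conj τ) (TwistedPoly.conj (τ : L →+* L) u) := by
  rw [isMorphism_iff, t_conj, t_conj, ← map_mul, ← map_mul, isMorphism_iff.1 h]

theorem DrinfeldModule.J_conj (δ : ℕ → ℕ) (τ : L ≃ₐ[Fq[X]] L) (φ : DrinfeldModule Fq L r) :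
    (φ.conj τ).J δ = τ (φ.J δ) := by
  rw [J, J, map_div₀, map_prod, map_pow]
  simp only [g_eq_tc, t_conj, tc_conj, map_pow, RingHom.coe_coe]

theorem HasPrimeNorm.map {α : L} (τ : L ≃ₐ[Fq[X]] L) (h : HasPrimeNorm r a α) :
    HasPrimeNorm r a (τ α) := by
  obtain ⟨h1, h2, h3⟩ := h
  rw [HasPrimeNorm, minpoly.algEquiv_eq]
  exact ⟨h1.map τ, h2, h3⟩

variable [IsAlgClosed L]

/-- A cyclic self-isogeny with an automorphism of `L` applied to all coefficients. -/
def CyclicSelfIsogeny.conj (hr : 2 ≤ r) (ha : a.Monic) (hprime : (Ideal.span {a}).IsPrime)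
    (τ : L ≃ₐ[Fq[X]] L) (s : CyclicSelfIsogeny Fq L r a) : CyclicSelfIsogeny Fq L r a where
  φ := s.φ.conj τ
  f := TwistedPoly.conj (τ : L →+* L) s.f
  isMorphism := s.isMorphism.conj τ
  monic := s.monic.map _
  cyclic := ker_equiv_of_hasPrimeNorm (by omega) (s.isMorphism.conj τ) ha hprime (by
    rw [tc_conj]
    exact (s.hasPrimeNorm hr ha hprime).map τ)

theorem CyclicSelfIsogeny.conj_equiv {hr : 2 ≤ r} {ha : a.Monic}
    {hprime : (Ideal.span {a}).IsPrime} (τ : L ≃ₐ[Fq[X]] L) {s s' : CyclicSelfIsogeny Fq L r a}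
    (h : s ≈ s') : s.conj hr ha hprime τ ≈ s'.conj hr ha hprime τ := by
  obtain ⟨c, d, hc, hd, h⟩ := h
  let m : TwistedPoly Fq L →* TwistedPoly Fq L := (TwistedPoly.conj (τ : L →+* L)).toMonoidHom
  refine ⟨Units.map m c, Units.map m d, hc.conj τ, hd.conj τ, ?_⟩
  change TwistedPoly.conj (τ : L →+* L) s'.f = _
  rw [h, map_mul, map_mul]
  rfl

theorem CyclicSelfIsogeny.conj_symm_conj {hr : 2 ≤ r} {ha : a.Monic}
    {hprime : (Ideal.span {a}).IsPrime} (τ : L ≃ₐ[Fq[X]] L) (s : CyclicSelfIsogeny Fq L r a) :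
    (s.conj hr ha hprime τ).conj hr ha hprime τ.symm = s := by
  have hφ : (s.φ.conj τ).conj τ.symm = s.φ := by
    refine ext_t (ext_tc fun i => ?_)
    rw [t_conj, t_conj, tc_conj, tc_conj]
    exact τ.symm_apply_apply _
  have hf : TwistedPoly.conj (τ.symm : L →+* L) (TwistedPoly.conj (τ : L →+* L) s.f) = s.f := by
    refine ext_tc fun i => ?_
    rw [tc_conj, tc_conj]
    exact τ.symm_apply_apply _
  obtain ⟨φ, f, _, _, _⟩ := s
  simp only [CyclicSelfIsogeny.conj] at hφ hf ⊢
  congr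

/-- The modular polynomial is invariant under all automorphisms of `L` over `Fq[T]`. -/
theorem modularPoly_map (hr : 2 ≤ r) (ha : a.Monic) (hprime : (Ideal.span {a}).IsPrime)
    {δ : ℕ → ℕ} (hδ : IsBasicExponent (Fintype.card Fq) r δ) (τ : L ≃ₐ[Fq[X]] L) :
    (modularPoly Fq L hδ a).map (τ : L →+* L) = modularPoly Fq L hδ a := by
  have hfin := finite_cyclicSelfIsogenyClass Fq L hr ha hprime
  let T (τ : L ≃ₐ[Fq[X]] L) : CyclicSelfIsogenyClass Fq L r a → CyclicSelfIsogenyClass Fq L r a :=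
    Quotient.map (CyclicSelfIsogeny.conj hr ha hprime τ) fun _ _ h =>
      CyclicSelfIsogeny.conj_equiv τ h
  have hinj : Function.Injective (T τ) := by
    refine Function.LeftInverse.injective (g := T τ.symm) fun S => ?_
    induction S using Quotient.inductionOn with
    | _ s => exact congrArg (Quotient.mk _) (s.conj_symm_conj τ)
  rw [modularPoly]
  refine ((mapRingHom (τ : L →+* L)).toMonoidHom.map_finprod (Set.toFinite _)).trans ?_
  refine Eq.trans (finprod_congr fun S => ?_)
    (finprod_comp (T τ) (Finite.injective_iff_bijective.1 hinj))
  induction S using Quotient.inductionOn with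
  | _ s =>
  change (X - C _ : L[X]).map (τ : L →+* L) = _
  rw [Polynomial.map_sub, map_X, map_C]
  congr 2
  exact (J_conj δ τ s.φ).symm

/-- Every class of self-isogenies contains one for a Drinfeld module with leading coefficient `1`,
and then all coefficients are integral. -/
theorem exists_normalised (hr : 2 ≤ r) (ha : a.Monic) (hprime : (Ideal.span {a}).IsPrime)
    (S : CyclicSelfIsogenyClass Fq L r a) :
    ∃ (ψ : DrinfeldModule Fq L r) (u : TwistedPoly Fq L), baseClass Fq L S = Quotient.mk _ ψ ∧
      ψ.t.tc r = 1 ∧ u * ψ.t = ψ.t * u ∧ HasPrimeNorm r a (u.tc 0) ∧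
      ∀ i, IsIntegral Fq[X] (ψ.t.tc i) ∧ IsIntegral Fq[X] (u.tc i) := by
  induction S using Quotient.inductionOn with
  | _ s =>
  obtain ⟨c, hc, h1⟩ := s.φ.exists_scaled_tc_eq_one (by omega)
  have hu := scale_commute hc (t_scaled s.φ c hc) s.commute
  have hN : HasPrimeNorm r a ((scale c s.f).tc 0) := by
    rw [tc_zero_scale hc]; exact s.hasPrimeNorm hr ha hprime
  refine ⟨s.φ.scaled c hc, scale c s.f, (mk_scaled s.φ c hc).symm, h1, hu, hN, ?_⟩
  refine isIntegralElem_tc (algebraMap Fq[X] L) (fun c => ⟨C c, ?_⟩) hu ?_ ?_ ?_ ?_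
  · exact (IsScalarTower.algebraMap_apply Fq Fq[X] L c).symm
  · rw [tdeg_t]; omega
  · rw [tdeg_t, h1]
  · rw [tc_t_zero]; exact ⟨X, rfl⟩
  · rw [tdeg_t, tc_t_zero]
    exact le_natDegree_of_eval₂_eq_zero hN.1 hN.2.1

theorem J_eq_prod {δ : ℕ → ℕ} {ψ : DrinfeldModule Fq L r} (h : ψ.t.tc r = 1) :
    ψ.J δ = ∏ i ∈ Finset.Ico 1 r, ψ.t.tc i ^ δ i := by
  rw [J, g_eq_tc, h, one_pow, div_one]
  rfl

theorem isIntegral_jClass (hr : 2 ≤ r) (ha : a.Monic) (hprime : (Ideal.span {a}).IsPrime)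
    {δ : ℕ → ℕ} (hδ : IsBasicExponent (Fintype.card Fq) r δ) (S : CyclicSelfIsogenyClass Fq L r a) :
    IsIntegral Fq[X] (jClass Fq L hδ (baseClass Fq L S)) := by
  obtain ⟨ψ, u, hψ, h1, -, -, hint⟩ := exists_normalised hr ha hprime S
  rw [hψ]
  change IsIntegral Fq[X] (ψ.J δ)
  rw [J_eq_prod h1]
  exact IsIntegral.prod _ fun i _ => (hint i).1.pow _

/-- Automorphisms of a subfield extend to an algebraically closed field. -/
theorem exists_algEquiv_extending {F : Type*} [Field F] [Algebra F L] {K : IntermediateField F L}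
    (σ : K ≃ₐ[F] K) : ∃ τ : L ≃ₐ[F] L, ∀ x : K, τ x = σ x := by
  -- act on `K[v]` for a transcendence basis `v` of `L` over `K`, then extend to `L`,
  -- which is an algebraic closure of it
  obtain ⟨ι, v, hv⟩ := exists_isTranscendenceBasis' K L
  let e0 := hv.1.aevalEquiv
  let e : Algebra.adjoin K (Set.range v) ≃+* Algebra.adjoin K (Set.range v) :=
    (e0.symm.toRingEquiv.trans (MvPolynomial.mapEquiv ι σ.toRingEquiv)).trans e0.toRingEquiv
  have := IsAlgClosed.isAlgClosure_of_transcendence_basis v hv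
  let τ : L ≃+* L := IsAlgClosure.equivOfEquiv L L e
  have hτ : ∀ x : K, τ x = σ x := by
    intro x
    have h1 := IsAlgClosure.equivOfEquiv_algebraMap L L e (algebraMap K _ x)
    have h2 : e (algebraMap K _ x) = algebraMap K _ (σ x) := by
      change e0 (MvPolynomial.map _ (e0.symm (algebraMap K _ x))) = _
      rw [e0.symm.commutes, MvPolynomial.algebraMap_eq, MvPolynomial.map_C,
        ← MvPolynomial.algebraMap_eq]
      exact e0.commutes _
    rw [h2] at h1
    exact h1
  refine ⟨AlgEquiv.ofRingEquiv (f := τ) fun x => ?_, hτ⟩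
  have h1 := hτ (algebraMap F K x)
  rw [σ.commutes] at h1
  exact h1

/-- The modular polynomial has integral algebraic coefficients, invariant under the Galois
group. -/
theorem exists_map_eq_modularPoly (hr : 2 ≤ r) (ha : a.Monic) (hprime : (Ideal.span {a}).IsPrime)
    {δ : ℕ → ℕ} (hδ : IsBasicExponent (Fintype.card Fq) r δ) :
    ∃ P : (algebraicClosure (RatFunc Fq) L)[X],
      P.map (algebraMap (algebraicClosure (RatFunc Fq) L) L) = modularPoly Fq L hδ a ∧
      (∀ n, IsIntegral Fq[X] (P.coeff n)) ∧
      ∀ σ : algebraicClosure (RatFunc Fq) L ≃ₐ[RatFunc Fq] algebraicClosure (RatFunc Fq) L,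
        P.map (σ : algebraicClosure (RatFunc Fq) L →+* algebraicClosure (RatFunc Fq) L) = P := by
  have hfin := finite_cyclicSelfIsogenyClass Fq L hr ha hprime
  have hj := isIntegral_jClass (L := L) hr ha hprime hδ
  have hcoeff : ∀ n, IsIntegral Fq[X] ((modularPoly Fq L hδ a).coeff n) := by
    cases nonempty_fintype (CyclicSelfIsogenyClass Fq L r a)
    let Q : (integralClosure Fq[X] L)[X] := ∏ S : CyclicSelfIsogenyClass Fq L r a,
      (X - C ⟨_, hj S⟩)
    have hQ : modularPoly Fq L hδ a = Q.map (algebraMap (integralClosure Fq[X] L) L) := by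
      rw [modularPoly, finprod_eq_prod_of_fintype, Polynomial.map_prod]
      refine Finset.prod_congr rfl fun S _ => ?_
      rw [Polynomial.map_sub, map_X, map_C]
      rfl
    intro n
    rw [hQ, coeff_map]
    exact (Q.coeff n).2
  obtain ⟨P, hP⟩ : ∃ P : (algebraicClosure (RatFunc Fq) L)[X],
      P.map (algebraMap (algebraicClosure (RatFunc Fq) L) L) = modularPoly Fq L hδ a := by
    rw [← mem_lifts, lifts_iff_coeff_lifts]
    intro n
    exact ⟨⟨_, mem_algebraicClosure_iff.2
      ((hcoeff n).tower_top (A := RatFunc Fq)).isAlgebraic⟩, rfl⟩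
  have hinj := (algebraMap (algebraicClosure (RatFunc Fq) L) L).injective
  refine ⟨P, hP, fun n => ?_, fun σ => ?_⟩
  · have h1 := hcoeff n
    rw [← hP, coeff_map] at h1
    exact (isIntegral_algHom_iff
      (IsScalarTower.toAlgHom Fq[X] (algebraicClosure (RatFunc Fq) L) L) hinj).1 h1
  · obtain ⟨τ, hτ⟩ := exists_algEquiv_extending (L := L) σ
    refine Polynomial.map_injective _ hinj ?_
    have h1 := modularPoly_map hr ha hprime hδ (τ.restrictScalars Fq[X])
    rw [← hP, Polynomial.map_map] at h1
    rw [Polynomial.map_map, ← h1]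
    congr 1
    exact RingHom.ext fun x => (hτ x).symm

end Conj

end DrinfeldCM

namespace DrinfeldCM

/-! ### Infinitesimal rigidity of self-isogenies -/

open TwistedPoly DrinfeldModule

/-- If `α e₀` is the first row of `C` and an eigenvector for `α` has first coordinate `0`, then
`α` is a multiple root of the characteristic polynomial. -/
theorem not_separable_charpoly {k : Type*} [Field k] {n : ℕ} [NeZero n]
    {C : Matrix (Fin n) (Fin n) k} {α : k} (hrow : ∀ j, C 0 j = if j = 0 then α else 0)
    {η : Fin n → k} (hη : η ≠ 0) (h0 : η 0 = 0) (hC : C.mulVec η = α • η) :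
    ¬ C.charpoly.Separable := by
  obtain ⟨m, rfl⟩ : ∃ m, n = m + 1 := ⟨n - 1, by have := NeZero.ne n; omega⟩
  let C' := C.submatrix Fin.succ Fin.succ
  have h1 : C.charpoly = (X - Polynomial.C α) * C'.charpoly := by
    rw [Matrix.charpoly, Matrix.det_succ_row_zero, Finset.sum_eq_single 0]
    · rw [Fin.val_zero, pow_zero, one_mul, Matrix.charmatrix_apply, Matrix.diagonal_apply_eq, hrow,
        if_pos rfl]
      congr 2
      ext i j : 1
      simp only [Matrix.submatrix_apply, Matrix.charmatrix_apply, Fin.succAbove_zero,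
        Matrix.diagonal_apply, Fin.succ_inj, C']
    · intro j _ hj
      rw [Matrix.charmatrix_apply, Matrix.diagonal_apply_ne _ (Ne.symm hj), hrow, if_neg hj]
      simp
    · simp
  have h2 : C'.charpoly.eval α = 0 := by
    rw [Matrix.eval_charpoly, ← Matrix.exists_mulVec_eq_zero_iff]
    refine ⟨fun i => η i.succ, fun h => hη (funext fun i => ?_), ?_⟩
    · refine Fin.cases h0 (fun i => ?_) i
      exact congrFun h i
    · rw [Matrix.sub_mulVec, sub_eq_zero]
      ext i
      have h3 := congrFun hC i.succ
      rw [Matrix.mulVec, dotProduct, Fin.sum_univ_succ, h0, mul_zero, zero_add] at h3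
      simp only [Matrix.scalar_apply, Matrix.mulVec_diagonal]
      exact h3.symm
  intro hsep
  obtain ⟨D, hD⟩ := dvd_iff_isRoot.2 h2
  have h4 := hsep.squarefree (X - Polynomial.C α) ⟨D, by rw [h1, hD, mul_assoc]⟩
  exact not_isUnit_X_sub_C α h4

section Rigid

variable {Fq : Type*} [Field Fq] [Fintype Fq] {L : Type*} [Field L] [Algebra Fq L]

theorem X_sub_C_smul_toMotive (t m : TwistedPoly Fq L) (c : L) :
    (X - C c : L[X]) • toMotive t m = toMotive t (m * t - c • m) := by
  rw [sub_smul, X_smul_toMotive, C_smul_toMotive, map_sub]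

/-- The derivative of an element of the motive. -/
theorem tc_zero_symm_smul_toMotive (t : TwistedPoly Fq L) (P : L[X]) (m : TwistedPoly Fq L) :
    ((toMotive t).symm (P • toMotive t m)).tc 0 = P.eval (t.tc 0) * m.tc 0 := by
  induction P using Polynomial.induction_on' generalizing m with
  | add P Q hP hQ => rw [add_smul, map_add, tc_add, hP, hQ, eval_add, add_mul]
  | monomial n c =>
    rw [← C_mul_X_pow_eq_monomial, mul_smul, X_pow_smul_toMotive, C_smul_toMotive,
      LinearEquiv.symm_apply_apply, tc_smul, ← d0_apply, map_mul, map_pow, d0_apply, d0_apply]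
    simp only [eval_mul, eval_C, eval_pow, eval_X]
    ring

theorem exists_smul_toMotive_eq (t : TwistedPoly Fq L) (P : L[X]) (n : Motive t) (c : L) :
    ∃ w : Motive t, P • n = (C (P.eval c) : L[X]) • n + (X - C c : L[X]) • w := by
  obtain ⟨Q, hQ⟩ := X_sub_C_dvd_sub_C_eval (a := c) (p := P)
  refine ⟨Q • n, ?_⟩
  rw [← mul_smul, ← hQ, sub_smul]
  abel

/-- An element of degree less than `deg t` that is divisible by `X - c` in the motive of `t`
vanishes. -/
theorem eq_zero_of_toMotive_eq_smul {t m : TwistedPoly Fq L} (ht : t.tdeg ≠ 0) {c : L}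
    (hm : ∀ i ≥ t.tdeg, m.tc i = 0) {w : Motive t} (h : toMotive t m = (X - C c : L[X]) • w) :
    m = 0 := by
  have ht0 : t ≠ 0 := by rintro rfl; simp [TwistedPoly.tdeg, TwistedPoly.poly_zero] at ht
  obtain ⟨v, rfl⟩ := (toMotive t).surjective w
  rw [X_sub_C_smul_toMotive] at h
  have h1 : m = v * t - c • v := (toMotive t).injective h
  rcases eq_or_ne v 0 with rfl | hv
  · rw [h1]; simp
  exfalso
  have h2 := hm (v.tdeg + t.tdeg) (by omega)
  rw [h1, tc_sub, tc_smul, tc_eq_zero_of_tdeg_lt (f := v) (by omega), mul_zero, sub_zero,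
    ← tdeg_mul hv ht0] at h2
  exact tc_tdeg_ne_zero (mul_ne_zero hv ht0) h2

/-- If the derivative of `u` is a simple root of the characteristic polynomial of `u` on the
motive of `t`, then the pair `(t, u)` has no first order deformations that fix both derivatives and
the leading coefficient of `t`: such a deformation `η` of `t` is an eigenvector of `u` on the fibre
of the motive at `t.tc 0`. -/
theorem eq_zero_of_deformation {t u : TwistedPoly Fq L} (ht : t.tdeg ≠ 0) (h : u * t = t * u)
    {p : Fq[X][X]} (hp : p.Monic) (hpdeg : p.natDegree = t.tdeg) (hp0 : evalPair t u p = 0)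
    (hmin : ∀ Q : Fq[X][X], Q.degree < t.tdeg → evalPair t u Q = 0 → Q = 0)
    (hsep : (p.map (aeval (t.tc 0) : Fq[X] →ₐ[Fq] L).toRingHom).Separable)
    {η v : TwistedPoly Fq L} (hη0 : η.tc 0 = 0) (hη : ∀ i ≥ t.tdeg, η.tc i = 0)
    (hv : v * t + u.tc 0 • η = η * u + t.tc 0 • v) : η = 0 := by
  obtain ⟨B, hB, -⟩ := exists_motive_matrix ht h
  have hχ := charpoly_motive_eq ht h hB hp hpdeg hp0 hmin
  have hB' := Matrix.represents_iff'.1 hB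
  set θ := t.tc 0
  set α := u.tc 0
  have : NeZero t.tdeg := ⟨ht⟩
  let C' : Matrix (Fin t.tdeg) (Fin t.tdeg) L := B.map (evalRingHom θ)
  have hC' : C'.charpoly.Separable := by
    have h1 : (evalRingHom θ).comp (mapRingHom (algebraMap Fq L)) =
        (aeval θ : Fq[X] →ₐ[Fq] L).toRingHom :=
      Polynomial.ringHom_ext (fun c => by simp) (by simp)
    rwa [Matrix.charpoly_map, hχ, Polynomial.map_map, h1]
  have hηsum : η = ∑ j : Fin t.tdeg, mono (η.tc j) (j : ℕ) := by
    conv_lhs => rw [eq_sum_mono η hη]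
    exact Finset.sum_range _
  have hmono : ∀ (c : L) (j : Fin t.tdeg),
      toMotive t (mono c (j : ℕ)) = (C c : L[X]) • motiveGen t j := by
    intro c j
    rw [C_smul_toMotive]
    congr 1
    exact ext_tc fun i => by simp
  -- modulo `X - θ`, the endomorphism `u` has the matrix `C'`
  have hred : ∀ j, ∃ w : Motive t, motiveEnd h (motiveGen t j) =
      ∑ i, (C (C' i j) : L[X]) • motiveGen t i + (X - C θ : L[X]) • w := by
    intro j
    choose w hw using fun i => exists_smul_toMotive_eq t (B i j) (motiveGen t i) θ
    refine ⟨∑ i, w i, ?_⟩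
    rw [← hB' j, Finset.smul_sum, ← Finset.sum_add_distrib]
    exact Finset.sum_congr rfl fun i _ => hw i
  choose w hw using hred
  by_contra hne
  refine not_separable_charpoly (C := C') (α := α) (η := fun j => η.tc j) (fun j => ?_)
    (fun h0 => hne ?_) ?_ ?_ hC'
  -- the first row of `C'`, read off from derivatives
  · have h1 := congrArg (fun n => ((toMotive t).symm n).tc 0) (hB' j)
    simp only [motiveEnd_toMotive, LinearEquiv.symm_apply_apply] at h1
    rw [map_sum, tc_sum] at h1
    simp only [tc_zero_symm_smul_toMotive] at h1
    rw [Finset.sum_eq_single 0 (fun i _ hi => by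
      rw [tc_mono, if_neg (fun h => hi (Fin.ext h.symm)), mul_zero]) (by simp)] at h1
    rw [← d0_apply (_ * _), map_mul, d0_apply, d0_apply] at h1
    simp only [tc_mono, Fin.val_zero, if_true, mul_one] at h1
    change (B 0 j).eval θ = _
    rw [h1]
    by_cases hj : j = 0
    · simp [hj, α]
    · have hj' : ¬ 0 = (j : ℕ) := fun h => hj (Fin.ext h.symm)
      simp [hj, hj']
  · rw [hηsum]
    refine Finset.sum_eq_zero fun j _ => ?_
    rw [show η.tc j = 0 from congrFun h0 j]
    exact ext_tc fun i => by simp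
  · simpa using hη0
  · set κ : Fin t.tdeg → L := fun j => η.tc j with hκ
    have h1 : toMotive t (η * u) =
        (C α : L[X]) • toMotive t η + (X - C θ : L[X]) • toMotive t v := by
      rw [C_smul_toMotive, X_sub_C_smul_toMotive, ← map_add, eq_sub_of_add_eq hv.symm]
      congr 1
      abel
    have h2 : toMotive t η = ∑ j, (C (κ j) : L[X]) • motiveGen t j := by
      conv_lhs => rw [hηsum]
      rw [map_sum]
      exact Finset.sum_congr rfl fun j _ => hmono _ _
    have h3 : toMotive t (η * u) = ∑ i, (C (C'.mulVec κ i) : L[X]) • motiveGen t i +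
        (X - C θ : L[X]) • ∑ j, (C (κ j) : L[X]) • w j := by
      rw [← motiveEnd_toMotive h, h2, map_sum]
      simp only [map_smul, hw, smul_add, Finset.smul_sum, Finset.sum_add_distrib]
      rw [Finset.sum_comm]
      congr 1
      · refine Finset.sum_congr rfl fun i _ => ?_
        rw [Matrix.mulVec, dotProduct, map_sum, Finset.sum_smul]
        refine Finset.sum_congr rfl fun j _ => ?_
        rw [← mul_smul, ← C_mul, mul_comm]
      · refine Finset.sum_congr rfl fun j _ => ?_
        rw [smul_comm]
    -- the difference `C' κ - α κ` is divisible by `X - θ` and of low degree, so it vanishes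
    have h4 : toMotive t (∑ i : Fin t.tdeg, mono (C'.mulVec κ i - α * κ i) (i : ℕ)) =
        (X - C θ : L[X]) • (toMotive t v - ∑ j, (C (κ j) : L[X]) • w j) := by
      have h5 : ∀ i, toMotive t (mono (C'.mulVec κ i - α * κ i) (i : ℕ)) =
          (C (C'.mulVec κ i) : L[X]) • motiveGen t i -
            (C α : L[X]) • (C (κ i) : L[X]) • motiveGen t i :=
        fun i => by rw [hmono, C_sub, C_mul, sub_smul, mul_smul]
      rw [map_sum, Finset.sum_congr rfl fun i _ => h5 i, Finset.sum_sub_distrib, ← Finset.smul_sum,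
        ← h2, smul_sub (X - C θ : L[X]) _ _]
      rw [h1] at h3
      rw [sub_eq_sub_iff_add_eq_add, ← h3]
      abel
    have h5 := eq_zero_of_toMotive_eq_smul ht (fun i hi => ?_) h4
    · ext i
      have h6 := congrArg (fun f => f.tc (i : ℕ)) h5
      simp only [tc_sum, tc_zero, tc_mono] at h6
      rw [Finset.sum_eq_single i (fun j _ hj => if_neg fun h => hj (Fin.ext h.symm)) (by simp),
        if_pos rfl] at h6
      exact sub_eq_zero.1 h6
    · rw [tc_sum]
      exact Finset.sum_eq_zero fun j _ => by rw [tc_mono, if_neg (by omega)]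

/-- An additive map applied to the coefficients of a twisted polynomial. -/
def mapCoeff (π : L →+ L) (f : TwistedPoly Fq L) : TwistedPoly Fq L :=
  ofCoeffs (fun i => π (f.tc i)) f.tdeg

theorem tc_mapCoeff (π : L →+ L) (f : TwistedPoly Fq L) (i : ℕ) :
    (mapCoeff π f).tc i = π (f.tc i) :=
  tc_ofCoeffs _ (fun i hi => by rw [tc_eq_zero_of_tdeg_lt hi, map_zero]) i

/-- A linear map over a subfield `E` that kills `1` acts as a derivation on products of twisted
polynomials whose coefficients have `q`-th powers in `E`. -/
theorem mapCoeff_mul {E : Subfield L} (π : L →ₗ[E] L) (h1 : π 1 = 0) {f g : TwistedPoly Fq L}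
    (hf : f.tc 0 ∈ E) (hg : ∀ i j, g.tc i ^ (Fintype.card Fq ^ (j + 1)) ∈ E) :
    mapCoeff π.toAddMonoidHom (f * g) =
      mapCoeff π.toAddMonoidHom f * g + f.tc 0 • mapCoeff π.toAddMonoidHom g := by
  have hπ : ∀ c ∈ E, ∀ x, π (c * x) = c * π x := fun c hc x => π.map_smul ⟨c, hc⟩ x
  have h0 : π (f.tc 0) = 0 := by rw [← mul_one (f.tc 0), hπ _ hf, h1, mul_zero]
  refine ext_tc fun n => ?_
  rw [tc_mapCoeff, tc_add, tc_smul, tc_mul, tc_mul,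
    Finset.Nat.sum_antidiagonal_eq_sum_range_succ_mk,
    Finset.Nat.sum_antidiagonal_eq_sum_range_succ_mk, Finset.sum_range_succ',
    Finset.sum_range_succ']
  simp only [tc_mapCoeff, LinearMap.toAddMonoidHom_coe, pow_zero, pow_one, Nat.sub_zero, map_add,
    map_sum, h0, zero_mul, add_zero, hπ _ hf]
  congr 1
  refine Finset.sum_congr rfl fun i _ => ?_
  rw [mul_comm, hπ _ (hg _ _), mul_comm]

/-- The coefficients of a commuting pair `(t, u)` without first order deformations lie in every
subfield that contains the derivatives and the `q`-th powers of all coefficients. -/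
theorem tc_mem_of_pow_mem {t u : TwistedPoly Fq L} (ht : t.tdeg ≠ 0) (h : u * t = t * u)
    (hlead : t.tc t.tdeg = 1)
    (hrig : ∀ η v : TwistedPoly Fq L, η.tc 0 = 0 → (∀ i ≥ t.tdeg, η.tc i = 0) →
      v * t + u.tc 0 • η = η * u + t.tc 0 • v → η = 0)
    {E : Subfield L} (ht0 : t.tc 0 ∈ E) (hu0 : u.tc 0 ∈ E)
    (htE : ∀ i j, t.tc i ^ (Fintype.card Fq ^ (j + 1)) ∈ E)
    (huE : ∀ i j, u.tc i ^ (Fintype.card Fq ^ (j + 1)) ∈ E) (i : ℕ) :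
    t.tc i ∈ E ∧ u.tc i ∈ E := by
  have ht00 : t ≠ 0 := by rintro rfl; simp [TwistedPoly.tdeg, TwistedPoly.poly_zero] at ht
  -- apply a linear map `π` killing `E` to the coefficients of `u t = t u`
  have key : ∀ π : L →ₗ[E] L, π 1 = 0 → (∀ i, π (t.tc i) = 0) ∧ ∀ i, π (u.tc i) = 0 := by
    intro π h1
    have hπE : ∀ c ∈ E, π c = 0 := fun c hc => by
      have := π.map_smul ⟨c, hc⟩ 1
      rw [h1, smul_zero] at this
      rwa [← mul_one c]
    have hrel := congrArg (mapCoeff π.toAddMonoidHom) h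
    rw [mapCoeff_mul π h1 hu0 htE, mapCoeff_mul π h1 ht0 huE] at hrel
    have hη := hrig _ _ (by rw [tc_mapCoeff]; exact hπE _ ht0) (fun i hi => ?_) hrel
    · refine ⟨fun i => ?_, fun i => ?_⟩
      · rw [← LinearMap.toAddMonoidHom_coe, ← tc_mapCoeff, hη, tc_zero]
      · have hv0 : mapCoeff π.toAddMonoidHom u = 0 := by
          rw [hη, smul_zero, zero_mul, add_zero, zero_add] at hrel
          -- `v t = θ v` contradicts the degrees
          by_contra hv
          have h2 := congrArg tdeg hrel
          rw [tdeg_mul hv ht00] at h2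
          have h3 : (t.tc 0 • mapCoeff π.toAddMonoidHom u).tdeg ≤
              (mapCoeff π.toAddMonoidHom u).tdeg := tdeg_le_of_forall fun i hi => by
            rw [tc_smul, tc_eq_zero_of_tdeg_lt hi, mul_zero]
          omega
        rw [← LinearMap.toAddMonoidHom_coe, ← tc_mapCoeff, hv0, tc_zero]
    · rw [tc_mapCoeff]
      rcases eq_or_lt_of_le hi with rfl | hi
      · rw [hlead]; exact h1
      · rw [tc_eq_zero_of_tdeg_lt hi, map_zero]
  -- an element outside of `E` is not killed by all these maps
  have hmem : ∀ x : L, (∀ π : L →ₗ[E] L, π 1 = 0 → π x = 0) → x ∈ E := by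
    intro x hx
    by_contra hxE
    have h1 : x ∉ Submodule.span E {(1 : L)} := by
      rw [Submodule.mem_span_singleton]
      rintro ⟨c, rfl⟩
      refine hxE ?_
      rw [Subfield.smul_def, smul_eq_mul, mul_one]
      exact c.2
    obtain ⟨f, hf, hle⟩ := Submodule.exists_le_ker_of_notMem h1
    have h2 : f 1 = 0 := hle (Submodule.mem_span_singleton_self 1)
    refine hf ?_
    have h3 := hx ((Algebra.linearMap E L).comp f) (by simp [h2])
    simpa using h3
  exact ⟨hmem _ fun π hπ => (key π hπ).1 i, hmem _ fun π hπ => (key π hπ).2 i⟩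

end Rigid

end DrinfeldCM

namespace DrinfeldCM

/-! ### Separability and descent of the modular polynomial -/

open TwistedPoly DrinfeldModule

theorem exists_isSeparable_pow_of_isAlgebraic {F K : Type*} [Field F] [Field K] [Algebra F K]
    [Algebra.IsAlgebraic F K] (p : ℕ) [ExpChar F p] (y : K) : ∃ n, IsSeparable F (y ^ p ^ n) := by
  have : ExpChar (separableClosure F K) p :=
    expChar_of_injective_algebraMap (algebraMap F (separableClosure F K)).injective p
  obtain ⟨n, z, hz⟩ := IsPurelyInseparable.pow_mem (separableClosure F K) p y
  refine ⟨n, ?_⟩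
  rw [← hz]
  exact mem_separableClosure_iff.1 z.2

/-- A sufficiently high `p`-power of an algebraic element is separable. -/
theorem exists_isSeparable_pow {F L : Type*} [Field F] [Field L] [Algebra F L] (p : ℕ)
    [ExpChar F p] {x : L} (hx : IsAlgebraic F x) : ∃ n, IsSeparable F (x ^ p ^ n) := by
  obtain ⟨n, hn⟩ := exists_isSeparable_pow_of_isAlgebraic (F := F) p
    (⟨x, mem_algebraicClosure_iff.2 hx⟩ : algebraicClosure F L)
  have h := (isSeparable_map_iff (algebraicClosure F L).val Subtype.val_injective).2 hn
  rw [map_pow] at h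
  exact ⟨n, h⟩

/-- A separable algebraic element fixed by the Galois group is rational. -/
theorem mem_range_algebraMap_of_fixed {F K : Type*} [Field F] [Field K] [Algebra F K] [Normal F K]
    {x : K} (hx : IsSeparable F x) (h : ∀ σ : K ≃ₐ[F] K, σ x = x) :
    x ∈ (algebraMap F K).range := by
  rw [← minpoly.natDegree_eq_one_iff,
    ← card_rootSet_eq_natDegree (K := K) hx (Normal.splits inferInstance x)]
  have hint := hx.isIntegral
  refine Fintype.card_eq_one_iff.2 ⟨⟨x, ?_⟩, fun y => Subtype.ext ?_⟩
  · exact (mem_rootSet_of_ne (minpoly.ne_zero hint)).2 (minpoly.aeval F x)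
  · obtain ⟨σ, hσ⟩ := minpoly.exists_algEquiv_of_root' (K := F) hint.isAlgebraic
      ((mem_rootSet_of_ne (minpoly.ne_zero hint)).1 y.2)
    rw [← hσ, h]

section

variable {Fq : Type*} [Field Fq] [Fintype Fq] {L : Type*} [Field L] [Algebra Fq L]
  [Algebra Fq[X] L] [Algebra (RatFunc Fq) L] [IsScalarTower Fq Fq[X] L]
  [IsScalarTower Fq[X] (RatFunc Fq) L] {r : ℕ} {a : Fq[X]}

/-- The degree `r` of an inseparable element is divisible by the characteristic. -/
theorem HasPrimeNorm.isSeparable {α : L} (h : HasPrimeNorm r a α) (hp : ¬ ringChar Fq ∣ r) :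
    IsSeparable (RatFunc Fq) α := by
  have hchar := ringChar.charP Fq
  have : CharP (RatFunc Fq) (ringChar Fq) :=
    charP_of_injective_algebraMap (algebraMap Fq (RatFunc Fq)).injective _
  rcases separable_or (ringChar Fq) (minpoly.irreducible (A := RatFunc Fq) h.1.tower_top) with
    hs | ⟨-, g, -, hg⟩
  · exact hs
  · refine absurd ?_ hp
    rw [← h.2.1, ← natDegree_minpoly_ratFunc h.1, ← hg, natDegree_expand]
    exact dvd_mul_left _ _

variable [IsAlgClosed L]

/-- A normalised Drinfeld module with an endomorphism whose derivative is separable and of maximal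
degree is defined over the separable closure of `Fq(T)`. -/
theorem isSeparable_tc (hr : 2 ≤ r) {ψ : DrinfeldModule Fq L r} {u : TwistedPoly Fq L}
    (h1 : ψ.t.tc r = 1) (hu : u * ψ.t = ψ.t * u) (hα : HasPrimeNorm r a (u.tc 0))
    (hint : ∀ i, IsIntegral Fq[X] (ψ.t.tc i) ∧ IsIntegral Fq[X] (u.tc i))
    (hsep : IsSeparable (RatFunc Fq) (u.tc 0)) (i : ℕ) : IsSeparable (RatFunc Fq) (ψ.t.tc i) := by
  have := faithfulSMul_polynomial Fq L
  have ht : ψ.t.tdeg ≠ 0 := by rw [ψ.tdeg_t]; omega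
  -- the derivative of `u` is a simple root of its minimal polynomial, which is the characteristic
  -- polynomial of `u` on the motive
  have hrig : ∀ η v : TwistedPoly Fq L, η.tc 0 = 0 → (∀ i ≥ ψ.t.tdeg, η.tc i = 0) →
      v * ψ.t + u.tc 0 • η = η * u + ψ.t.tc 0 • v → η = 0 := by
    intro η v
    refine eq_zero_of_deformation ht hu (minpoly.monic hα.1) ?_ ?_ ?_ ?_
    · rw [ψ.tdeg_t, hα.2.1]
    · rw [ψ.evalPair_eq_zero_iff hu, minpoly.aeval]
    · intro Q hQ h0
      rw [ψ.evalPair_eq_zero_iff hu] at h0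
      by_contra hQ0
      have h2 := natDegree_le_of_dvd (minpoly.isIntegrallyClosed_dvd hα.1 h0) hQ0
      rw [hα.2.1] at h2
      rw [ψ.tdeg_t] at hQ
      exact absurd ((natDegree_lt_iff_degree_lt hQ0).2 hQ) (by omega)
    · rw [ψ.tc_t_zero, aeval_algebraMap_X_toRingHom,
        IsScalarTower.algebraMap_eq Fq[X] (RatFunc Fq) L, ← Polynomial.map_map,
        ← minpoly_ratFunc hα.1]
      exact Polynomial.Separable.map hsep
  obtain ⟨p, hchar, n, hp, hcard⟩ := FiniteField.card' Fq
  have : ExpChar Fq p := ExpChar.prime hp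
  have : ExpChar (RatFunc Fq) p :=
    expChar_of_injective_algebraMap (algebraMap Fq (RatFunc Fq)).injective p
  have : ExpChar L p := expChar_of_injective_algebraMap (algebraMap Fq L).injective p
  obtain ⟨e, he⟩ : ∃ e, Fintype.card Fq = p ^ (e + 1) :=
    ⟨n.natPred, by rw [hcard, PNat.natPred_add_one]⟩
  -- `E k` consists of the elements whose `p^k`-th power is separable
  let E (k : ℕ) : Subfield L :=
    (separableClosure (RatFunc Fq) L).toSubfield.comap (iterateFrobenius L p k)
  have hE : ∀ k x, x ∈ E k ↔ IsSeparable (RatFunc Fq) (x ^ p ^ k) := fun k x => by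
    change iterateFrobenius L p k x ∈ separableClosure (RatFunc Fq) L ↔ _
    rw [mem_separableClosure_iff, iterateFrobenius_def]
  have hpow : ∀ k x, x ∈ E k → ∀ n, x ^ n ∈ E k := fun k x hx n => pow_mem hx n
  have hmono : ∀ k l x, x ∈ E k → x ∈ E (k + l) := by
    intro k l x hx
    rw [hE] at hx ⊢
    rw [pow_add, pow_mul]
    rw [← mem_separableClosure_iff] at hx ⊢
    exact pow_mem hx _
  -- rigidity removes one `p`-th root at a time
  have hstep : ∀ k, ((∀ i, ψ.t.tc i ∈ E (k + 1)) ∧ ∀ i, u.tc i ∈ E (k + 1)) →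
      (∀ i, ψ.t.tc i ∈ E k) ∧ ∀ i, u.tc i ∈ E k := by
    rintro k ⟨htk, huk⟩
    have hq : ∀ x ∈ E (k + 1), ∀ j, x ^ Fintype.card Fq ^ (j + 1) ∈ E k := by
      intro x hx j
      have h2 : x ^ p ∈ E k := by
        rw [hE] at hx ⊢
        rwa [← pow_mul, ← pow_succ']
      rw [he, ← pow_mul, show (e + 1) * (j + 1) = (e * j + e + j) + 1 by ring, pow_succ', pow_mul]
      exact hpow _ _ h2 _
    have h0 : ∀ x, IsSeparable (RatFunc Fq) x → x ∈ E k := fun x hx => by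
      have := hmono 0 k x ((hE 0 x).2 (by rwa [pow_zero, pow_one]))
      rwa [zero_add] at this
    have h3 := tc_mem_of_pow_mem ht hu (by rw [ψ.tdeg_t, h1]) hrig (E := E k) (h0 _ ?_) (h0 _ hsep)
      (fun i => hq _ (htk i)) (fun i => hq _ (huk i))
    · exact ⟨fun i => (h3 i).1, fun i => (h3 i).2⟩
    · rw [ψ.tc_t_zero, IsScalarTower.algebraMap_apply Fq[X] (RatFunc Fq) L]
      exact isSeparable_algebraMap _
  have hdown : ∀ k, ((∀ i, ψ.t.tc i ∈ E k) ∧ ∀ i, u.tc i ∈ E k) →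
      (∀ i, ψ.t.tc i ∈ E 0) ∧ ∀ i, u.tc i ∈ E 0 := by
    intro k
    induction k with
    | zero => exact id
    | succ k ih => exact fun h => ih (hstep k h)
  have hex : ∀ f : TwistedPoly Fq L, (∀ i, IsIntegral Fq[X] (f.tc i)) →
      ∃ N, ∀ l i, f.tc i ∈ E (N + l) := by
    intro f hf
    choose N hN using fun i => exists_isSeparable_pow (F := RatFunc Fq) p
      ((hf i).tower_top (A := RatFunc Fq)).isAlgebraic
    refine ⟨(Finset.range (f.tdeg + 1)).sup N, fun l i => ?_⟩
    by_cases hi : i ≤ f.tdeg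
    · have hle : N i ≤ (Finset.range (f.tdeg + 1)).sup N :=
        Finset.le_sup (f := N) (Finset.mem_range.2 (by omega))
      obtain ⟨m, hm⟩ := Nat.exists_eq_add_of_le hle
      rw [hm, add_assoc]
      exact hmono _ _ _ ((hE _ _).2 (hN i))
    · rw [tc_eq_zero_of_tdeg_lt (not_le.1 hi)]
      exact zero_mem _
  obtain ⟨N, hN⟩ := hex ψ.t fun i => (hint i).1
  obtain ⟨M, hM⟩ := hex u fun i => (hint i).2
  have h4 := (hdown (N + M) ⟨hN M, fun i => by rw [add_comm]; exact hM N i⟩).1 i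
  rwa [hE, pow_zero, pow_one] at h4

/-- If the characteristic does not divide `r`, the modular polynomial has coefficients in
`Fq[T]`. -/
theorem exists_map_polynomial_eq_modularPoly (hr : 2 ≤ r) (ha : a.Monic)
    (hprime : (Ideal.span {a}).IsPrime) {δ : ℕ → ℕ} (hδ : IsBasicExponent (Fintype.card Fq) r δ)
    (hp : ¬ ringChar Fq ∣ r) :
    ∃ P : Fq[X][X], P.map (algebraMap Fq[X] L) = modularPoly Fq L hδ a := by
  have hfin := finite_cyclicSelfIsogenyClass Fq L hr ha hprime
  obtain ⟨P, hP, hint, hσ⟩ := exists_map_eq_modularPoly (L := L) hr ha hprime hδ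
  have hj : ∀ S : CyclicSelfIsogenyClass Fq L r a,
      jClass Fq L hδ (baseClass Fq L S) ∈ separableClosure (RatFunc Fq) L := by
    intro S
    obtain ⟨ψ, u, hψ, h1, hu, hα, hint⟩ := exists_normalised hr ha hprime S
    rw [hψ]
    change ψ.J δ ∈ _
    rw [J_eq_prod h1]
    refine prod_mem fun i _ => pow_mem (mem_separableClosure_iff.2 ?_) _
    exact isSeparable_tc hr h1 hu hα hint (hα.isSeparable hp) i
  have hcoeff : ∀ n, (modularPoly Fq L hδ a).coeff n ∈ separableClosure (RatFunc Fq) L := by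
    cases nonempty_fintype (CyclicSelfIsogenyClass Fq L r a)
    let Q : (separableClosure (RatFunc Fq) L)[X] := ∏ S : CyclicSelfIsogenyClass Fq L r a,
      (X - C ⟨_, hj S⟩)
    have hQ : modularPoly Fq L hδ a = Q.map (algebraMap (separableClosure (RatFunc Fq) L) L) := by
      rw [modularPoly, finprod_eq_prod_of_fintype, Polynomial.map_prod]
      refine Finset.prod_congr rfl fun S _ => ?_
      rw [Polynomial.map_sub, map_X, map_C]
      rfl
    intro n
    rw [hQ, coeff_map]
    exact (Q.coeff n).2
  rw [← mem_lifts, lifts_iff_coeff_lifts]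
  intro n
  have h1 : IsSeparable (RatFunc Fq) (P.coeff n) := by
    have h2 := hcoeff n
    rw [← hP, coeff_map, mem_separableClosure_iff] at h2
    exact (isSeparable_map_iff (algebraicClosure (RatFunc Fq) L).val Subtype.val_injective).1 h2
  have : Normal (RatFunc Fq) (algebraicClosure (RatFunc Fq) L) := inferInstance
  -- the coefficients are separable and fixed by the Galois group, hence in `Fq(T)`; being integral,
  -- they lie in `Fq[T]`
  obtain ⟨c, hc⟩ := mem_range_algebraMap_of_fixed h1 fun σ => by
    have h2 := congrArg (fun Q => Q.coeff n) (hσ σ)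
    rwa [coeff_map] at h2
  have h3 := hint n
  rw [← hc, isIntegral_algebraMap_iff (algebraMap (RatFunc Fq) _).injective,
    IsIntegrallyClosed.isIntegral_iff] at h3
  obtain ⟨b, hb⟩ := h3
  refine ⟨b, ?_⟩
  rw [← hP, coeff_map, ← hc, ← hb, IsScalarTower.algebraMap_apply Fq[X] (RatFunc Fq) L]
  rfl

end

end DrinfeldCM

end

theorem mainTheorem1 (Fq : Type*) [Field Fq] [Fintype Fq] (L : Type*) [Field L] [IsAlgClosed L]
    [Algebra Fq L] [Algebra Fq[X] L] [Algebra (RatFunc Fq) L]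
    [IsScalarTower Fq Fq[X] L] [IsScalarTower Fq[X] (RatFunc Fq) L]
    (r : ℕ) (hr : 2 ≤ r) (δ : ℕ → ℕ)
    (hδ : DrinfeldCM.DrinfeldModule.IsBasicExponent (Fintype.card Fq) r δ)
    (a : Fq[X]) (ha : a.Monic) (hprime : (Ideal.span {a}).IsPrime) :
    Finite (DrinfeldCM.CyclicSelfIsogenyClass Fq L r a) ∧
    (∀ O : Subalgebra Fq[X] L, DrinfeldCM.IsImaginaryOrder r O →
      (DrinfeldCM.cmClasses r O).Finite ∧ (DrinfeldCM.normClasses O a).Finite) ∧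
    (∀ R : Set (Subalgebra Fq[X] L), DrinfeldCM.IsOrderReps r R →
      {O ∈ R | DrinfeldCM.gammaExp O a ≠ 0}.Finite ∧
      DrinfeldCM.modularPoly Fq L hδ a =
        ∏ᶠ O ∈ R, DrinfeldCM.hilbertClassPoly hδ O ^ DrinfeldCM.gammaExp O a) ∧
    (∃ P : (algebraicClosure (RatFunc Fq) L)[X],
      P.map (algebraMap (algebraicClosure (RatFunc Fq) L) L) = DrinfeldCM.modularPoly Fq L hδ a ∧
      (∀ n, IsIntegral Fq[X] (P.coeff n)) ∧
      ∀ σ : algebraicClosure (RatFunc Fq) L ≃ₐ[RatFunc Fq] algebraicClosure (RatFunc Fq) L,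
        P.map (σ : algebraicClosure (RatFunc Fq) L →+* algebraicClosure (RatFunc Fq) L) = P) ∧
    (¬ ringChar Fq ∣ r →
      ∃ P : Fq[X][X], P.map (algebraMap Fq[X] L) = DrinfeldCM.modularPoly Fq L hδ a) := by
  refine ⟨DrinfeldCM.finite_cyclicSelfIsogenyClass Fq L hr ha hprime, fun O hO => ⟨?_, ?_⟩,
    fun R hR => DrinfeldCM.modularPoly_eq_finprod hr ha hprime hδ hR,
    DrinfeldCM.exists_map_eq_modularPoly hr ha hprime hδ,
    DrinfeldCM.exists_map_polynomial_eq_modularPoly hr ha hprime hδ⟩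
  · exact DrinfeldCM.DrinfeldModule.finite_cmClasses (by omega) hO
  · exact DrinfeldCM.finite_normClasses hr hO (DrinfeldCM.prime_of_isPrime_span ha hprime).1
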